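/- Define the integers $a(n)$, $n\ge 1$, by $$\sum_{n=1}^{\infty} a(n)q^n=\phi(q):=\sum_{n=0}^{\infty}\frac{(-q;q)_{2n}\,q^{n+1}}{(q;q^2)_{n+1}^2},$$ where $(x;q)_0:=1$ and $(x;q)_n:=\prod_{k=0}^{n-1}(1-xq^k)$ for $n\ge 1$. Then, for every integer $n\ge 0$ and each $r\in\{1,3,4\}$, $$a(1250n+250r+219)\equiv 0\pmod{125}.$$ -/

import Mathlib

namespace RamanujanPhi

open PowerSeries
open scoped PowerSeries.WithPiTopology

/-- The finite `q`-shifted factorial `(a; q)_n = ∏_{0 ≤ k < n} (1 - a q ^ k)`. -/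
def qPoch {R : Type*} [CommRing R] (a q : R) (n : ℕ) : R :=
  ∏ k ∈ Finset.range n, (1 - a * q ^ k)

/-- The `n`-th summand `(-q; q)_{2n} q^{n+1} / (q; q^2)_{n+1}^2` of `φ(q)`, as a formal power
series in `q = X`. The denominator has constant coefficient `1`, and `invOfUnit _ 1` is its
multiplicative inverse in `ℤ⟦X⟧` (see `denom_mul_invOfUnit`). -/
noncomputable def phiTerm (n : ℕ) : PowerSeries ℤ :=
  qPoch (-X) X (2 * n) * X ^ (n + 1) * invOfUnit (qPoch X (X ^ 2) (n + 1) ^ 2) 1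

/-- The function `φ(q) = ∑_{n ≥ 0} (-q; q)_{2n} q^{n+1} / (q; q^2)_{n+1}^2`, as a formal power
series in `q`. The sum converges coefficientwise (see `hasSum_phiTerm`). -/
noncomputable def phi : PowerSeries ℤ := ∑' n : ℕ, phiTerm n

/-- The coefficients `a(n)` of `φ(q) = ∑ a(n) q^n`; here `a(0) = 0`. -/
noncomputable def a (n : ℕ) : ℤ := coeff n phi

theorem denom_mul_invOfUnit (n : ℕ) :
    qPoch (X : PowerSeries ℤ) (X ^ 2) (n + 1) ^ 2 *
      invOfUnit (qPoch (X : PowerSeries ℤ) (X ^ 2) (n + 1) ^ 2) 1 = 1 := by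
  apply mul_invOfUnit
  simp [qPoch, map_prod]

theorem coeff_phiTerm_of_le {m n : ℕ} (h : m ≤ n) : coeff m (phiTerm n) = 0 := by
  have hd : (X : PowerSeries ℤ) ^ (n + 1) ∣ phiTerm n :=
    ((Dvd.intro_left _ rfl : (X : PowerSeries ℤ) ^ (n + 1) ∣
      qPoch (-X) X (2 * n) * X ^ (n + 1))).mul_right _
  exact (X_pow_dvd_iff.mp hd) m (by omega)

theorem summable_phiTerm : Summable phiTerm := by
  refine ⟨PowerSeries.mk fun m => ∑ n ∈ Finset.range m, coeff m (phiTerm n), ?_⟩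
  rw [PowerSeries.WithPiTopology.hasSum_iff_hasSum_coeff]
  intro m
  rw [coeff_mk]
  apply hasSum_sum_of_ne_finset_zero
  intro n hn
  exact coeff_phiTerm_of_le (by simpa using hn)

theorem hasSum_phiTerm : HasSum phiTerm phi := summable_phiTerm.hasSum

/-- Each coefficient `a(m)` is a finite sum of coefficients of summands. -/
theorem a_eq_sum (m : ℕ) : a m = ∑ n ∈ Finset.range m, coeff m (phiTerm n) := by
  have h := ((PowerSeries.WithPiTopology.hasSum_iff_hasSum_coeff (R := ℤ)).mp hasSum_phiTerm) m
  refine h.unique (hasSum_sum_of_ne_finset_zero ?_)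
  intro n hn
  exact coeff_phiTerm_of_le (by simpa using hn)

end RamanujanPhi

namespace RamanujanPhi

open PowerSeries Filter Topology
open scoped PowerSeries.WithPiTopology

/-! ### Summation of families of formal power series -/

/-! Write E_k for `eta k`. The odd-indexed coefficients of `phi` are generated by an eta quotient, Σ
a(2n+1) X^n = E_2^8 / E_1^7 (`eta_pow_mul_oddPart`). The index in the theorem is 2m+1 with m =
5(5(5(5n+r)+4)+1)+4, so the claim is that `U 4`, `U 1`, `U 4`, `U r`, applied in this order, send
the quotient to zero modulo 125; here `U j` extracts the coefficients with index j modulo 5.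

The eta quotient. Partial fractions for the denominators (`sum_pfCoeff`) and an exchange of
summations turn `phi * theta` into an Appell–Lerch sum (`hasSum_phi_mul_theta`). The diagonals of
that sum obey the same recurrence as the convolution of `theta` with a Lambert family, whence 2
E_2^3 φ + (even series) = 2L with L = Σ k X^k / (1 - X^(2k)) (`two_mul_eta_mul_phi`,
`alt_thetaLam_zero`). The odd part of L is a square up to elementary factors: X K^2 = 2(L(X) -
L(-X)) for K = Σ X^n / (1 + X^(2n+1)) over all integers n (`X_mul_kapSum_sq`), and K = 2 E_4^4 /
E_2^2 (`eta_sq_mul_kapSum`).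

The 5-dissections. The nonzero components of E_1 are a, -E_5, c with a c = -E_5^2. Comparing
components in products of eta and theta functions, and counting sums of two squares with Gaussian
integers, expresses everything through two parameters tied by one relation. This yields
`dissection_identities`: the norm of E_1, the relation E_2^5 E_5^2 = E_1^5 E_5 E_10 + 5X E_1^2 E_2
E_10^4, and the identity needed for `U 4` of θ^2 / E_1.

The congruence. By the middle relation E_2^5/E_10 and E_1^5/E_5 differ by 5 times a series, so the
quotient has a three-term expansion modulo 125 (`exists_oddPart`). Series in X^5 factor out of each
`U j`, and the remaining components supply factors of 5. After `U 4`, `U 1`, `U 4` only 50 E_5 E_10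
E_2^3 survives, and `U r` of E_2^3 is 5X E_10^3, 0, 0 for r = 1, 3, 4. -/

instance : NonarchimedeanRing (PowerSeries ℤ) where
  is_nonarchimedean U hU := by
    obtain ⟨I, hI, hIU⟩ := (IsLinearTopology.hasBasis_open_ideal (R := PowerSeries ℤ)).mem_iff.mp hU
    exact ⟨⟨I.toAddSubgroup, hI⟩, hIU⟩

/-- A function to `ℕ` all of whose sublevel sets are finite. -/
def Proper {ι : Type*} (e : ι → ℕ) : Prop := ∀ N, {i | e i < N}.Finite

theorem Proper.mono {ι : Type*} {e e' : ι → ℕ} (h : Proper e) (hle : ∀ i, e i ≤ e' i) :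
    Proper e' := fun N => (h N).subset fun i hi => lt_of_le_of_lt (hle i) hi

theorem Proper.comp {ι κ : Type*} {e : ι → ℕ} (h : Proper e) {f : κ → ι}
    (hf : Function.Injective f) : Proper (e ∘ f) := fun N =>
  (h N).preimage hf.injOn

theorem proper_natAbs : Proper Int.natAbs := fun N =>
  (Set.finite_Icc (-(N : ℤ)) N).subset fun i hi => by
    simp only [Set.mem_ofPred_eq] at hi
    simp only [Set.mem_Icc]; omega

theorem proper_id : Proper (id : ℕ → ℕ) := fun N => Set.finite_lt_nat N

theorem proper_add {ι κ : Type*} {e : ι → ℕ} {e' : κ → ℕ} (h : Proper e) (h' : Proper e') :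
    Proper fun p : ι × κ => e p.1 + e' p.2 := fun N =>
  ((h N).prod (h' N)).subset fun p hp => by
    simp only [Set.mem_ofPred_eq] at hp
    exact ⟨show e p.1 < N by omega, show e' p.2 < N by omega⟩

theorem coeff_eq_zero_of_dvd {f : PowerSeries ℤ} {n d : ℕ} (h : X ^ n ∣ f) (hd : d < n) :
    coeff d f = 0 := X_pow_dvd_iff.mp h d hd

/-- Only finitely many terms reach a given coefficient, so the terms tend to zero, which suffices in
a complete nonarchimedean group. Most convergence questions below reduce to such a bound on
exponents. -/
theorem summable_of_dvd {ι : Type*} {f : ι → PowerSeries ℤ} {e : ι → ℕ} (he : Proper e)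
    (h : ∀ i, X ^ e i ∣ f i) : Summable f := by
  rw [NonarchimedeanAddGroup.summable_iff_tendsto_cofinite_zero,
    WithPiTopology.tendsto_iff_coeff_tendsto]
  intro d
  apply tendsto_nhds_of_eventually_eq
  rw [Filter.eventually_cofinite]
  refine (he (d + 1)).subset fun i hi => ?_
  by_contra hlt
  exact hi (by rw [map_zero]; exact coeff_eq_zero_of_dvd (h i) (by simp at hlt; omega))

theorem HasSum.coeff {ι : Type*} {f : ι → PowerSeries ℤ} {S : PowerSeries ℤ} (h : HasSum f S)
    (d : ℕ) : HasSum (fun i => PowerSeries.coeff d (f i)) (PowerSeries.coeff d S) :=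
  (WithPiTopology.hasSum_iff_hasSum_coeff (R := ℤ)).mp h d

theorem coeff_hasSum_of_dvd {ι : Type*} {f : ι → PowerSeries ℤ} {e : ι → ℕ} (he : Proper e)
    (h : ∀ i, X ^ e i ∣ f i) {S : PowerSeries ℤ} (hS : HasSum f S) (d : ℕ) :
    PowerSeries.coeff d S = ∑ i ∈ (he (d + 1)).toFinset, PowerSeries.coeff d (f i) := by
  refine (HasSum.coeff hS d).unique (hasSum_sum_of_ne_finset_zero fun i hi => ?_)
  refine coeff_eq_zero_of_dvd (h i) ?_
  simp at hi
  omega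

theorem hasSum_of_eq {ι : Type*} {f g : ι → PowerSeries ℤ} {S T : PowerSeries ℤ}
    (h : HasSum f S) (hfg : ∀ i, g i = f i) (hST : T = S) : HasSum g T := by
  rw [hST, show g = f from funext hfg]; exact h

/-- Tannery's theorem for formal power series. -/
theorem tendsto_of_hasSum_of_dvd {ι : Type*} {F : ℕ → ι → PowerSeries ℤ}
    {S : ℕ → PowerSeries ℤ} {g : ι → PowerSeries ℤ} {T : PowerSeries ℤ} {e : ι → ℕ}
    (he : Proper e) (hd : ∀ N i, X ^ e i ∣ F N i) (hF : ∀ N, HasSum (F N) (S N))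
    (hg : ∀ i, Tendsto (fun N => F N i) atTop (𝓝 (g i))) (hT : HasSum g T) :
    Tendsto S atTop (𝓝 T) := by
  have hgd : ∀ i, X ^ e i ∣ g i := fun i => by
    rw [X_pow_dvd_iff]
    intro m hm
    have h1 := (WithPiTopology.tendsto_iff_coeff_tendsto ℤ _ _ _).mp (hg i) m
    refine tendsto_nhds_unique h1 ?_
    refine tendsto_const_nhds.congr fun N => ?_
    exact (coeff_eq_zero_of_dvd (hd N i) hm).symm
  rw [WithPiTopology.tendsto_iff_coeff_tendsto]
  intro d
  rw [coeff_hasSum_of_dvd he hgd hT d]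
  have : ∀ N, PowerSeries.coeff d (S N) =
      ∑ i ∈ (he (d + 1)).toFinset, PowerSeries.coeff d (F N i) :=
    fun N => coeff_hasSum_of_dvd he (hd N) (hF N) d
  simp_rw [this]
  exact tendsto_finsetSum _ fun i _ =>
    (WithPiTopology.tendsto_iff_coeff_tendsto ℤ _ _ _).mp (hg i) d

/-- Convergence to a limit known modulo larger and larger powers of `X`. -/
theorem tendsto_of_dvd_sub {f : ℕ → PowerSeries ℤ} {g : PowerSeries ℤ} {e : ℕ → ℕ}
    (he : Tendsto e atTop atTop) (h : ∀ N, X ^ e N ∣ f N - g) : Tendsto f atTop (𝓝 g) := by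
  rw [WithPiTopology.tendsto_iff_coeff_tendsto]
  intro d
  apply tendsto_nhds_of_eventually_eq
  filter_upwards [he.eventually_gt_atTop d] with N hN
  have := coeff_eq_zero_of_dvd (h N) hN
  rw [map_sub, sub_eq_zero] at this
  exact this

/-- The convolution form of the product of two bilateral sums. -/
theorem hasSum_convolution {f g : ℤ → PowerSeries ℤ} {A B : PowerSeries ℤ} (hf : HasSum f A)
    (hg : HasSum g B) :
    (∀ k, Summable fun n => f n * g (k - n)) ∧
      HasSum (fun k => ∑' n, f n * g (k - n)) (A * B) := by
  have h := HasSum.mul_of_nonarchimedean hf hg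
  -- `φ` sends `(k, n)` to `(n, k - n)`, so that the fibre over `k` is an antidiagonal.
  let φ : ℤ × ℤ ≃ ℤ × ℤ :=
    { toFun := fun p => (p.2, p.1 - p.2)
      invFun := fun p => (p.1 + p.2, p.1)
      left_inv := fun p => by simp
      right_inv := fun p => by simp }
  have h2 := (Equiv.hasSum_iff φ).mpr h
  have h3 : ∀ k, Summable fun n => f n * g (k - n) := fun k =>
    h2.summable.prod_factor k
  exact ⟨h3, h2.prod_fiberwise fun k => (h3 k).hasSum⟩

/-! ### Inverses -/

/-- The inverse of a power series with constant coefficient `1`. -/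
noncomputable def pinv (f : PowerSeries ℤ) : PowerSeries ℤ := invOfUnit f 1

theorem mul_pinv {f : PowerSeries ℤ} (h : constantCoeff f = 1) : f * pinv f = 1 :=
  mul_invOfUnit f 1 (by simpa using h)

theorem eq_pinv {f g : PowerSeries ℤ} (h : constantCoeff f = 1) (hg : f * g = 1) :
    g = pinv f := by
  have := mul_pinv h
  calc g = g * (f * pinv f) := by rw [this, mul_one]
    _ = (f * g) * pinv f := by ring
    _ = pinv f := by rw [hg, one_mul]

theorem ne_zero_of_constantCoeff {f : PowerSeries ℤ} (h : constantCoeff f = 1) : f ≠ 0 := by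
  rintro rfl; simp at h

theorem constantCoeff_one_sub_X_pow {n : ℕ} (hn : n ≠ 0) :
    constantCoeff (1 - X ^ n : PowerSeries ℤ) = 1 := by simp [hn]

theorem constantCoeff_one_add_X_pow {n : ℕ} (hn : n ≠ 0) :
    constantCoeff (1 + X ^ n : PowerSeries ℤ) = 1 := by simp [hn]

/-- The geometric series. -/
theorem hasSum_geometric {f : PowerSeries ℤ} (h : constantCoeff f = 0) :
    HasSum (fun n => f ^ n) (pinv (1 - f)) := by
  have h1 := WithPiTopology.summable_pow_of_constantCoeff_eq_zero h
  have h2 := WithPiTopology.one_sub_mul_tsum_pow_of_constantCoeff_eq_zero h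
  rw [← eq_pinv (by simp [h]) h2]
  exact h1.hasSum

/-! ### Infinite products and the Jacobi triple product -/

/-- The finite product `∏_{k < N} (1 - ε X ^ (a + b k))`. -/
noncomputable def qfin (ε : ℤ) (a b N : ℕ) : PowerSeries ℤ :=
  ∏ k ∈ Finset.range N, (1 - (ε : PowerSeries ℤ) * X ^ (a + b * k))

/-- The infinite product `∏_k (1 - ε X ^ (a + b k))`. -/
noncomputable def qprod (ε : ℤ) (a b : ℕ) : PowerSeries ℤ :=
  ∏' k, (1 - (ε : PowerSeries ℤ) * X ^ (a + b * k))

theorem qfin_succ (ε : ℤ) (a b N : ℕ) :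
    qfin ε a b (N + 1) = qfin ε a b N * (1 - (ε : PowerSeries ℤ) * X ^ (a + b * N)) :=
  Finset.prod_range_succ _ _

@[simp] theorem qfin_zero (ε : ℤ) (a b : ℕ) : qfin ε a b 0 = 1 := Finset.prod_range_zero _

theorem qfin_dvd_sub (ε : ℤ) (a b N M : ℕ) :
    (X : PowerSeries ℤ) ^ (a + b * N) ∣ qfin ε a b (N + M) - qfin ε a b N := by
  induction M with
  | zero => simp
  | succ M ih =>
    rw [← add_assoc, qfin_succ, mul_sub, mul_one, sub_right_comm]
    refine dvd_sub ih ?_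
    refine Dvd.dvd.mul_left (Dvd.dvd.mul_left (pow_dvd_pow _ ?_) _) _
    gcongr
    omega

theorem tendsto_qfin (ε : ℤ) (a : ℕ) {b : ℕ} (hb : 0 < b) :
    Tendsto (qfin ε a b) atTop (𝓝 (qprod ε a b)) := by
  have h : Multipliable fun k => (1 + (-((ε : PowerSeries ℤ) * X ^ (a + b * k)))) := by
    apply WithPiTopology.multipliable_one_add_of_tendsto_order_atTop_nhds_top
    rw [ENat.tendsto_nhds_top_iff_natCast_lt]
    intro n
    filter_upwards [eventually_gt_atTop n] with k hk
    refine lt_of_lt_of_le (b := (k : ℕ∞)) (by exact_mod_cast hk) ?_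
    apply PowerSeries.nat_le_order
    intro i hi
    refine coeff_eq_zero_of_dvd (n := k) ?_ hi
    rw [dvd_neg]
    refine Dvd.dvd.mul_left (pow_dvd_pow _ ?_) _
    nlinarith
  simp_rw [← sub_eq_add_neg] at h
  exact h.hasProd.tendsto_prod_nat

theorem constantCoeff_qfin (ε : ℤ) {a : ℕ} (ha : 0 < a) (b N : ℕ) :
    constantCoeff (qfin ε a b N) = 1 := by
  rw [qfin, map_prod]
  apply Finset.prod_eq_one
  intro k _
  simp [ha.ne']

theorem constantCoeff_qprod (ε : ℤ) {a b : ℕ} (ha : 0 < a) (hb : 0 < b) :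
    constantCoeff (qprod ε a b) = 1 := by
  have h := (WithPiTopology.tendsto_iff_coeff_tendsto ℤ _ _ _).mp (tendsto_qfin ε a hb) 0
  simp only [coeff_zero_eq_constantCoeff, constantCoeff_qfin ε ha] at h
  exact tendsto_nhds_unique h tendsto_const_nhds

/-- The factors are sorted by their index modulo `m`. -/
theorem qfin_split (ε : ℤ) (a b m N : ℕ) :
    qfin ε a b (m * N) = ∏ i ∈ Finset.range m, qfin ε (a + b * i) (m * b) N := by
  induction N with
  | zero => simp
  | succ N ih =>
    rw [mul_add, mul_one]
    simp_rw [qfin_succ, Finset.prod_mul_distrib]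
    rw [← ih]
    simp only [qfin]
    rw [Finset.prod_range_add]
    congr 1
    refine Finset.prod_congr rfl fun i _ => ?_
    congr 3
    ring

theorem qprod_split (ε : ℤ) (a : ℕ) {b m : ℕ} (hb : 0 < b) (hm : 0 < m) :
    qprod ε a b = ∏ i ∈ Finset.range m, qprod ε (a + b * i) (m * b) := by
  have h1 : Tendsto (fun N => qfin ε a b (m * N)) atTop (𝓝 (qprod ε a b)) :=
    (tendsto_qfin ε a hb).comp (tendsto_id.const_mul_atTop' hm)
  simp_rw [qfin_split] at h1
  exact tendsto_nhds_unique h1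
    (tendsto_finsetProd _ fun i _ => tendsto_qfin ε _ (Nat.mul_pos hm hb))

theorem qprod_mul_qprod_neg (a : ℕ) {b : ℕ} (hb : 0 < b) :
    qprod 1 a b * qprod (-1) a b = qprod 1 (2 * a) (2 * b) := by
  refine tendsto_nhds_unique ((tendsto_qfin 1 a hb).mul (tendsto_qfin (-1) a hb)) ?_
  refine (tendsto_qfin 1 (2 * a) (show 0 < 2 * b by omega)).congr fun N => ?_
  rw [qfin, qfin, qfin, ← Finset.prod_mul_distrib]
  refine Finset.prod_congr rfl fun k _ => ?_
  push_cast
  ring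

theorem continuous_expand (k : ℕ) (hk : k ≠ 0) :
    Continuous (expand k hk : PowerSeries ℤ → PowerSeries ℤ) := by
  rw [continuous_iff_continuousAt]
  intro f
  rw [ContinuousAt, WithPiTopology.tendsto_iff_coeff_tendsto]
  intro d
  simp_rw [coeff_expand]
  split_ifs
  · exact (WithPiTopology.continuous_coeff ℤ _).tendsto f
  · exact tendsto_const_nhds

theorem expand_qprod (k : ℕ) (hk : k ≠ 0) (ε : ℤ) (a : ℕ) {b : ℕ} (hb : 0 < b) :
    expand k hk (qprod ε a b) = qprod ε (k * a) (k * b) := by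
  have h := ((continuous_expand k hk).tendsto _).comp (tendsto_qfin ε a hb)
  refine tendsto_nhds_unique h ?_
  refine (tendsto_qfin ε (k * a) (show 0 < k * b by positivity)).congr fun N => ?_
  simp only [Function.comp_apply, qfin, map_prod]
  refine Finset.prod_congr rfl fun i _ => ?_
  simp only [map_sub, map_one, map_mul, map_pow, expand_X, map_intCast]
  ring

/-! ### Gaussian binomials and the finite triple product -/

/-- The inverse of `(X ^ Q; X ^ Q)_m`, extended by zero to negative `m`. -/
noncomputable def iq (Q : ℕ) (m : ℤ) : PowerSeries ℤ :=
  if 0 ≤ m then pinv (qfin 1 Q Q m.toNat) else 0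

theorem iq_natCast (Q m : ℕ) : iq Q m = pinv (qfin 1 Q Q m) := by simp [iq]

theorem iq_of_neg (Q : ℕ) {m : ℤ} (h : m < 0) : iq Q m = 0 := by simp [iq, h]

theorem qfin_mul_iq {Q : ℕ} (hQ : 0 < Q) (m : ℕ) : qfin 1 Q Q m * iq Q m = 1 := by
  rw [iq_natCast]; exact mul_pinv (constantCoeff_qfin 1 hQ Q m)

theorem iq_succ {Q : ℕ} (hQ : 0 < Q) (m : ℕ) :
    (1 - X ^ (Q * (m + 1))) * iq Q ((m + 1 : ℕ) : ℤ) = iq Q m := by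
  have h1 := qfin_mul_iq hQ m
  have h2 := qfin_mul_iq hQ (m + 1)
  rw [qfin_succ] at h2
  calc _ = (qfin 1 Q Q m * iq Q m) * ((1 - X ^ (Q * (m + 1))) * iq Q ((m + 1 : ℕ) : ℤ)) := by
        rw [h1, one_mul]
    _ = iq Q m * (qfin 1 Q Q m * (1 - ((1 : ℤ) : PowerSeries ℤ) * X ^ (Q + Q * m)) *
          iq Q ((m + 1 : ℕ) : ℤ)) := by push_cast; ring
    _ = iq Q m := by rw [h2, mul_one]

theorem iq_pred {Q : ℕ} (hQ : 0 < Q) (m : ℕ) :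
    (1 - X ^ (Q * m)) * iq Q (m : ℤ) = iq Q ((m : ℤ) - 1) := by
  rcases m with _ | m
  · simp [iq_of_neg]
  · rw [iq_succ hQ]; congr 1; push_cast; ring

/-- Over the common factor `iq Q U * iq Q V` this is a polynomial identity in `X ^ (Q * U)` and `X ^
(Q * V)`. It is the q-Pascal rule applied twice, stripped of its numerators. -/
theorem iq_recurrence {Q : ℕ} (hQ : 0 < Q) (U V : ℕ) (h : 1 ≤ U + V) :
    (1 - X ^ (Q * (U + V - 1))) * (1 - X ^ (Q * (U + V))) * iq Q U * iq Q V =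
      (1 + X ^ (Q * (U + V - 1))) * iq Q ((U : ℤ) - 1) * iq Q ((V : ℤ) - 1)
        + X ^ (Q * U) * (iq Q U * iq Q ((V : ℤ) - 2))
        + X ^ (Q * V) * (iq Q ((U : ℤ) - 2) * iq Q V) := by
  -- The truncated subtraction is harmless: for `m = 0` and `m = 1` a factor `1 - X ^ 0` makes the
  -- right side vanish, as it should.
  have h2 : ∀ m : ℕ, iq Q ((m : ℤ) - 2) =
      (1 - X ^ (Q * (m - 1))) * ((1 - X ^ (Q * m)) * iq Q (m : ℤ)) := by
    intro m
    rw [iq_pred hQ]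
    rcases m with _ | m
    · simp [iq_of_neg]
    · have := iq_pred hQ m
      rw [show ((m + 1 : ℕ) : ℤ) - 1 = m by push_cast; ring,
        show ((m + 1 : ℕ) : ℤ) - 2 = (m : ℤ) - 1 by push_cast; ring, ← this]
      simp
  rw [h2, h2, ← iq_pred hQ, ← iq_pred hQ]
  rcases U with _ | U <;> rcases V with _ | V
  · omega
  · simp [mul_add, pow_add]; ring
  · simp only [mul_add, pow_add, mul_one, Nat.add_sub_cancel, add_zero, mul_zero, pow_zero,
      Nat.cast_zero, Nat.zero_sub]
    ring
  · have e1 : U + 1 + (V + 1) - 1 = U + V + 1 := by omega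
    have e2 : U + 1 + (V + 1) = U + V + 2 := by omega
    rw [e1, e2]
    simp only [Nat.add_sub_cancel, mul_add, pow_add, mul_one]
    ring

theorem qfin_two_mul_succ {Q : ℕ} (N : ℕ) :
    qfin 1 Q Q (2 * (N + 1)) =
      qfin 1 Q Q (2 * N) * (1 - X ^ (Q * (2 * N + 1))) * (1 - X ^ (Q * (2 * N + 2))) := by
  rw [show 2 * (N + 1) = 2 * N + 1 + 1 by ring, qfin_succ, qfin_succ]
  push_cast
  ring

/-- The Gaussian binomial coefficient `[2N, N + n]` in base `X ^ Q`. -/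
noncomputable def gauss (Q N : ℕ) (n : ℤ) : PowerSeries ℤ :=
  qfin 1 Q Q (2 * N) * iq Q (N - n) * iq Q (N + n)

theorem gauss_eq_zero {Q N : ℕ} {n : ℤ} (h : N < n.natAbs) : gauss Q N n = 0 := by
  rw [gauss]
  rcases le_total 0 n with h0 | h0
  · rw [iq_of_neg Q (m := N - n) (by omega)]; ring
  · rw [iq_of_neg Q (m := N + n) (by omega)]; ring

theorem gauss_zero (Q : ℕ) (n : ℤ) : gauss Q 0 n = if n = 0 then 1 else 0 := by
  split_ifs with h
  · subst h
    have : pinv (1 : PowerSeries ℤ) = 1 := (eq_pinv (by simp) (by simp)).symm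
    simp [gauss, iq, this]
  · exact gauss_eq_zero (by omega)

theorem gauss_succ {Q : ℕ} (hQ : 0 < Q) (N : ℕ) {n : ℤ} (hn : n.natAbs ≤ N + 1) :
    gauss Q (N + 1) n = (1 + X ^ (Q * (2 * N + 1))) * gauss Q N n
      + X ^ (Q * (N + 1 - n).toNat) * gauss Q N (n - 1)
      + X ^ (Q * (N + 1 + n).toNat) * gauss Q N (n + 1) := by
  obtain ⟨U, hU⟩ := Int.eq_ofNat_of_zero_le (show 0 ≤ (N : ℤ) + 1 - n by omega)
  obtain ⟨V, hV⟩ := Int.eq_ofNat_of_zero_le (show 0 ≤ (N : ℤ) + 1 + n by omega)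
  have hUV : U + V = 2 * N + 2 := by omega
  have key := iq_recurrence hQ U V (by omega)
  simp only [gauss, hU, hV, Int.toNat_natCast, qfin_two_mul_succ]
  rw [show ((N + 1 : ℕ) : ℤ) - n = U by push_cast; omega,
    show ((N + 1 : ℕ) : ℤ) + n = V by push_cast; omega,
    show (N : ℤ) - n = U - 1 by omega, show (N : ℤ) + n = V - 1 by omega,
    show (N : ℤ) - (n - 1) = U by omega, show (N : ℤ) + (n - 1) = V - 2 by omega,
    show (N : ℤ) - (n + 1) = U - 2 by omega, show (N : ℤ) + (n + 1) = V by omega]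
  rw [hUV, show 2 * N + 2 - 1 = 2 * N + 1 by omega] at key
  linear_combination (qfin 1 Q Q (2 * N)) * key

/-- The data of a theta series: exponents `((a + c) n ^ 2 + (a - c) n) / 2`, signs `(-ε) ^ n`. -/
structure IsTheta (ε : ℤ) (a c : ℕ) (e : ℤ → ℕ) (σ : ℤ → ℤ) : Prop where
  exponent : ∀ n : ℤ, 2 * (e n : ℤ) = (a + c) * n ^ 2 + (a - c) * n
  sign_zero : σ 0 = 1
  sign_succ : ∀ n, σ (n + 1) = -ε * σ n
  sq : ε * ε = 1
  pos : 0 < a + c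

section Theta

variable {ε : ℤ} {a c : ℕ} {e : ℤ → ℕ} {σ : ℤ → ℤ}

/-- The weight of the neighbouring binomial in `gauss_succ` depends on `n`. Shifting the theta term
from `n` to `n - 1` absorbs this dependence and leaves the monomial of the next factor of `qfin ε a
(a + c)`. `step_down` does the same for `c`. -/
theorem IsTheta.step_up (h : IsTheta ε a c e σ) {N : ℕ} {n : ℤ} (hn : n ≤ N + 1) :
    ((ε : PowerSeries ℤ) * X ^ (a + (a + c) * N)) * ((σ (n - 1) : PowerSeries ℤ) * X ^ e (n - 1)) =
      -(X ^ ((a + c) * (N + 1 - n).toNat) * ((σ n : PowerSeries ℤ) * X ^ e n)) := by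
  obtain ⟨U, hU⟩ := Int.eq_ofNat_of_zero_le (show 0 ≤ (N : ℤ) + 1 - n by omega)
  have h1 : σ n = -ε * σ (n - 1) := by simpa using h.sign_succ (n - 1)
  have h2 := h.exponent n
  have h3 := h.exponent (n - 1)
  have h4 : a + (a + c) * N + e (n - 1) = (a + c) * U + e n := by
    zify
    have : (U : ℤ) = N + 1 - n := hU.symm
    rw [this]
    nlinarith
  rw [hU, h1, Int.toNat_natCast]
  push_cast
  calc _ = (ε : PowerSeries ℤ) * (σ (n - 1) : PowerSeries ℤ) * X ^ (a + (a + c) * N + e (n - 1)) := by ring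
    _ = _ := by rw [h4]; ring

theorem IsTheta.step_down (h : IsTheta ε a c e σ) {N : ℕ} {n : ℤ} (hn : -(N + 1 : ℤ) ≤ n) :
    ((ε : PowerSeries ℤ) * X ^ (c + (a + c) * N)) * ((σ (n + 1) : PowerSeries ℤ) * X ^ e (n + 1)) =
      -(X ^ ((a + c) * (N + 1 + n).toNat) * ((σ n : PowerSeries ℤ) * X ^ e n)) := by
  obtain ⟨U, hU⟩ := Int.eq_ofNat_of_zero_le (show 0 ≤ (N : ℤ) + 1 + n by omega)
  have h2 := h.exponent n
  have h3 := h.exponent (n + 1)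
  have h4 : c + (a + c) * N + e (n + 1) = (a + c) * U + e n := by
    zify
    have : (U : ℤ) = N + 1 + n := hU.symm
    rw [this]
    nlinarith
  rw [hU, h.sign_succ, Int.toNat_natCast]
  have hs : (ε : PowerSeries ℤ) * ε = 1 := by exact_mod_cast congrArg (Int.cast) h.sq
  push_cast
  calc _ = -((ε : PowerSeries ℤ) * (ε : PowerSeries ℤ)) * (σ n : PowerSeries ℤ) * X ^ (c + (a + c) * N + e (n + 1)) := by ring
    _ = _ := by rw [h4, hs]; ring

theorem IsTheta.gauss_term (h : IsTheta ε a c e σ) (N : ℕ) (n : ℤ) :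
    gauss (a + c) (N + 1) n * ((σ n : PowerSeries ℤ) * X ^ e n) =
      (1 + X ^ ((a + c) * (2 * N + 1))) *
          (gauss (a + c) N n * ((σ n : PowerSeries ℤ) * X ^ e n))
        - (ε : PowerSeries ℤ) * X ^ (a + (a + c) * N) *
          (gauss (a + c) N (n - 1) * ((σ (n - 1) : PowerSeries ℤ) * X ^ e (n - 1)))
        - (ε : PowerSeries ℤ) * X ^ (c + (a + c) * N) *
          (gauss (a + c) N (n + 1) * ((σ (n + 1) : PowerSeries ℤ) * X ^ e (n + 1))) := by
  by_cases hn : n.natAbs ≤ N + 1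
  · rw [gauss_succ h.pos N hn]
    have h1 := h.step_up (N := N) (n := n) (by omega)
    have h2 := h.step_down (N := N) (n := n) (by omega)
    linear_combination gauss (a + c) N (n - 1) * h1 + gauss (a + c) N (n + 1) * h2
  · rw [gauss_eq_zero (N := N + 1) (by omega), gauss_eq_zero (N := N) (n := n) (by omega),
      gauss_eq_zero (N := N) (n := n - 1) (by omega),
      gauss_eq_zero (N := N) (n := n + 1) (by omega)]
    ring

/-- The finite form of the Jacobi triple product. -/
theorem IsTheta.hasSum_gauss (h : IsTheta ε a c e σ) (N : ℕ) :
    HasSum (fun n => gauss (a + c) N n * ((σ n : PowerSeries ℤ) * X ^ e n))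
      (qfin ε a (a + c) N * qfin ε c (a + c) N) := by
  induction N with
  | zero =>
    have h0 : e 0 = 0 := by have := h.exponent 0; simp at this; exact this
    refine hasSum_of_eq (hasSum_ite_eq (0 : ℤ) (1 : PowerSeries ℤ)) (fun n => ?_) (by simp)
    by_cases hn : n = 0
    · subst hn; simp [gauss_zero, h0, h.sign_zero]
    · simp [gauss_zero, hn]
  | succ N ih =>
    have h1 := ((Equiv.addRight (-1 : ℤ)).hasSum_iff).mpr ih
    have h2 := ((Equiv.addRight (1 : ℤ)).hasSum_iff).mpr ih
    have h3 := ((ih.mul_left (1 + X ^ ((a + c) * (2 * N + 1)))).sub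
      (h1.mul_left ((ε : PowerSeries ℤ) * X ^ (a + (a + c) * N)))).sub
      (h2.mul_left ((ε : PowerSeries ℤ) * X ^ (c + (a + c) * N)))
    have hs : (ε : PowerSeries ℤ) * ε = 1 := by exact_mod_cast congrArg (Int.cast) h.sq
    -- Since `ε * ε = 1`, this monomial is the product term in the expansion of the two new factors
    -- of the triple product.
    have e1 : (X : PowerSeries ℤ) ^ ((a + c) * (2 * N + 1)) =
        X ^ (a + (a + c) * N) * X ^ (c + (a + c) * N) := by
      rw [← pow_add]; congr 1; ring
    refine hasSum_of_eq h3 (fun n => ?_) ?_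
    · simpa [sub_eq_add_neg] using h.gauss_term N n
    · rw [qfin_succ, qfin_succ, e1]
      linear_combination (qfin ε a (a + c) N * qfin ε c (a + c) N *
        X ^ (a + (a + c) * N) * X ^ (c + (a + c) * N)) * hs

theorem tendsto_iq {Q : ℕ} (hQ : 0 < Q) (f : ℕ → ℤ) (hf : Tendsto f atTop atTop) :
    Tendsto (fun N => iq Q (f N)) atTop (𝓝 (pinv (qprod 1 Q Q))) := by
  have hlim : Tendsto (fun m : ℕ => pinv (qfin 1 Q Q m)) atTop (𝓝 (pinv (qprod 1 Q Q))) := by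
    have key : ∀ m, X ^ (Q + Q * m) ∣ pinv (qfin 1 Q Q m) - pinv (qprod 1 Q Q) := by
      intro m
      have h1 := mul_pinv (constantCoeff_qfin 1 hQ Q m)
      have h2 := mul_pinv (constantCoeff_qprod 1 hQ hQ)
      have h3 : X ^ (Q + Q * m) ∣ qprod 1 Q Q - qfin 1 Q Q m := by
        rw [X_pow_dvd_iff]
        intro d hd
        have h4 := (WithPiTopology.tendsto_iff_coeff_tendsto ℤ _ _ _).mp (tendsto_qfin 1 Q hQ) d
        rw [map_sub, sub_eq_zero]
        refine tendsto_nhds_unique h4 (tendsto_const_nhds.congr' ?_)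
        filter_upwards [eventually_ge_atTop m] with M hM
        obtain ⟨k, rfl⟩ := Nat.exists_eq_add_of_le hM
        have := coeff_eq_zero_of_dvd (qfin_dvd_sub 1 Q Q m k) hd
        rw [map_sub, sub_eq_zero] at this
        exact this.symm
      have h5 : pinv (qfin 1 Q Q m) - pinv (qprod 1 Q Q) =
          (qprod 1 Q Q - qfin 1 Q Q m) * (pinv (qfin 1 Q Q m) * pinv (qprod 1 Q Q)) := by
        linear_combination pinv (qprod 1 Q Q) * h1 - pinv (qfin 1 Q Q m) * h2
      rw [h5]
      exact h3.mul_right _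
    refine tendsto_of_dvd_sub ?_ key
    exact tendsto_atTop_mono (fun m => (by nlinarith : m ≤ Q + Q * m)) tendsto_id
  have hf' : Tendsto (fun N => (f N).toNat) atTop atTop := by
    rw [tendsto_atTop] at hf ⊢
    intro b
    filter_upwards [hf b] with N hN
    omega
  refine (hlim.comp hf').congr' ?_
  filter_upwards [hf.eventually_ge_atTop 0] with N hN
  simp [iq, hN]

theorem tendsto_gauss {Q : ℕ} (hQ : 0 < Q) (n : ℤ) :
    Tendsto (fun N => gauss Q N n) atTop (𝓝 (pinv (qprod 1 Q Q))) := by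
  have h1 : Tendsto (fun N => qfin 1 Q Q (2 * N)) atTop (𝓝 (qprod 1 Q Q)) :=
    (tendsto_qfin 1 Q hQ).comp (tendsto_id.const_mul_atTop' (by norm_num))
  have h2 := tendsto_iq hQ (fun N => (N : ℤ) - n)
    (tendsto_atTop_add_const_right _ (-n) tendsto_natCast_atTop_atTop)
  have h3 := tendsto_iq hQ (fun N => (N : ℤ) + n)
    (tendsto_atTop_add_const_right _ n tendsto_natCast_atTop_atTop)
  have := (h1.mul h2).mul h3
  rwa [mul_pinv (constantCoeff_qprod 1 hQ hQ), one_mul] at this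

theorem IsTheta.proper (h : IsTheta ε a c e σ) : Proper e := by
  refine fun N => (Set.finite_Icc (-(2 * N + 1 : ℤ)) (2 * N + 1)).subset fun n hn => ?_
  simp only [Set.mem_ofPred_eq] at hn
  have h1 := h.exponent n
  have h2 := h.pos
  have hle : |n| ≤ 2 * N + 1 := by
    have h3 : ((a : ℤ) + c) * n ^ 2 + (a - c) * n ≥ n ^ 2 - |n| := by
      have hsq : n ^ 2 = |n| ^ 2 := (sq_abs n).symm
      have h4 : -|n| ≤ n := neg_abs_le n
      have h5 : n ≤ |n| := le_abs_self n
      have h6 : |n| ≤ |n| ^ 2 := by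
        rcases (abs_nonneg n).eq_or_lt with h | h
        · rw [← h]; norm_num
        · nlinarith
      rw [hsq]
      have ha : (0 : ℤ) ≤ a := by positivity
      have hc : (0 : ℤ) ≤ c := by positivity
      have : (1 : ℤ) ≤ a + c := by exact_mod_cast h2
      nlinarith [mul_le_mul_of_nonneg_left h4 ha, mul_le_mul_of_nonneg_left h5 hc]
    by_contra hlt
    push Not at hlt
    have : |n| * (|n| - 1) ≥ |n| * 1 := by nlinarith
    have hsq : n ^ 2 = |n| ^ 2 := (sq_abs n).symm
    nlinarith
  exact abs_le.mp hle

theorem IsTheta.summable (h : IsTheta ε a c e σ) :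
    Summable fun n => (σ n : PowerSeries ℤ) * X ^ e n :=
  summable_of_dvd h.proper fun _ => Dvd.intro_left _ rfl

/-- The Jacobi triple product identity. -/
theorem IsTheta.hasSum (h : IsTheta ε a c e σ) :
    HasSum (fun n => (σ n : PowerSeries ℤ) * X ^ e n)
      (qprod ε a (a + c) * qprod ε c (a + c) * qprod 1 (a + c) (a + c)) := by
  have h1 := (tendsto_qfin ε a h.pos).mul (tendsto_qfin ε c h.pos)
  -- Each Gaussian binomial tends to the inverse of `qprod 1 (a + c) (a + c)`, and the exponents `e
  -- n` bound the orders uniformly in `N`, so the limit may be taken termwise.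
  have h2 := tendsto_of_hasSum_of_dvd h.proper
    (fun N n => Dvd.dvd.mul_left (Dvd.intro_left _ rfl) _) h.hasSum_gauss
    (fun n => (tendsto_gauss h.pos n).mul_const _) (h.summable.hasSum.mul_left _)
  have h3 := tendsto_nhds_unique h1 h2
  have h4 := mul_pinv (constantCoeff_qprod 1 h.pos h.pos)
  have h5 : qprod ε a (a + c) * qprod ε c (a + c) * qprod 1 (a + c) (a + c) =
      ∑' n, (σ n : PowerSeries ℤ) * X ^ e n := by
    rw [h3]
    linear_combination (∑' n, (σ n : PowerSeries ℤ) * X ^ e n) * h4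
  rw [h5]
  exact h.summable.hasSum

end Theta

/-! ### Theta functions and eta products -/

/-- The sign `(-1) ^ n`. -/
def sg (n : ℤ) : ℤ := (n.negOnePow : ℤ)

@[simp] theorem sg_zero : sg 0 = 1 := by simp [sg]

theorem sg_succ (n : ℤ) : sg (n + 1) = -sg n := by simp [sg, Int.negOnePow_succ]

theorem sg_add (m n : ℤ) : sg (m + n) = sg m * sg n := by simp [sg, Int.negOnePow_add]

theorem sg_neg (n : ℤ) : sg (-n) = sg n := by simp [sg]

theorem sg_mul_self (n : ℤ) : sg n * sg n = 1 := by
  rw [← sg_add, ← two_mul, sg, Int.negOnePow_two_mul]; rfl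

theorem sg_two_mul (n : ℤ) : sg (2 * n) = 1 := by
  rw [sg, Int.negOnePow_two_mul]; rfl

theorem sg_natCast (n : ℕ) : sg n = (-1) ^ n := by
  induction n with
  | zero => simp
  | succ n ih => rw [Nat.cast_succ, sg_succ, ih, pow_succ]; ring

/-- The product `∏_{n ≥ 1} (1 - X ^ (k n))`. -/
noncomputable def eta (k : ℕ) : PowerSeries ℤ := qprod 1 k k

theorem constantCoeff_eta {k : ℕ} (hk : 0 < k) : constantCoeff (eta k) = 1 :=
  constantCoeff_qprod 1 hk hk

theorem eta_ne_zero {k : ℕ} (hk : 0 < k) : eta k ≠ 0 :=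
  ne_zero_of_constantCoeff (constantCoeff_eta hk)

theorem expand_eta (m : ℕ) (hm : m ≠ 0) {k : ℕ} (hk : 0 < k) :
    expand m hm (eta k) = eta (m * k) := expand_qprod m hm 1 k hk

theorem qprod_one_two_mul_eta : qprod 1 1 2 * eta 2 = eta 1 := by
  rw [eta, eta, qprod_split 1 1 one_pos (m := 2) (by norm_num), Finset.prod_range_succ,
    Finset.prod_range_succ, Finset.prod_range_zero]
  simp

theorem qprod_neg_mul_eta : qprod (-1) 1 1 * eta 1 = eta 2 := by
  rw [mul_comm]; exact qprod_mul_qprod_neg 1 one_pos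

/-- Exponents of the theta series. -/
def sqn (n : ℤ) : ℕ := (n ^ 2).toNat

theorem coe_sqn (n : ℤ) : (sqn n : ℤ) = n ^ 2 := Int.toNat_of_nonneg (sq_nonneg n)

/-- The triangular number `n (n + 1) / 2`. -/
def tri (n : ℤ) : ℕ := (n * (n + 1) / 2).toNat

theorem two_mul_tri (n : ℤ) : 2 * (tri n : ℤ) = n * (n + 1) := by
  have h1 : 0 ≤ n * (n + 1) := by
    rcases le_or_gt 0 n with h | h
    · positivity
    · nlinarith
  rw [tri, Int.toNat_of_nonneg (by omega)]
  exact Int.mul_ediv_cancel' (Int.even_mul_succ_self n).two_dvd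

theorem natAbs_le_sqn (n : ℤ) : n.natAbs ≤ sqn n := by
  have h := coe_sqn n
  zify
  rw [h, ← sq_abs]
  rcases (abs_nonneg n).eq_or_lt with h | h
  · rw [← h]; norm_num
  · nlinarith

theorem proper_sqn : Proper sqn := proper_natAbs.mono natAbs_le_sqn

/-- The theta function `∑ (-1) ^ n X ^ (n ^ 2)`. -/
noncomputable def theta : PowerSeries ℤ := qprod 1 1 2 ^ 2 * eta 2

/-- The theta function `∑ X ^ (n ^ 2)`. -/
noncomputable def thetaPos : PowerSeries ℤ := qprod (-1) 1 2 ^ 2 * eta 2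

/-- The theta function `∑_{n ≥ 0} X ^ (n (n + 1) / 2)`. -/
noncomputable def psi : PowerSeries ℤ := qprod (-1) 1 1 ^ 2 * eta 1

theorem theta_mul_eta : theta * eta 2 = eta 1 ^ 2 := by
  rw [theta, ← qprod_one_two_mul_eta]; ring

theorem psi_mul_eta : psi * eta 1 = eta 2 ^ 2 := by
  rw [psi, ← qprod_neg_mul_eta]; ring

theorem theta_mul_thetaPos : theta * thetaPos * eta 4 ^ 2 = eta 2 ^ 4 := by
  have h1 := qprod_mul_qprod_neg 1 (b := 2) two_pos
  have h2 := congrArg (expand 2 two_ne_zero) qprod_one_two_mul_eta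
  rw [map_mul, expand_qprod _ _ _ _ two_pos, expand_eta _ _ two_pos, expand_eta _ _ one_pos] at h2
  norm_num at h1 h2
  rw [← h1] at h2
  rw [theta, thetaPos]
  linear_combination (qprod 1 1 2 * qprod (-1) 1 2 * eta 4 + eta 2) * eta 2 ^ 2 * h2

theorem constantCoeff_theta : constantCoeff theta = 1 := by
  simp [theta, constantCoeff_qprod, constantCoeff_eta]

theorem isTheta_sg {a c : ℕ} {e : ℤ → ℕ} (h : 0 < a + c)
    (he : ∀ n : ℤ, 2 * (e n : ℤ) = (a + c) * n ^ 2 + (a - c) * n) : IsTheta 1 a c e sg where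
  exponent := he
  sign_zero := sg_zero
  sign_succ n := by rw [sg_succ]; ring
  sq := by norm_num
  pos := h

theorem isTheta_one {a c : ℕ} {e : ℤ → ℕ} (h : 0 < a + c)
    (he : ∀ n : ℤ, 2 * (e n : ℤ) = (a + c) * n ^ 2 + (a - c) * n) :
    IsTheta (-1) a c e (fun _ => 1) where
  exponent := he
  sign_zero := rfl
  sign_succ n := by norm_num
  sq := by norm_num
  pos := h

theorem hasSum_theta : HasSum (fun n : ℤ => (sg n : PowerSeries ℤ) * X ^ sqn n) theta := by
  have h := (isTheta_sg (a := 1) (c := 1) (e := sqn) (by norm_num)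
    (fun n => by rw [coe_sqn]; push_cast; ring)).hasSum
  exact hasSum_of_eq h (fun _ => rfl) (by rw [theta, eta]; ring)

theorem hasSum_thetaPos : HasSum (fun n : ℤ => (X : PowerSeries ℤ) ^ sqn n) thetaPos := by
  have h := (isTheta_one (a := 1) (c := 1) (e := sqn) (by norm_num)
    (fun n => by rw [coe_sqn]; push_cast; ring)).hasSum
  exact hasSum_of_eq h (fun _ => by simp) (by rw [thetaPos, eta]; ring)

theorem qprod_neg_zero : qprod (-1) 0 1 = 2 * qprod (-1) 1 1 := by
  have h1 := (tendsto_qfin (-1) 0 (b := 1) one_pos).comp (tendsto_add_atTop_nat 1)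
  have h2 := (tendsto_qfin (-1) 1 (b := 1) one_pos).const_mul 2
  refine tendsto_nhds_unique h1 (h2.congr fun N => ?_)
  simp only [Function.comp_apply, qfin]
  rw [Finset.prod_range_succ', mul_comm]
  congr 1
  · exact Finset.prod_congr rfl fun k _ => by congr 3; ring
  · push_cast; norm_num

theorem hasSum_two_mul_psi : HasSum (fun n : ℤ => (X : PowerSeries ℤ) ^ tri n) (2 * psi) := by
  have h := (isTheta_one (a := 1) (c := 0) (e := tri) (by norm_num)
    (fun n => by rw [two_mul_tri]; push_cast; ring)).hasSum
  refine hasSum_of_eq h (fun _ => by simp) ?_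
  simp only [add_zero]
  rw [qprod_neg_zero, psi, eta]; ring

theorem isTheta_tri : IsTheta 1 1 0 tri sg :=
  isTheta_sg (by norm_num) fun n => by rw [two_mul_tri]; push_cast; ring

theorem proper_tri : Proper tri := isTheta_tri.proper

/-- The product side contains the factor `1 - X ^ 0`. This vanishing is used repeatedly to discard
unweighted sums. -/
theorem hasSum_sg_tri : HasSum (fun n : ℤ => (sg n : PowerSeries ℤ) * X ^ tri n) 0 := by
  refine hasSum_of_eq isTheta_tri.hasSum (fun _ => rfl) ?_
  have h1 := (tendsto_qfin 1 0 (b := 1) one_pos).comp (tendsto_add_atTop_nat 1)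
  have h2 : qprod 1 0 1 = 0 := by
    refine tendsto_nhds_unique h1 (tendsto_const_nhds.congr fun N => ?_)
    simp only [Function.comp_apply, qfin]
    rw [Finset.prod_range_succ']
    simp
  simp only [add_zero]
  rw [h2]; ring

/-- The weight `n` plays the role of a derivative of the finite triple product at a zero. In the
recurrence for the terms one writes `n` as `(n - 1) + 1` and `(n + 1) - 1`; the leftover unweighted
sum is zero from level 1 on, and at level 0 it supplies the initial value. -/
theorem hasSum_mul_gauss (N : ℕ) :
    HasSum (fun n : ℤ => (n : PowerSeries ℤ) * (gauss 1 (N + 1) n * ((sg n : PowerSeries ℤ) *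
      X ^ tri n))) (qfin 1 1 1 N * qfin 1 1 1 (N + 1)) := by
  have key : ∀ (N : ℕ) (D : PowerSeries ℤ), HasSum (fun n : ℤ => (n : PowerSeries ℤ) *
      (gauss 1 N n * ((sg n : PowerSeries ℤ) * X ^ tri n))) D →
      HasSum (fun n : ℤ => (n : PowerSeries ℤ) * (gauss 1 (N + 1) n * ((sg n : PowerSeries ℤ) *
      X ^ tri n))) ((1 - X ^ N) * (1 - X ^ (N + 1)) * D + (X ^ N - X ^ (N + 1)) *
        (qfin 1 1 1 N * qfin 1 0 1 N)) := by
    intro N D hD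
    have hS := isTheta_tri.hasSum_gauss N
    simp only [add_zero] at hS
    have h1 := ((Equiv.addRight (-1 : ℤ)).hasSum_iff).mpr (hD.add hS)
    have h2 := ((Equiv.addRight (1 : ℤ)).hasSum_iff).mpr (hD.sub hS)
    have h3 := ((hD.mul_left (1 + X ^ (2 * N + 1))).sub
      (h1.mul_left (X ^ (N + 1)))).sub (h2.mul_left (X ^ N))
    refine hasSum_of_eq h3 (fun n => ?_) ?_
    · have := isTheta_tri.gauss_term N n
      simp only [add_zero] at this
      rw [this]
      simp only [Function.comp_apply, Equiv.coe_addRight, ← sub_eq_add_neg]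
      push_cast
      ring
    · ring
  induction N with
  | zero =>
    have h0 : HasSum (fun n : ℤ => (n : PowerSeries ℤ) *
        (gauss 1 0 n * ((sg n : PowerSeries ℤ) * X ^ tri n))) 0 := by
      refine hasSum_of_eq hasSum_zero (fun n => ?_) rfl
      by_cases hn : n = 0
      · simp [hn]
      · simp [gauss_zero, hn]
    refine hasSum_of_eq (key 0 0 h0) (fun _ => rfl) ?_
    simp [qfin]
  | succ N ih =>
    refine hasSum_of_eq (key (N + 1) _ ih) (fun _ => rfl) ?_
    have h0 : qfin 1 0 1 (N + 1) = 0 := by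
      rw [qfin, Finset.prod_range_succ']; simp
    rw [h0, qfin_succ 1 1 1 (N + 1), qfin_succ 1 1 1 N]
    push_cast
    ring

/-- Jacobi's identity for the cube of the eta product. -/
theorem hasSum_jacobi :
    HasSum (fun n : ℤ => (n : PowerSeries ℤ) * ((sg n : PowerSeries ℤ) * X ^ tri n))
      (eta 1 ^ 3) := by
  have hsum : Summable fun n : ℤ => (n : PowerSeries ℤ) * ((sg n : PowerSeries ℤ) * X ^ tri n) :=
    summable_of_dvd proper_tri fun n => Dvd.dvd.mul_left (Dvd.intro_left _ rfl) _
  have h1 := (tendsto_qfin 1 1 (b := 1) one_pos).mul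
    ((tendsto_qfin 1 1 (b := 1) one_pos).comp (tendsto_add_atTop_nat 1))
  have h2 := tendsto_of_hasSum_of_dvd proper_tri
    (fun N n => Dvd.dvd.mul_left (Dvd.dvd.mul_left (Dvd.intro_left _ rfl) _) _) hasSum_mul_gauss
    (fun n => (((tendsto_gauss one_pos n).comp (tendsto_add_atTop_nat 1)).mul_const _).const_mul _)
    (hasSum_of_eq (hsum.hasSum.mul_left (pinv (qprod 1 1 1))) (fun _ => by ring) rfl)
  have h3 := tendsto_nhds_unique h1 h2
  have h4 := mul_pinv (constantCoeff_qprod 1 (a := 1) (b := 1) one_pos one_pos)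
  have h5 : eta 1 ^ 3 = ∑' n : ℤ, (n : PowerSeries ℤ) * ((sg n : PowerSeries ℤ) * X ^ tri n) := by
    rw [eta]
    linear_combination (qprod 1 1 1) * h3 +
      (∑' n : ℤ, (n : PowerSeries ℤ) * ((sg n : PowerSeries ℤ) * X ^ tri n)) * h4
  rw [h5]
  exact hsum.hasSum

/-- Generalized pentagonal numbers `n (3 n + 1) / 2`. -/
def pent (n : ℤ) : ℕ := (n * (3 * n + 1) / 2).toNat

theorem two_mul_pent (n : ℤ) : 2 * (pent n : ℤ) = n * (3 * n + 1) := by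
  have h1 : 0 ≤ n * (3 * n + 1) := by
    rcases le_or_gt 0 n with h | h
    · positivity
    · nlinarith
  rw [pent, Int.toNat_of_nonneg (by omega)]
  apply Int.mul_ediv_cancel'
  have h2 : n * (3 * n + 1) = n * (n + 1) + 2 * (n * n) := by ring
  rw [h2]
  exact dvd_add (Int.even_mul_succ_self n).two_dvd (Dvd.intro _ rfl)

theorem hasSum_eta : HasSum (fun n : ℤ => (sg n : PowerSeries ℤ) * X ^ pent n) (eta 1) := by
  have h := (isTheta_sg (a := 2) (c := 1) (e := pent) (by norm_num)
    (fun n => by rw [two_mul_pent]; push_cast; ring)).hasSum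
  refine hasSum_of_eq h (fun _ => rfl) ?_
  rw [eta, qprod_split 1 1 one_pos (m := 3) (by norm_num), Finset.prod_range_succ,
    Finset.prod_range_succ, Finset.prod_range_succ, Finset.prod_range_zero]
  simp only [one_mul, mul_zero, mul_one, add_zero, Nat.reduceAdd]
  ring

theorem continuous_rescale_neg_one :
    Continuous (rescale (-1) : PowerSeries ℤ → PowerSeries ℤ) := by
  rw [continuous_iff_continuousAt]
  intro f
  rw [ContinuousAt, WithPiTopology.tendsto_iff_coeff_tendsto]
  intro d
  simp_rw [coeff_rescale]
  exact ((WithPiTopology.continuous_coeff ℤ _).tendsto f).const_mul _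

theorem HasSum.rescale_neg_one {ι : Type*} {f : ι → PowerSeries ℤ} {S : PowerSeries ℤ}
    (h : HasSum f S) : HasSum (fun i => rescale (-1) (f i)) (rescale (-1) S) :=
  h.map (rescale (-1)) continuous_rescale_neg_one

theorem HasSum.expand {ι : Type*} {f : ι → PowerSeries ℤ} {S : PowerSeries ℤ}
    (h : HasSum f S) (k : ℕ) (hk : k ≠ 0) :
    HasSum (fun i => PowerSeries.expand k hk (f i)) (PowerSeries.expand k hk S) :=
  h.map (PowerSeries.expand k hk) (continuous_expand k hk)

/-! ### The Appell–Lerch form of `φ` -/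

/-- The inverse of `1 - X ^ m`. -/
noncomputable def ginv (m : ℕ) : PowerSeries ℤ := pinv (1 - X ^ m)

theorem mul_ginv {m : ℕ} (hm : m ≠ 0) : (1 - X ^ m) * ginv m = 1 :=
  mul_pinv (constantCoeff_one_sub_X_pow hm)

/-- The coefficients of the partial fraction expansion of `1 / (X; X ^ 2)_{n + 1} ^ 2`. -/
noncomputable def pfCoeff (r : ℕ) : PowerSeries ℤ :=
  (-1) ^ r * X ^ (r * (r + 1)) * (1 + X ^ (2 * r + 1)) * ginv (2 * r + 1)

/-- After multiplication by `1 - X ^ (2 * m)` the summand is `G r - G (r + 1)`. `G 0` vanishes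
through `1 - X ^ 0`, and `G (m + 1)` because `iq` is zero at `-1`. -/
theorem sum_telescope_iq (m : ℕ) (hm : 0 < m) :
    ∑ r ∈ Finset.range (m + 1), (-1) ^ r * X ^ (r * (r - 1)) * (1 - X ^ (2 * (2 * r + 1))) *
      (iq 2 ((m : ℤ) - r) * iq 2 ((m : ℤ) + r + 1)) = 0 := by
  set G : ℕ → PowerSeries ℤ := fun r => (-1) ^ r * X ^ (r * (r - 1)) * (1 - X ^ (2 * r)) *
    (iq 2 ((m : ℤ) - r) * iq 2 ((m : ℤ) + r)) with hG
  have hne : (1 - X ^ (2 * m) : PowerSeries ℤ) ≠ 0 :=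
    ne_zero_of_constantCoeff (constantCoeff_one_sub_X_pow (by omega))
  apply mul_left_cancel₀ hne
  rw [mul_zero, Finset.mul_sum]
  have hterm : ∀ r ∈ Finset.range (m + 1), (1 - X ^ (2 * m)) *
      ((-1) ^ r * X ^ (r * (r - 1)) * (1 - X ^ (2 * (2 * r + 1))) *
      (iq 2 ((m : ℤ) - r) * iq 2 ((m : ℤ) + r + 1))) = G r - G (r + 1) := by
    intro r hr
    obtain ⟨u, rfl⟩ : ∃ u, m = r + u := Nat.exists_eq_add_of_le (by simpa using hr)
    have h1 := iq_pred two_pos u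
    have h2 := iq_succ two_pos (r + u + r)
    simp only [hG]
    rw [show ((r + u : ℕ) : ℤ) - r = u by push_cast; ring,
      show ((r + u : ℕ) : ℤ) - (r + 1 : ℕ) = (u : ℤ) - 1 by push_cast; ring,
      show ((r + u : ℕ) : ℤ) + r + 1 = (r + u + r + 1 : ℕ) by push_cast; ring,
      show ((r + u : ℕ) : ℤ) + r = (r + u + r : ℕ) by push_cast; ring,
      show ((r + u : ℕ) : ℤ) + (r + 1 : ℕ) = (r + u + r + 1 : ℕ) by push_cast; ring,
      ← h1, ← h2, show (r + 1) * (r + 1 - 1) = r * (r - 1) + 2 * r by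
        rcases r with _ | r
        · rfl
        · simp; ring]
    ring
  rw [Finset.sum_congr rfl hterm, Finset.sum_range_sub']
  simp [hG, iq_of_neg]

/-- An identity of Bailey-pair type. When `n` grows by one, the product side gains `(1 - X ^ (2 * n
+ 3)) ^ 2`; summand by summand, the resulting discrepancy is `X ^ (2 * (n + 1))` times a term of
`sum_telescope_iq`, so it sums to zero. -/
theorem sum_pfCoeff (n : ℕ) :
    (∑ r ∈ Finset.range (n + 1), pfCoeff r * (iq 2 ((n : ℤ) - r) * iq 2 ((n : ℤ) + r + 1))) *
      qfin 1 1 2 (n + 1) ^ 2 = 1 := by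
  induction n with
  | zero =>
    have h1 : (1 - X : PowerSeries ℤ) * ginv 1 = 1 := by
      have := mul_ginv (m := 1) one_ne_zero
      rwa [pow_one] at this
    have h2 := iq_succ two_pos 0
    have h3 := qfin_mul_iq two_pos 0
    simp at h2 h3
    rw [h3] at h2
    simp [pfCoeff, qfin, h3]
    linear_combination (1 - X ^ 2) * iq 2 1 * h1 + h2
  | succ n ih =>
    have key : (1 - X ^ (2 * n + 3)) ^ 2 * (∑ r ∈ Finset.range (n + 2), pfCoeff r *
        (iq 2 (((n + 1 : ℕ) : ℤ) - r) * iq 2 (((n + 1 : ℕ) : ℤ) + r + 1))) =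
        ∑ r ∈ Finset.range (n + 1), pfCoeff r * (iq 2 ((n : ℤ) - r) * iq 2 ((n : ℤ) + r + 1)) := by
      have hz : ∑ r ∈ Finset.range (n + 1), pfCoeff r *
          (iq 2 ((n : ℤ) - r) * iq 2 ((n : ℤ) + r + 1)) =
          ∑ r ∈ Finset.range (n + 2), pfCoeff r *
            (iq 2 ((n : ℤ) - r) * iq 2 ((n : ℤ) + r + 1)) := by
        rw [Finset.sum_range_succ _ (n + 1)]
        simp [iq_of_neg]
      have ht := congrArg (X ^ (2 * (n + 1)) * ·) (sum_telescope_iq (n + 1) (by omega))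
      simp only [mul_zero, Finset.mul_sum] at ht
      rw [hz, Finset.mul_sum, ← sub_eq_zero, ← Finset.sum_sub_distrib, ← ht]
      refine Finset.sum_congr rfl fun r hr => ?_
      obtain ⟨u, hu⟩ : ∃ u, n + 1 = r + u := Nat.exists_eq_add_of_le (by simp at hr; omega)
      have h1 := iq_pred two_pos u
      have h2 := iq_succ two_pos (n + r + 1)
      have h3 := mul_ginv (m := 2 * r + 1) (by omega)
      rw [show ((n + 1 : ℕ) : ℤ) - r = u by rw [hu]; push_cast; ring,
        show (n : ℤ) - r = (u : ℤ) - 1 by omega,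
        show ((n + 1 : ℕ) : ℤ) + r + 1 = (n + r + 1 + 1 : ℕ) by push_cast; ring,
        show (n : ℤ) + r + 1 = (n + r + 1 : ℕ) by push_cast; ring, ← h1, ← h2, pfCoeff]
      have e1 : (X : PowerSeries ℤ) ^ (2 * (n + 1)) * X ^ (r * (r - 1)) =
          X ^ (2 * u) * X ^ (r * (r + 1)) := by
        rw [← pow_add, ← pow_add]; congr 1
        rcases r with _ | r
        · simp; omega
        · simp; rw [hu]; ring
      have e2 : (X : PowerSeries ℤ) ^ (2 * (n + r + 1 + 1)) =
          X ^ (2 * u) * X ^ (2 * (2 * r + 1)) := by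
        rw [← pow_add]; congr 1; omega
      have e3 : (X : PowerSeries ℤ) ^ (2 * n + 3) = X ^ (2 * u) * X ^ (2 * r + 1) := by
        rw [← pow_add]; congr 1; omega
      rw [e2, e3]
      linear_combination (-(-1) ^ r * (1 - X ^ (2 * (2 * r + 1))) *
        (iq 2 (u : ℤ) * iq 2 ((n + r + 1 + 1 : ℕ) : ℤ))) * e1 +
        ((-1) ^ r * X ^ (r * (r + 1)) * (1 + X ^ (2 * r + 1)) * X ^ (2 * u) *
          (1 - X ^ (2 * r + 1)) * iq 2 (u : ℤ) * iq 2 ((n + r + 1 + 1 : ℕ) : ℤ)) * h3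
    rw [← ih, ← key, qfin_succ 1 1 2 (n + 1)]
    push_cast
    ring

/-- The building blocks of `φ`. -/
noncomputable def wTerm (n r : ℕ) : PowerSeries ℤ :=
  qfin (-1) 1 1 (2 * n) * X ^ (n + 1) * (iq 2 ((n : ℤ) - r) * iq 2 ((n : ℤ) + r + 1))

theorem wTerm_eq_zero {n r : ℕ} (h : n < r) : wTerm n r = 0 := by
  rw [wTerm, iq_of_neg 2 (m := (n : ℤ) - r) (by omega)]; ring

theorem X_pow_dvd_wTerm (n r : ℕ) : X ^ (n + 1) ∣ wTerm n r :=
  (Dvd.intro_left _ rfl : X ^ (n + 1) ∣ qfin (-1) 1 1 (2 * n) * X ^ (n + 1)).mul_right _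

theorem proper_succ : Proper fun n : ℕ => n + 1 := proper_id.mono fun n => Nat.le_succ n

theorem summable_wTerm (r : ℕ) : Summable fun n => wTerm n r :=
  summable_of_dvd proper_succ fun n => X_pow_dvd_wTerm n r

/-- The column sums of `wTerm`. -/
noncomputable def wSum (r : ℕ) : PowerSeries ℤ := ∑' n, wTerm n r

theorem qfin_neg_two_mul_succ (n : ℕ) : qfin (-1) 1 1 (2 * (n + 1)) =
    qfin (-1) 1 1 (2 * n) * (1 + X ^ (2 * n + 1)) * (1 + X ^ (2 * n + 2)) := by
  rw [show 2 * (n + 1) = 2 * n + 1 + 1 by ring, qfin_succ, qfin_succ]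
  push_cast
  ring

/-- The termwise difference is `H (n + 1) - H n`, where `H` vanishes at 0 and tends to 0. -/
theorem wSum_recurrence (r : ℕ) :
    (1 + X ^ (2 * r + 3)) * wSum (r + 1) = X * (1 + X ^ (2 * r + 1)) * wSum r := by
  set H : ℕ → PowerSeries ℤ := fun n => qfin (-1) 1 1 (2 * n) * X ^ (n + 1) *
    (1 - X ^ (2 * (r + 1))) * (iq 2 ((n : ℤ) - r - 1) * iq 2 ((n : ℤ) + r + 1)) with hH
  have hterm : ∀ n, X * (1 + X ^ (2 * r + 1)) * wTerm n r - (1 + X ^ (2 * r + 3)) * wTerm n (r + 1)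
      = H (n + 1) - H n := by
    intro n
    rcases lt_or_ge n r with h | h
    · rw [wTerm_eq_zero h, wTerm_eq_zero (by omega)]
      simp only [hH]
      rw [iq_of_neg 2 (m := ((n + 1 : ℕ) : ℤ) - r - 1) (by push_cast; omega),
        iq_of_neg 2 (m := (n : ℤ) - r - 1) (by omega)]
      ring
    · obtain ⟨u, rfl⟩ := Nat.exists_eq_add_of_le h
      have h1 := iq_pred two_pos u
      have h2 := iq_succ two_pos (r + u + r + 1)
      simp only [hH, wTerm]
      rw [show ((r + u : ℕ) : ℤ) - r - 1 = (u : ℤ) - 1 by push_cast; ring,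
        show ((r + u : ℕ) : ℤ) - r = u by push_cast; ring,
        show ((r + u : ℕ) : ℤ) - (r + 1 : ℕ) = (u : ℤ) - 1 by push_cast; ring,
        show ((r + u + 1 : ℕ) : ℤ) - r - 1 = u by push_cast; ring,
        show ((r + u : ℕ) : ℤ) + (r + 1 : ℕ) + 1 = (r + u + r + 1 + 1 : ℕ) by push_cast; ring,
        show ((r + u : ℕ) : ℤ) + r + 1 = (r + u + r + 1 : ℕ) by push_cast; ring,
        show ((r + u + 1 : ℕ) : ℤ) + r + 1 = (r + u + r + 1 + 1 : ℕ) by push_cast; ring,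
        ← h1, ← h2, qfin_neg_two_mul_succ]
      ring
  have hsum := ((summable_wTerm r).hasSum.mul_left (X * (1 + X ^ (2 * r + 1)))).sub
    ((summable_wTerm (r + 1)).hasSum.mul_left (1 + X ^ (2 * r + 3)))
  have h1 := hsum.tendsto_sum_nat
  simp_rw [hterm, Finset.sum_range_sub] at h1
  have h0 : H 0 = 0 := by
    simp only [hH]
    rw [iq_of_neg 2 (m := ((0 : ℕ) : ℤ) - r - 1) (by push_cast; omega)]
    ring
  have h2 : Tendsto (fun n => H n - H 0) atTop (𝓝 0) := by
    refine tendsto_of_dvd_sub (e := id) tendsto_id fun n => ?_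
    rw [h0, sub_zero, sub_zero]
    refine Dvd.dvd.mul_right (Dvd.dvd.mul_right (Dvd.dvd.mul_left (pow_dvd_pow _ ?_) _) _) _
    exact Nat.le_succ n
  have h3 := tendsto_nhds_unique h1 h2
  rw [sub_eq_zero] at h3
  exact h3.symm

/-- Euler's sum `∑ X ^ m / (X ^ 2; X ^ 2)_m = 1 / (X; X ^ 2)_∞`. -/
theorem hasSum_euler : HasSum (fun m : ℕ => X ^ m * iq 2 (m : ℤ)) (pinv (qprod 1 1 2)) := by
  have hs : ∀ j, Summable fun m : ℕ => X ^ ((2 * j + 1) * m) * iq 2 (m : ℤ) := fun j =>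
    summable_of_dvd (e := id) proper_id fun m =>
      Dvd.dvd.mul_right (pow_dvd_pow _ (by simp only [id]; nlinarith)) _
  set S : ℕ → PowerSeries ℤ := fun j => ∑' m : ℕ, X ^ ((2 * j + 1) * m) * iq 2 (m : ℤ) with hS
  have hrec : ∀ j, (1 - X ^ (2 * j + 1)) * S j = S (j + 1) := by
    intro j
    have h1 := (hs j).hasSum.sub (hs (j + 1)).hasSum
    have h2 : HasSum (fun m : ℕ => X ^ ((2 * j + 1) * m) * iq 2 ((m : ℤ) - 1))
        (S j - S (j + 1)) := by
      refine hasSum_of_eq h1 (fun m => ?_) rfl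
      rw [← iq_pred two_pos]
      ring
    have h3 := (hasSum_nat_add_iff' 1).mpr h2
    have h4 : HasSum (fun m : ℕ => X ^ ((2 * j + 1) * m) * iq 2 (m : ℤ) * X ^ (2 * j + 1))
        (S j - S (j + 1)) := by
      refine hasSum_of_eq h3 (fun m => ?_) ?_
      · push_cast
        rw [show (m : ℤ) + 1 - 1 = m by ring]
        ring
      · simp [iq_of_neg]
    have h5 := h4.unique ((hs j).hasSum.mul_right (X ^ (2 * j + 1)))
    linear_combination h5
  have hprod : ∀ N, qfin 1 1 2 N * S 0 = S N := by
    intro N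
    induction N with
    | zero => simp
    | succ N ih => rw [qfin_succ, ← hrec, ← ih]; push_cast; ring
  have hlim : Tendsto S atTop (𝓝 1) := by
    have h0 := qfin_mul_iq two_pos 0
    simp at h0
    refine tendsto_of_hasSum_of_dvd (e := id) proper_id (fun N m =>
      Dvd.dvd.mul_right (pow_dvd_pow _ (by simp only [id]; nlinarith)) _)
      (fun N => (hs N).hasSum) (fun m => ?_) (hasSum_ite_eq (0 : ℕ) (1 : PowerSeries ℤ))
    by_cases hm : m = 0
    · subst hm; simp [h0]
    · simp only [hm, if_false]
      refine tendsto_of_dvd_sub (e := id) tendsto_id fun N => ?_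
      rw [sub_zero]
      refine Dvd.dvd.mul_right (pow_dvd_pow _ ?_) _
      have : 1 ≤ m := Nat.one_le_iff_ne_zero.mpr hm
      simp only [id]
      nlinarith
  have h1 := (tendsto_qfin 1 1 two_pos).mul_const (S 0)
  simp_rw [hprod] at h1
  have h2 := tendsto_nhds_unique h1 hlim
  have h3 := (hs 0).hasSum
  refine hasSum_of_eq h3 (fun m => by simp) ?_
  exact (eq_pinv (constantCoeff_qprod 1 one_pos two_pos) h2).symm

theorem wSum_eq_shift (r : ℕ) :
    HasSum (fun m : ℕ => qfin (-1) 1 1 (2 * (m + r)) * (X ^ m * (iq 2 (m : ℤ) *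
      iq 2 (((m + 2 * r + 1 : ℕ)) : ℤ))) * X ^ (r + 1)) (wSum r) := by
  have h := (hasSum_nat_add_iff' r).mpr (summable_wTerm r).hasSum
  refine hasSum_of_eq h (fun m => ?_) ?_
  · rw [wTerm, show ((m + r : ℕ) : ℤ) - r = m by push_cast; ring,
      show ((m + r : ℕ) : ℤ) + r + 1 = (m + 2 * r + 1 : ℕ) by push_cast; ring]
    ring
  · rw [Finset.sum_eq_zero fun i hi => wTerm_eq_zero (by simpa using hi), sub_zero]
    rfl

/-- By the recurrence, `(1 + X ^ (2 * r + 1)) * wSum r` is `X ^ r` times a constant series. With `X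
^ (r + 1)` removed, letting `r` grow identifies the constant: the terms tend to those of Euler's sum
`hasSum_euler`, and the resulting product is the inverse of `theta`. -/
theorem wSum_mul_theta (r : ℕ) : (1 + X ^ (2 * r + 1)) * wSum r * theta = X ^ (r + 1) := by
  have hconst : ∀ r, (1 + X ^ (2 * r + 1)) * wSum r = X ^ r * ((1 + X) * wSum 0) := by
    intro r
    induction r with
    | zero => simp
    | succ r ih => 
      have := wSum_recurrence r
      rw [show 2 * (r + 1) + 1 = 2 * r + 3 by ring, this, mul_assoc, ih]; ring
  have hsv : ∀ r, Summable fun m : ℕ => qfin (-1) 1 1 (2 * (m + r)) * (X ^ m * (iq 2 (m : ℤ) *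
      iq 2 (((m + 2 * r + 1 : ℕ)) : ℤ))) := fun r =>
    summable_of_dvd (e := id) proper_id fun m => Dvd.dvd.mul_left (Dvd.intro _ rfl) _
  set v : ℕ → PowerSeries ℤ := fun r => ∑' m : ℕ, qfin (-1) 1 1 (2 * (m + r)) *
    (X ^ m * (iq 2 (m : ℤ) * iq 2 (((m + 2 * r + 1 : ℕ)) : ℤ))) with hv
  have hvw : ∀ r, wSum r = v r * X ^ (r + 1) := fun r =>
    (wSum_eq_shift r).unique ((hsv r).hasSum.mul_right _)
  have hvc : ∀ r, (1 + X ^ (2 * r + 1)) * v r = (1 + X) * v 0 := by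
    intro r
    have h := hconst r
    rw [hvw, hvw 0] at h
    have hx : (X : PowerSeries ℤ) ^ (r + 1) ≠ 0 := pow_ne_zero _ X_ne_zero
    apply mul_right_cancel₀ hx
    rw [mul_assoc, h]
    ring
  have hlim : Tendsto v atTop (𝓝 (qprod (-1) 1 1 * pinv (eta 2) * pinv (qprod 1 1 2))) := by
    refine tendsto_of_hasSum_of_dvd (e := id) proper_id
      (fun N m => Dvd.dvd.mul_left (Dvd.intro _ rfl) _) (fun r => (hsv r).hasSum) (fun m => ?_)
      (hasSum_euler.mul_left (qprod (-1) 1 1 * pinv (eta 2)))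
    have h1 : Tendsto (fun N => qfin (-1) 1 1 (2 * (m + N))) atTop (𝓝 (qprod (-1) 1 1)) := by
      refine (tendsto_qfin (-1) 1 one_pos).comp ?_
      exact tendsto_atTop_mono (fun N => (by omega : N ≤ 2 * (m + N))) tendsto_id
    have h2 : Tendsto (fun N => iq 2 (((m + 2 * N + 1 : ℕ)) : ℤ)) atTop (𝓝 (pinv (eta 2))) := by
      refine tendsto_iq two_pos _ (tendsto_natCast_atTop_atTop.comp ?_)
      exact tendsto_atTop_mono (fun N => (by omega : N ≤ m + 2 * N + 1)) tendsto_id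
    have h3 := h1.mul ((h2.const_mul (iq 2 (m : ℤ))).const_mul (X ^ m))
    rw [show qprod (-1) 1 1 * pinv (eta 2) * (X ^ m * iq 2 (m : ℤ)) =
      qprod (-1) 1 1 * (X ^ m * (iq 2 (m : ℤ) * pinv (eta 2))) by ring]
    exact h3
  have hlim2 : Tendsto (fun r => (1 + X ^ (2 * r + 1)) * v r) atTop
      (𝓝 (1 * (qprod (-1) 1 1 * pinv (eta 2) * pinv (qprod 1 1 2)))) := by
    refine Tendsto.mul (tendsto_of_dvd_sub (e := id) tendsto_id fun N => ?_) hlim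
    rw [add_sub_cancel_left]
    exact pow_dvd_pow _ (by simp only [id]; omega)
  simp_rw [hvc] at hlim2
  have h0 := tendsto_nhds_unique tendsto_const_nhds hlim2
  have h1 : qprod (-1) 1 1 * qprod 1 1 2 = 1 := by
    apply mul_right_cancel₀ (eta_ne_zero one_pos)
    calc _ = qprod 1 1 2 * (qprod (-1) 1 1 * eta 1) := by ring
      _ = _ := by rw [qprod_neg_mul_eta, qprod_one_two_mul_eta, one_mul]
  have h2 := mul_pinv (constantCoeff_eta two_pos)
  have h3 := mul_pinv (constantCoeff_qprod 1 (a := 1) (b := 2) one_pos two_pos)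
  rw [hvw, ← mul_assoc, hvc, h0, theta]
  linear_combination X ^ (r + 1) * (eta 2 * pinv (eta 2) * (qprod 1 1 2 * pinv (qprod 1 1 2))) * h1
    + X ^ (r + 1) * (qprod 1 1 2 * pinv (qprod 1 1 2)) * h2 + X ^ (r + 1) * h3

theorem phiTerm_eq (n : ℕ) :
    phiTerm n = ∑ r ∈ Finset.range (n + 1), pfCoeff r * wTerm n r := by
  have h1 : qPoch (-X : PowerSeries ℤ) X (2 * n) = qfin (-1) 1 1 (2 * n) := by
    refine Finset.prod_congr rfl fun k _ => ?_
    push_cast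
    ring
  have h2 : qPoch (X : PowerSeries ℤ) (X ^ 2) (n + 1) = qfin 1 1 2 (n + 1) := by
    refine Finset.prod_congr rfl fun k _ => ?_
    push_cast
    ring
  have h3 := eq_pinv (f := qfin 1 1 2 (n + 1) ^ 2)
    (by rw [map_pow, constantCoeff_qfin 1 one_pos, one_pow])
    (by rw [mul_comm]; exact sum_pfCoeff n)
  rw [phiTerm, h1, h2, show invOfUnit (qfin 1 1 2 (n + 1) ^ 2) 1 = pinv _ from rfl, ← h3,
    Finset.mul_sum]
  refine Finset.sum_congr rfl fun r _ => ?_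
  rw [wTerm]
  ring

/-- The Appell–Lerch series `∑ (-1) ^ n X ^ ((n + 1) ^ 2) / (1 - X ^ (2 n + 1))`. -/
theorem hasSum_phi_mul_theta :
    HasSum (fun n : ℕ => (-1) ^ n * X ^ ((n + 1) ^ 2) * ginv (2 * n + 1)) (phi * theta) := by
  have hs : Summable fun p : ℕ × ℕ => pfCoeff p.2 * wTerm p.1 p.2 := by
    refine summable_of_dvd (e := fun p : ℕ × ℕ => id p.1 + id p.2)
      (proper_add proper_id proper_id) fun p => ?_
    rw [add_comm, pow_add]
    refine mul_dvd_mul ?_ ((pow_dvd_pow _ (Nat.le_succ _)).trans (X_pow_dvd_wTerm _ _))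
    rw [pfCoeff]
    refine Dvd.dvd.mul_right (Dvd.dvd.mul_right (Dvd.dvd.mul_left (pow_dvd_pow _ ?_) _) _) _
    simp only [id]
    nlinarith
  obtain ⟨S, hS⟩ := hs
  have hrow : ∀ n, HasSum (fun r => pfCoeff r * wTerm n r) (phiTerm n) := fun n => by
    rw [phiTerm_eq]
    refine hasSum_sum_of_ne_finset_zero fun r hr => ?_
    rw [wTerm_eq_zero (by simpa using hr)]
    ring
  have hcol : ∀ r, HasSum (fun n => pfCoeff r * wTerm n r) (pfCoeff r * wSum r) := fun r =>
    (summable_wTerm r).hasSum.mul_left _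
  -- The same double series is summed by rows, giving `phi`, and by columns, giving the terms
  -- evaluated by `wSum_mul_theta`.
  have h1 : HasSum phiTerm S := hS.prod_fiberwise hrow
  have h2 : S = phi := h1.unique hasSum_phiTerm
  have hS' : HasSum (fun p : ℕ × ℕ => pfCoeff p.1 * wTerm p.2 p.1) S :=
    ((Equiv.prodComm ℕ ℕ).hasSum_iff (f := fun p : ℕ × ℕ => pfCoeff p.2 * wTerm p.1 p.2)).mpr hS
  have h3 : HasSum (fun r => pfCoeff r * wSum r) S := hS'.prod_fiberwise hcol
  rw [h2] at h3
  refine hasSum_of_eq (h3.mul_right theta) (fun r => ?_) rfl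
  rw [pfCoeff]
  linear_combination -((-1) ^ r * X ^ (r * (r + 1)) * ginv (2 * r + 1)) * wSum_mul_theta r

/-! ### The Lambert series attached to `φ` -/

theorem hasSum_int_of_symm {f : ℤ → PowerSeries ℤ} {S : PowerSeries ℤ} (h0 : f 0 = 0)
    (hneg : ∀ n : ℕ, f (-((n : ℤ) + 1)) = f (n + 1))
    (h : HasSum (fun n : ℕ => f (n + 1)) S) : HasSum f (2 * S) := by
  have := HasSum.of_add_one_of_neg_add_one (f := f) h (by simpa only [hneg] using h)
  exact hasSum_of_eq this (fun _ => rfl) (by rw [h0]; ring)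

/-- The family `|m| X ^ |m| / (1 - X ^ (2 |m|))`. -/
noncomputable def lam (m : ℤ) : PowerSeries ℤ :=
  (m.natAbs : PowerSeries ℤ) * X ^ m.natAbs * ginv (2 * m.natAbs)

theorem lam_neg (m : ℤ) : lam (-m) = lam m := by simp [lam]

theorem dvd_lam (m : ℤ) : X ^ m.natAbs ∣ lam m :=
  Dvd.dvd.mul_right (Dvd.intro_left _ rfl) _

theorem lam_mul (m : ℕ) : (1 - X ^ (2 * m)) * lam m = (m : PowerSeries ℤ) * X ^ m := by
  rcases Nat.eq_zero_or_pos m with rfl | hm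
  · simp
  · have := mul_ginv (m := 2 * m) (by omega)
    simp only [lam, Int.natAbs_natCast]
    linear_combination ((m : PowerSeries ℤ) * X ^ m) * this

/-- The Lambert series `∑_{k ≥ 1} k X ^ k / (1 - X ^ (2 k))`. -/
noncomputable def lambert : PowerSeries ℤ := ∑' n : ℕ, lam (n + 1)

theorem summable_lam_succ : Summable fun n : ℕ => lam (n + 1) :=
  summable_of_dvd (e := id) proper_id fun n =>
    (pow_dvd_pow _ (by simp only [id]; omega)).trans (dvd_lam _)

theorem hasSum_lambert : HasSum (fun n : ℕ => lam (n + 1)) lambert := summable_lam_succ.hasSum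

theorem hasSum_lam : HasSum lam (2 * lambert) :=
  hasSum_int_of_symm (by simp [lam]) (fun _ => lam_neg _) hasSum_lambert

/-- The terms of the theta series. -/
noncomputable def thetaTerm (n : ℤ) : PowerSeries ℤ := (sg n : PowerSeries ℤ) * X ^ sqn n

theorem thetaTerm_neg (n : ℤ) : thetaTerm (-n) = thetaTerm n := by
  rw [thetaTerm, thetaTerm, sg_neg, sqn, neg_sq, sqn]

/-- The convolution of `thetaTerm` and `lam`. -/
noncomputable def thetaLam (k : ℤ) : PowerSeries ℤ := ∑' n, thetaTerm n * lam (k - n)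

theorem summable_thetaLam (k : ℤ) : Summable fun n => thetaTerm n * lam (k - n) :=
  (hasSum_convolution hasSum_theta hasSum_lam).1 k

theorem hasSum_thetaLam : HasSum thetaLam (theta * (2 * lambert)) :=
  (hasSum_convolution hasSum_theta hasSum_lam).2

theorem thetaLam_neg (k : ℤ) : thetaLam (-k) = thetaLam k := by
  have h := ((Equiv.neg ℤ).hasSum_iff).mpr (summable_thetaLam (-k)).hasSum
  refine (hasSum_of_eq h (fun n => ?_) rfl : HasSum (fun n => thetaTerm n * lam (k - n)) _).unique
    (summable_thetaLam k).hasSum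
  simp only [Function.comp_apply, Equiv.neg_apply]
  rw [thetaTerm_neg, ← lam_neg]
  congr 2
  ring

theorem expand_two_X_pow (n : ℕ) :
    expand 2 two_ne_zero ((X : PowerSeries ℤ) ^ n) = X ^ (2 * n) := by
  rw [map_pow, expand_X, ← pow_mul]

theorem hasSum_sg_two_mul_tri :
    HasSum (fun n : ℤ => (sg n : PowerSeries ℤ) * X ^ (2 * tri n)) 0 := by
  refine hasSum_of_eq (HasSum.expand hasSum_sg_tri 2 two_ne_zero) (fun n => ?_) (by simp)
  rw [map_mul, map_intCast, expand_two_X_pow]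

theorem hasSum_jacobi_two : HasSum (fun n : ℤ => (n : PowerSeries ℤ) *
    ((sg n : PowerSeries ℤ) * X ^ (2 * tri n))) (eta 2 ^ 3) := by
  refine hasSum_of_eq (HasSum.expand hasSum_jacobi 2 two_ne_zero) (fun n => ?_) ?_
  · rw [map_mul, map_mul, map_intCast, map_intCast, expand_two_X_pow]
  · rw [map_pow, expand_eta _ _ one_pos, mul_one]

/-- The exponents `2 * k + 1 + n ^ 2` and `(n + 1) ^ 2` differ by `2 * (k - n)`. The combination
therefore cancels the denominator of `lam (k - n)` and leaves a Jacobi-type term with weight `n -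
k`. -/
theorem thetaTerm_lam (k : ℕ) (n : ℤ) :
    X ^ (2 * k + 1) * (thetaTerm n * lam (k - n)) + thetaTerm (n + 1) * lam (k - n) =
      X ^ (k + 1) * ((n : PowerSeries ℤ) * ((sg n : PowerSeries ℤ) * X ^ (2 * tri n)) -
        (k : PowerSeries ℤ) * ((sg n : PowerSeries ℤ) * X ^ (2 * tri n))) := by
  have h1 := coe_sqn n
  have h2 := coe_sqn (n + 1)
  have h3 := two_mul_tri n
  simp only [thetaTerm, sg_succ]
  push_cast
  rcases le_or_gt n k with h | h
  · obtain ⟨m, hm⟩ := Int.eq_ofNat_of_zero_le (sub_nonneg.mpr h)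
    have hl := lam_mul m
    rw [hm]
    have e1 : 2 * k + 1 + sqn n = sqn (n + 1) + 2 * m := by zify; rw [h1, h2, ← hm]; ring
    have e2 : k + 1 + 2 * tri n = sqn (n + 1) + m := by
      zify; rw [h2, ← hm, h3]; ring
    have e3 : (m : PowerSeries ℤ) = k - n := by
      have : (m : ℤ) = k - n := hm.symm
      exact_mod_cast congrArg (Int.cast : ℤ → PowerSeries ℤ) this
    have e1' := congrArg ((X : PowerSeries ℤ) ^ ·) e1
    have e2' := congrArg ((X : PowerSeries ℤ) ^ ·) e2
    simp only [pow_add] at e1' e2'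
    rw [e3] at hl
    linear_combination (sg n : PowerSeries ℤ) * lam m * e1' -
      (sg n : PowerSeries ℤ) * (n - k) * e2' - (sg n : PowerSeries ℤ) * X ^ sqn (n + 1) * hl
  · obtain ⟨m, hm⟩ := Int.eq_ofNat_of_zero_le (sub_nonneg.mpr h.le)
    have hl := lam_mul m
    rw [show (k : ℤ) - n = -(n - k) by ring, lam_neg, hm]
    have e1 : 2 * k + 1 + sqn n + 2 * m = sqn (n + 1) := by zify; rw [h1, h2, ← hm]; ring
    have e2 : k + 1 + 2 * tri n = 2 * k + 1 + sqn n + m := by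
      zify; rw [h1, ← hm, h3]; ring
    have e3 : (m : PowerSeries ℤ) = n - k := by
      have : (m : ℤ) = n - k := hm.symm
      exact_mod_cast congrArg (Int.cast : ℤ → PowerSeries ℤ) this
    have e1' := congrArg ((X : PowerSeries ℤ) ^ ·) e1
    have e2' := congrArg ((X : PowerSeries ℤ) ^ ·) e2
    simp only [pow_add] at e1' e2'
    rw [e3] at hl
    linear_combination (sg n : PowerSeries ℤ) * lam m * e1' -
      (sg n : PowerSeries ℤ) * (n - k) * e2' +
      (sg n : PowerSeries ℤ) * X ^ (2 * k + 1) * X ^ sqn n * hl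

/-- Summing `thetaTerm_lam` over `n`, Jacobi's identity evaluates the part weighted by `n`, and the
part weighted by `k` vanishes. -/
theorem thetaLam_succ (k : ℕ) :
    thetaLam (k + 1) = X ^ (k + 1) * eta 2 ^ 3 - X ^ (2 * k + 1) * thetaLam k := by
  have h1 := (summable_thetaLam k).hasSum.mul_left (X ^ (2 * k + 1))
  have h2 := ((Equiv.addRight (1 : ℤ)).hasSum_iff).mpr (summable_thetaLam (k + 1)).hasSum
  have h3 := h1.add h2
  have h4 := ((hasSum_jacobi_two.sub (hasSum_sg_two_mul_tri.mul_left (k : PowerSeries ℤ))).mul_left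
    (X ^ (k + 1)))
  have h5 := (hasSum_of_eq h4 (fun n => ?_) rfl : HasSum _ _).unique h3
  · rw [mul_zero, sub_zero] at h5
    rw [h5]
    simp only [thetaLam]
    ring
  · rw [← thetaTerm_lam]
    simp only [Function.comp_apply, Equiv.coe_addRight]
    rw [show (k : ℤ) + 1 - (n + 1) = k - n by ring]

/-- The coefficients of the Appell–Lerch sum arranged along diagonals. -/
noncomputable def appell (k : ℕ) : PowerSeries ℤ :=
  ∑ p ∈ Finset.HasAntidiagonal.antidiagonal k, (-1) ^ p.1 * X ^ ((p.1 + 1) ^ 2 + (2 * p.1 + 1) * p.2)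

/-- With the index shifted by one and `eta 2 ^ 3` removed, this is the recurrence of
`thetaLam_succ`. -/
theorem appell_succ (k : ℕ) : appell (k + 1) = X ^ (k + 2) - X ^ (2 * k + 3) * appell k := by
  rw [appell, Finset.Nat.sum_antidiagonal_succ, appell, Finset.mul_sum, sub_eq_add_neg,
    ← Finset.sum_neg_distrib]
  congr 1
  · simp; ring
  · refine Finset.sum_congr rfl fun p hp => ?_
    have hk : p.1 + p.2 = k := Finset.HasAntidiagonal.mem_antidiagonal.mp hp
    subst hk
    simp only
    ring

theorem hasSum_appell : HasSum appell (phi * theta) := by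
  set F : ℕ × ℕ → PowerSeries ℤ := fun p =>
    (-1) ^ p.1 * X ^ ((p.1 + 1) ^ 2 + (2 * p.1 + 1) * p.2) with hF
  have hs : Summable F := by
    refine summable_of_dvd (e := fun p : ℕ × ℕ => id p.1 + id p.2)
      (proper_add proper_id proper_id) fun p => ?_
    refine Dvd.dvd.mul_left (pow_dvd_pow _ ?_) _
    simp only [id]
    nlinarith
  obtain ⟨S, hS⟩ := hs
  have hrow : ∀ j, HasSum (fun i => F (j, i)) ((-1) ^ j * X ^ ((j + 1) ^ 2) * ginv (2 * j + 1)) := by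
    intro j
    have h := (hasSum_geometric (f := X ^ (2 * j + 1)) (by simp)).mul_left
      ((-1) ^ j * X ^ ((j + 1) ^ 2))
    refine hasSum_of_eq h (fun i => ?_) rfl
    simp only [hF]
    ring
  have h1 := hS.prod_fiberwise hrow
  have h2 : S = phi * theta := h1.unique hasSum_phi_mul_theta
  have h3 := (Finset.HasAntidiagonal.sigmaAntidiagonalEquivProd.hasSum_iff (f := F)).mpr hS
  have h4 := h3.sigma (g := appell) fun k => by
    have := Finset.hasSum (Finset.HasAntidiagonal.antidiagonal k) F
    exact this
  rwa [h2] at h4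

/-- A particular solution plus a multiple of `thetaTerm`, which solves the homogeneous recurrence.
-/
theorem thetaLam_eq (k : ℕ) : thetaLam (k + 1) =
    eta 2 ^ 3 * appell k + thetaTerm (k + 1) * thetaLam 0 := by
  have hs : ∀ k : ℕ, thetaTerm (k + 1) = -(X ^ (2 * k + 1) * thetaTerm k) := by
    intro k
    have e : sqn (k + 1) = 2 * k + 1 + sqn k := by zify; rw [coe_sqn, coe_sqn]; ring
    rw [thetaTerm, thetaTerm, sg_succ, e]
    push_cast
    ring
  have h0 : thetaTerm 0 = 1 := by simp [thetaTerm, sqn]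
  induction k with
  | zero =>
    have h1 := thetaLam_succ 0
    have h2 := hs 0
    have h3 : appell 0 = X := by simp [appell]
    simp only [Nat.cast_zero, h0, zero_add, mul_zero, pow_one, mul_one] at h1 h2 ⊢
    rw [h1, h2, h3]
    ring
  | succ k ih =>
    have h1 := thetaLam_succ (k + 1)
    have h2 := hs (k + 1)
    push_cast at h1 h2 ⊢
    rw [h1, ih, h2, appell_succ]
    ring

/-- `thetaLam_eq` is summed over all integers. Every term of the result contains a factor `theta`,
which is cancelled. -/
theorem two_mul_eta_mul_phi : 2 * (eta 2 ^ 3 * phi) + thetaLam 0 = 2 * lambert := by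
  set b : ℤ → PowerSeries ℤ := fun k => thetaLam k - thetaTerm k * thetaLam 0 with hb
  have hb0 : b 0 = 0 := by simp [hb, thetaTerm, sqn]
  have hbn : ∀ n : ℕ, b (-((n : ℤ) + 1)) = b (n + 1) := fun n => by
    simp only [hb]
    rw [thetaLam_neg, thetaTerm_neg]
  have h1 := hasSum_int_of_symm hb0 hbn
    (hasSum_of_eq (hasSum_appell.mul_left (eta 2 ^ 3))
      (fun k => by simp only [hb]; rw [thetaLam_eq]; ring) rfl)
  have h2 := hasSum_thetaLam.sub (hasSum_theta.mul_right (thetaLam 0))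
  have h3 := h1.unique h2
  apply mul_right_cancel₀ (ne_zero_of_constantCoeff constantCoeff_theta)
  linear_combination h3

/-! ### The Lambert series for `ψ(q ^ 2) ^ 2` -/

/-- The inverse of `1 + X ^ m`. -/
noncomputable def hinv (m : ℕ) : PowerSeries ℤ := pinv (1 + X ^ m)

theorem mul_hinv (u : ℕ) : (1 + X ^ (2 * u + 1)) * hinv (2 * u + 1) = 1 :=
  mul_pinv (constantCoeff_one_add_X_pow (by omega))

/-- The identification of `n` and `-1 - n`. -/
def fold (n : ℤ) : ℕ := if 0 ≤ n then n.toNat else (-1 - n).toNat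

theorem fold_natCast (u : ℕ) : fold u = u := by simp [fold]

theorem fold_reflect (n : ℤ) : fold (-1 - n) = fold n := by
  unfold fold; split_ifs <;> omega

theorem int_cases (n : ℤ) : (∃ u : ℕ, n = u) ∨ ∃ u : ℕ, n = -1 - u := by
  rcases le_or_gt 0 n with h | h
  · exact Or.inl ⟨n.toNat, by omega⟩
  · exact Or.inr ⟨(-1 - n).toNat, by omega⟩

/-- The family `X ^ n / (1 + X ^ (2 n + 1))`. -/
noncomputable def kap (n : ℤ) : PowerSeries ℤ := X ^ fold n * hinv (2 * fold n + 1)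

theorem kap_reflect (n : ℤ) : kap (-1 - n) = kap n := by rw [kap, fold_reflect, kap]

theorem kap_natCast (u : ℕ) : kap u = X ^ u * hinv (2 * u + 1) := by rw [kap, fold_natCast]

theorem kap_negSucc (u : ℕ) : kap (-1 - u) = X ^ u * hinv (2 * u + 1) := by
  rw [kap_reflect, kap_natCast]

/-- The decaying part of `1 / (1 + X ^ (2 m + 1))`. -/
noncomputable def hdec (m : ℤ) : PowerSeries ℤ :=
  (if 0 ≤ m then -1 else 1) * (X ^ (2 * fold m + 1) * hinv (2 * fold m + 1))

/-- The family `1 / (1 + X ^ (2 m + 1))`. -/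
noncomputable def ffun (m : ℤ) : PowerSeries ℤ := hdec m + if 0 ≤ m then 1 else 0

theorem ffun_natCast (u : ℕ) : ffun u = hinv (2 * u + 1) := by
  have := mul_hinv u
  simp only [ffun, hdec, fold_natCast, Int.natCast_nonneg, if_true]
  linear_combination -this

theorem ffun_negSucc (u : ℕ) : ffun (-1 - u) = X ^ (2 * u + 1) * hinv (2 * u + 1) := by
  have h : ¬ (0 ≤ (-1 - u : ℤ)) := by omega
  simp only [ffun, hdec, fold_reflect, fold_natCast, h, if_false]
  ring

theorem ffun_reflect (m : ℤ) : ffun (-1 - m) = 1 - ffun m := by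
  rcases int_cases m with ⟨u, rfl⟩ | ⟨u, rfl⟩
  · have := mul_hinv u
    rw [ffun_negSucc, ffun_natCast]
    linear_combination this
  · have := mul_hinv u
    rw [show -1 - (-1 - (u : ℤ)) = u by ring, ffun_negSucc, ffun_natCast]
    linear_combination this

theorem dvd_hdec (m : ℤ) : X ^ m.natAbs ∣ hdec m := by
  refine Dvd.dvd.mul_left (Dvd.dvd.mul_right (pow_dvd_pow _ ?_) _) _
  unfold fold
  split_ifs <;> omega

theorem summable_hdec : Summable hdec := summable_of_dvd proper_natAbs dvd_hdec

theorem dvd_kap (n : ℤ) : X ^ (n.natAbs - 1) ∣ kap n := by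
  refine Dvd.dvd.mul_right (pow_dvd_pow _ ?_) _
  unfold fold
  split_ifs <;> omega

theorem proper_natAbs_sub_one : Proper fun n : ℤ => n.natAbs - 1 := fun N =>
  (Set.finite_Icc (-(N + 1 : ℤ)) (N + 1)).subset fun i hi => by
    simp only [Set.mem_ofPred_eq] at hi
    simp only [Set.mem_Icc]; omega

theorem summable_kap : Summable kap := summable_of_dvd proper_natAbs_sub_one dvd_kap

/-- The differences of `ffun`. -/
noncomputable def gfun (m : ℤ) : PowerSeries ℤ := ffun m - ffun (m - 1)

theorem gfun_eq (m : ℤ) : gfun m = hdec m - hdec (m - 1) + if m = 0 then 1 else 0 := by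
  simp only [gfun, ffun]
  rcases lt_trichotomy m 0 with h | h | h
  · simp [show ¬ (0 ≤ m) by omega, show ¬ (1 ≤ m) by omega, h.ne]
  · subst h; simp; ring
  · simp [h.le, show 1 ≤ m by omega, h.ne']

theorem dvd_gfun (m : ℤ) : X ^ (m.natAbs - 1) ∣ gfun m := by
  rw [gfun_eq]
  refine dvd_add (dvd_sub ?_ ?_) ?_
  · exact (pow_dvd_pow _ (by omega)).trans (dvd_hdec m)
  · exact (pow_dvd_pow _ (by omega)).trans (dvd_hdec (m - 1))
  · split_ifs with h
    · subst h; simp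
    · exact dvd_zero _

/-- A telescoping sum: `ffun` tends to 0 at minus infinity and to 1 at plus infinity. -/
theorem hasSum_gfun : HasSum gfun 1 := by
  have h1 := summable_hdec.hasSum
  have h2 := ((Equiv.subRight (1 : ℤ)).hasSum_iff).mpr h1
  refine hasSum_of_eq ((h1.sub h2).add (hasSum_ite_eq (0 : ℤ) (1 : PowerSeries ℤ)))
    (fun m => gfun_eq m) (by ring)

theorem summable_mul_gfun : Summable fun m : ℤ => (m : PowerSeries ℤ) * gfun m :=
  summable_of_dvd proper_natAbs_sub_one fun m => Dvd.dvd.mul_left (dvd_gfun m) _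

/-- The terms `(-1) ^ n X ^ (n (n - 1))`. -/
noncomputable def jac (n : ℤ) : PowerSeries ℤ := (sg n : PowerSeries ℤ) * X ^ (2 * tri (-n))

theorem proper_two_mul_tri_neg : Proper fun n : ℤ => 2 * tri (-n) :=
  (proper_tri.comp neg_injective).mono fun n => by simp only [Function.comp_apply]; omega

theorem hasSum_jac : HasSum jac 0 := by
  refine hasSum_of_eq (((Equiv.neg ℤ).hasSum_iff).mpr hasSum_sg_two_mul_tri) (fun n => ?_) rfl
  simp [jac, sg_neg]

theorem hasSum_mul_jac : HasSum (fun n : ℤ => (n : PowerSeries ℤ) * jac n) (-(eta 2 ^ 3)) := by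
  refine hasSum_of_eq (((Equiv.neg ℤ).hasSum_iff).mpr hasSum_jacobi_two).neg (fun n => ?_) rfl
  simp [jac, sg_neg]

theorem tri_reflect (n : ℤ) : tri (-1 - n) = tri n := by
  have h1 := two_mul_tri n
  have h2 := two_mul_tri (-1 - n)
  have : (-1 - n) * (-1 - n + 1) = n * (n + 1) := by ring
  omega

theorem jac_reflect (n : ℤ) : jac (1 - n) = -jac n := by
  rw [jac, jac, show (1 : ℤ) - n = -n + 1 by ring, sg_succ, sg_neg,
    show -(-n + 1) = -1 - (-n) by ring, tri_reflect]
  push_cast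
  ring

/-- The convolution of `jac` and `ffun`. -/
noncomputable def jacF (k : ℤ) : PowerSeries ℤ := ∑' n, jac n * ffun (k - n)

theorem hasSum_jacF (k : ℤ) : HasSum (fun n => jac n * ffun (k - n)) (jacF k) :=
  (summable_of_dvd proper_two_mul_tri_neg fun _ =>
    Dvd.dvd.mul_right (Dvd.intro_left _ rfl) _).hasSum

/-- Under `n ↦ 1 - n` the factor `jac` changes sign and `ffun` becomes `1 - ffun`; the extra sum of
`jac` is zero. -/
theorem jacF_neg (k : ℤ) : jacF (-k) = jacF k := by
  have h1 := ((Equiv.subLeft (1 : ℤ)).hasSum_iff).mpr (hasSum_jacF (-k))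
  have h2 := (hasSum_jacF k).sub hasSum_jac
  rw [sub_zero] at h2
  refine (hasSum_of_eq h1 (fun n => ?_) rfl : HasSum (fun n => jac n * ffun (k - n) - jac n) _).unique h2
  simp only [Function.comp_apply, Equiv.subLeft_apply]
  rw [jac_reflect, show -k - (1 - n) = -1 - (k - n) by ring, ffun_reflect]
  ring

theorem two_mul_tri_neg (n : ℤ) : 2 * (tri (-n) : ℤ) = n ^ 2 - n := by
  rw [two_mul_tri]; ring

/-- The shift matches exponents so that the denominator `1 + X ^ (2 * u + 1)` cancels in each term.
What remains is an alternating triangular sum, which is zero. -/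
theorem jacF_succ (k : ℕ) : jacF (k + 1) = X ^ (2 * k + 1) * jacF k := by
  have h1 := ((Equiv.addRight (1 : ℤ)).hasSum_iff).mpr (hasSum_jacF (k + 1))
  have h2 := (hasSum_jacF k).mul_left (X ^ (2 * k + 1))
  have h3 := h1.sub h2
  have h4 := hasSum_sg_two_mul_tri.neg
  rw [neg_zero] at h4
  have h5 := h3.unique (hasSum_of_eq h4 (fun n => ?_) rfl)
  · exact sub_eq_zero.mp h5
  · simp only [Function.comp_apply, Equiv.coe_addRight, jac]
    rw [show (k : ℤ) + 1 - (n + 1) = k - n by ring, sg_succ, show -(n + 1) = -1 - n by ring,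
      tri_reflect]
    push_cast
    have e1 := two_mul_tri n
    have e2 := two_mul_tri_neg n
    rcases int_cases (k - n) with ⟨u, hu⟩ | ⟨u, hu⟩
    · rw [hu, ffun_natCast]
      have e3 : 2 * k + 1 + 2 * tri (-n) = 2 * tri n + (2 * u + 1) := by
        zify; rw [e1, e2, ← hu]; ring
      have e4 := congrArg ((X : PowerSeries ℤ) ^ ·) e3
      simp only [pow_add _ (2 * tri n), pow_add _ (2 * k + 1)] at e4
      linear_combination -(sg n : PowerSeries ℤ) * hinv (2 * u + 1) * e4 -
        (sg n : PowerSeries ℤ) * X ^ (2 * tri n) * mul_hinv u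
    · rw [hu, ffun_negSucc]
      have e3 : 2 * tri n = 2 * k + 1 + 2 * tri (-n) + (2 * u + 1) := by
        zify
        have : (u : ℤ) = n - k - 1 := by linarith
        rw [e1, e2, this]; ring
      rw [e3, pow_add, pow_add]
      linear_combination -(sg n : PowerSeries ℤ) * X ^ (2 * k + 1) * X ^ (2 * tri (-n)) *
        X ^ (2 * u + 1) * mul_hinv u

theorem sqn_neg (n : ℤ) : sqn (-n) = sqn n := by simp [sqn]

theorem jacF_eq (k : ℤ) : jacF k = X ^ sqn k * jacF 0 := by
  have h : ∀ k : ℕ, jacF k = X ^ sqn k * jacF 0 := by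
    intro k
    induction k with
    | zero => simp [sqn]
    | succ k ih =>
      have e : sqn (k + 1) = 2 * k + 1 + sqn k := by zify; rw [coe_sqn, coe_sqn]; ring
      push_cast
      rw [jacF_succ, ih, e, pow_add]
      ring
  obtain ⟨n, rfl | rfl⟩ := k.eq_nat_or_neg
  · exact h n
  · rw [jacF_neg, sqn_neg, h]

/-- The sum of `k * (jacF k - jacF (k - 1))` is computed in two ways. By parts, with `jacF_eq`, it
is `-(thetaPos * jacF 0)`. As a convolution of `jac` with `gfun`, with `k` split as `n + (k - n)`,
it is `-(eta 2 ^ 3) * 1 + 0`. -/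
theorem jacF_mul_thetaPos : jacF 0 * thetaPos = eta 2 ^ 3 := by
  have hc : HasSum jacF (thetaPos * jacF 0) :=
    hasSum_of_eq (hasSum_thetaPos.mul_right (jacF 0)) jacF_eq rfl
  have hk : Summable fun k : ℤ => (k : PowerSeries ℤ) * jacF k :=
    summable_of_dvd proper_sqn fun k => by
      rw [jacF_eq]; exact Dvd.dvd.mul_left (Dvd.intro _ rfl) _
  obtain ⟨S, hS⟩ := hk
  have hS1 := ((Equiv.subRight (1 : ℤ)).hasSum_iff).mpr hS
  have hc1 := ((Equiv.subRight (1 : ℤ)).hasSum_iff).mpr hc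
  have ha := hasSum_convolution hasSum_mul_jac hasSum_gfun
  have hb := hasSum_convolution hasSum_jac summable_mul_gfun.hasSum
  have h1 := (hS.sub hS1).sub hc1
  have h2 := ha.2.add hb.2
  have h3 := h1.unique (hasSum_of_eq h2 (fun k => ?_) rfl)
  · linear_combination -h3
  · have e1 := ((hasSum_jacF k).sub (hasSum_jacF (k - 1))).mul_left (k : PowerSeries ℤ)
    have e2 := (ha.1 k).hasSum.add (hb.1 k).hasSum
    have e3 := e1.unique (hasSum_of_eq e2 (fun n => ?_) rfl)
    · simp only [Function.comp_apply, Equiv.subRight_apply]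
      rw [← e3]
      push_cast
      ring
    · rw [gfun, show k - n - 1 = k - 1 - n by ring]
      push_cast
      ring

/-- The bilateral sum of `kap`. -/
noncomputable def kapSum : PowerSeries ℤ := ∑' n, kap n

theorem hasSum_kap : HasSum kap kapSum := summable_kap.hasSum

/-- The theta function `ψ(X ^ 2)`. -/
noncomputable def psiTwo : PowerSeries ℤ := expand 2 two_ne_zero psi

theorem hasSum_two_mul_psiTwo :
    HasSum (fun n : ℤ => (X : PowerSeries ℤ) ^ (2 * tri n)) (2 * psiTwo) := by
  refine hasSum_of_eq (HasSum.expand hasSum_two_mul_psi 2 two_ne_zero) (fun n => ?_) ?_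
  · rw [expand_two_X_pow]
  · rw [map_mul, psiTwo, map_ofNat]

/-- The `k`-th convolution of the theta terms with `kap` agrees term by term with `X ^ k * jacF k`,
that is with `X ^ (2 * tri k) * jacF 0`; negative `k` follow by reflection. -/
theorem theta_mul_kapSum : theta * kapSum = 2 * psiTwo * jacF 0 := by
  obtain ⟨h1, h2⟩ := hasSum_convolution hasSum_theta hasSum_kap
  have hsym : ∀ k : ℤ, ∑' n, (sg n : PowerSeries ℤ) * X ^ sqn n * kap (-1 - k - n) =
      ∑' n, (sg n : PowerSeries ℤ) * X ^ sqn n * kap (k - n) := by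
    intro k
    rw [← (Equiv.neg ℤ).tsum_eq]
    refine tsum_congr fun n => ?_
    simp only [Equiv.neg_apply]
    rw [sg_neg, sqn_neg, show -1 - k - -n = -1 - (k - n) by ring, kap_reflect]
  have hnat : ∀ k : ℕ, ∑' n, (sg n : PowerSeries ℤ) * X ^ sqn n * kap (k - n) =
      X ^ (2 * tri k) * jacF 0 := by
    intro k
    have h3 := (hasSum_jacF k).mul_left (X ^ k)
    have e0 : X ^ (2 * tri k) * jacF 0 = X ^ k * jacF k := by
      rw [jacF_eq k, ← mul_assoc, ← pow_add]
      congr 2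
      have := two_mul_tri k
      zify
      rw [this, coe_sqn]
      ring
    rw [e0]
    refine (hasSum_of_eq h3 (fun n => ?_) rfl : HasSum _ _).tsum_eq
    have e1 := coe_sqn n
    have e2 := two_mul_tri_neg n
    rcases int_cases (k - n) with ⟨u, hu⟩ | ⟨u, hu⟩
    · rw [hu, ffun_natCast, kap_natCast, jac]
      have e3 : k + 2 * tri (-n) = sqn n + u := by zify; rw [e1, e2, ← hu]; ring
      have e4 := congrArg ((X : PowerSeries ℤ) ^ ·) e3
      simp only [pow_add] at e4
      linear_combination -(sg n : PowerSeries ℤ) * hinv (2 * u + 1) * e4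
    · rw [hu, ffun_negSucc, kap_negSucc, jac]
      have e3 : k + 2 * tri (-n) + (2 * u + 1) = sqn n + u := by
        have : (u : ℤ) = n - k - 1 := by linarith
        zify; rw [e1, e2, this]; ring
      have e4 := congrArg ((X : PowerSeries ℤ) ^ ·) e3
      simp only [pow_add _ _ u, pow_add _ k, pow_add _ _ (2 * u + 1)] at e4
      linear_combination -(sg n : PowerSeries ℤ) * hinv (2 * u + 1) * e4
  have h3 : HasSum (fun k : ℤ => X ^ (2 * tri k) * jacF 0) (theta * kapSum) := by
    refine hasSum_of_eq h2 (fun k => ?_) rfl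
    rcases int_cases k with ⟨u, rfl⟩ | ⟨u, rfl⟩
    · exact (hnat u).symm
    · rw [hsym, hnat, tri_reflect]
  exact h3.unique (hasSum_two_mul_psiTwo.mul_right (jacF 0))

theorem psiTwo_mul_eta : psiTwo * eta 2 = eta 4 ^ 2 := by
  have h := congrArg (expand 2 two_ne_zero) psi_mul_eta
  rw [map_mul, map_pow, expand_eta _ _ one_pos, expand_eta _ _ two_pos] at h
  exact h

theorem eta_sq_mul_kapSum : eta 2 ^ 2 * kapSum = 2 * eta 4 ^ 4 := by
  have h1 := theta_mul_kapSum
  have h2 := jacF_mul_thetaPos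
  have h3 := theta_mul_thetaPos
  have h4 := psiTwo_mul_eta
  apply mul_left_cancel₀ (pow_ne_zero 3 (eta_ne_zero two_pos))
  linear_combination (-(eta 2 * kapSum)) * h3 + (eta 2 * thetaPos * eta 4 ^ 2) * h1 +
    (2 * eta 2 * psiTwo * eta 4 ^ 2) * h2 + (2 * eta 2 ^ 3 * eta 4 ^ 2) * h4

/-! ### The odd part of `φ` -/

/-- The substitution `X ↦ -X`. -/
noncomputable def alt : PowerSeries ℤ →+* PowerSeries ℤ := rescale (-1)

theorem alt_X_pow (n : ℕ) : alt (X ^ n) = (-1) ^ n * X ^ n := by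
  rw [alt, map_pow, rescale_neg_one_X, neg_pow]

theorem alt_pinv {f : PowerSeries ℤ} (h : constantCoeff f = 1) : alt (pinv f) = pinv (alt f) := by
  refine eq_pinv ?_ ?_
  · rw [← coeff_zero_eq_constantCoeff_apply, alt, coeff_rescale, pow_zero, one_mul,
      coeff_zero_eq_constantCoeff_apply, h]
  · rw [← map_mul, mul_pinv h, map_one]

theorem alt_ginv_two_mul {m : ℕ} (hm : m ≠ 0) : alt (ginv (2 * m)) = ginv (2 * m) := by
  rw [ginv, alt_pinv (constantCoeff_one_sub_X_pow (by omega)), map_sub, alt_X_pow, map_one,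
    pow_mul, neg_one_sq, one_pow, one_mul]

theorem alt_ginv_odd (m : ℕ) : alt (ginv (2 * m + 1)) = hinv (2 * m + 1) := by
  rw [ginv, alt_pinv (constantCoeff_one_sub_X_pow (by omega)), map_sub, alt_X_pow, map_one,
    pow_succ, pow_mul, neg_one_sq, one_pow, one_mul, hinv, neg_one_mul, sub_neg_eq_add]

theorem sg_natAbs (n : ℤ) : (-1 : PowerSeries ℤ) ^ n.natAbs = (sg n : PowerSeries ℤ) := by
  have h : ∀ m : ℕ, (-1 : PowerSeries ℤ) ^ m = (sg m : PowerSeries ℤ) := fun m => by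
    rw [sg_natCast]; push_cast; rfl
  obtain ⟨m, rfl | rfl⟩ := n.eq_nat_or_neg
  · rw [Int.natAbs_natCast, h]
  · rw [sg_neg, Int.natAbs_neg, Int.natAbs_natCast, h]

theorem sg_sqn (n : ℤ) : (-1 : PowerSeries ℤ) ^ sqn n = (sg n : PowerSeries ℤ) := by
  have h : sqn n = n.natAbs * n.natAbs := by
    zify; rw [coe_sqn]; simp [sq]
  rw [h, ← sg_natAbs, pow_mul]
  rcases Nat.even_or_odd n.natAbs with h | h
  · rw [h.neg_one_pow, one_pow]
  · rw [h.neg_one_pow, h.neg_one_pow]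

theorem sg_mul_self_cast (n : ℤ) : (sg n : PowerSeries ℤ) * (sg n : PowerSeries ℤ) = 1 := by
  exact_mod_cast congrArg (Int.cast : ℤ → PowerSeries ℤ) (sg_mul_self n)

theorem alt_lam (m : ℤ) : alt (lam m) = (sg m : PowerSeries ℤ) * lam m := by
  by_cases hm : m.natAbs = 0
  · simp [lam, hm]
  · rw [lam, map_mul, map_mul, alt_ginv_two_mul hm, alt_X_pow, map_natCast, sg_natAbs]
    ring

theorem alt_thetaTerm (n : ℤ) : alt (thetaTerm n) = (sg n : PowerSeries ℤ) * thetaTerm n := by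
  rw [thetaTerm, map_mul, map_intCast, alt_X_pow, sg_sqn]

/-- In `thetaTerm n * lam (-n)` both factors have the parity of `n`, so the product is even in `X`.
The series therefore drops out of the odd part of `phi`. -/
theorem alt_thetaLam_zero : alt (thetaLam 0) = thetaLam 0 := by
  have h := (summable_thetaLam 0).hasSum
  refine (hasSum_of_eq (HasSum.rescale_neg_one h) (fun n => ?_) rfl :
    HasSum (fun n => thetaTerm n * lam (0 - n)) (alt (thetaLam 0))).unique h
  have h1 := alt_thetaTerm n
  have h2 := alt_lam (0 - n)
  have h3 := sg_mul_self_cast n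
  rw [show rescale (-1 : ℤ) = alt from rfl, map_mul, h1, h2, zero_sub, sg_neg]
  linear_combination -(thetaTerm n * lam (-n)) * h3

theorem alt_expand_two (f : PowerSeries ℤ) :
    alt (expand 2 two_ne_zero f) = expand 2 two_ne_zero f := by
  ext n
  rw [alt, coeff_rescale]
  by_cases h : 2 ∣ n
  · obtain ⟨m, rfl⟩ := h
    rw [pow_mul, neg_one_sq, one_pow, one_mul]
  · rw [coeff_expand_of_not_dvd _ _ _ h, mul_zero]

theorem eta_two : eta 2 = expand 2 two_ne_zero (eta 1) := by
  rw [expand_eta _ _ one_pos, mul_one]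

theorem two_ne_zero_powerSeries : (2 : PowerSeries ℤ) ≠ 0 := fun h => by
  have := congrArg constantCoeff h
  rw [map_ofNat, map_zero] at this
  norm_num at this

theorem hasSum_succ_mul_pow {f : PowerSeries ℤ} (h : constantCoeff f = 0) :
    HasSum (fun k : ℕ => ((k : PowerSeries ℤ) + 1) * f ^ k) (pinv (1 - f) ^ 2) := by
  have hd : ∀ k : ℕ, X ^ id k ∣ ((k : PowerSeries ℤ) + 1) * f ^ k := fun k =>
    Dvd.dvd.mul_left (pow_dvd_pow_of_dvd (X_dvd_iff.mpr h) k) _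
  obtain ⟨S, hS⟩ := summable_of_dvd proper_id hd
  have h1 : HasSum (fun k : ℕ => (k : PowerSeries ℤ) * f ^ k) (f * S) := by
    rw [← hasSum_nat_add_iff' 1]
    refine hasSum_of_eq (hS.mul_left f) (fun k => ?_) (by simp)
    push_cast
    ring
  have h2 := (hasSum_of_eq (hS.sub h1) (fun k => ?_) rfl : HasSum (fun k : ℕ => f ^ k) _).unique
    (hasSum_geometric h)
  · have h3 := mul_pinv (f := 1 - f) (by simp [h])
    refine hasSum_of_eq hS (fun _ => rfl) ?_
    linear_combination -(pinv (1 - f)) * h2 + S * h3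
  · ring

/-- Both sides expand into one double series. In this form `X ↦ -X` turns the terms into squares of
`hinv`, which are values of `kap` products. -/
theorem hasSum_lambert_odd :
    HasSum (fun m : ℕ => X ^ (2 * m + 1) * ginv (2 * m + 1) ^ 2) lambert := by
  set F : ℕ × ℕ → PowerSeries ℤ := fun p =>
    ((p.1 : PowerSeries ℤ) + 1) * X ^ ((p.1 + 1) * (2 * p.2 + 1)) with hF
  have hs : Summable F := by
    refine summable_of_dvd (e := fun p : ℕ × ℕ => id p.1 + id p.2)
      (proper_add proper_id proper_id) fun p => ?_
    refine Dvd.dvd.mul_left (pow_dvd_pow _ ?_) _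
    simp only [id]
    nlinarith
  obtain ⟨S, hS⟩ := hs
  have hrow : ∀ k, HasSum (fun m => F (k, m)) (lam (k + 1)) := by
    intro k
    have h := (hasSum_geometric (f := X ^ (2 * (k + 1))) (by simp)).mul_left
      (((k : PowerSeries ℤ) + 1) * X ^ (k + 1))
    refine hasSum_of_eq h (fun m => ?_) ?_
    · simp only [hF]
      ring
    · rw [lam, show ((k : ℤ) + 1).natAbs = k + 1 by omega, ginv]
      push_cast
      rfl
  have hcol : ∀ m, HasSum (fun k => F (k, m)) (X ^ (2 * m + 1) * ginv (2 * m + 1) ^ 2) := by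
    intro m
    have h := (hasSum_succ_mul_pow (f := X ^ (2 * m + 1)) (by simp)).mul_left (X ^ (2 * m + 1))
    refine hasSum_of_eq h (fun k => ?_) rfl
    simp only [hF]
    ring
  have h1 : S = lambert := (hS.prod_fiberwise hrow).unique hasSum_lambert
  have hS' : HasSum (fun p : ℕ × ℕ => F (p.2, p.1)) S :=
    ((Equiv.prodComm ℕ ℕ).hasSum_iff (f := F)).mpr hS
  rw [← h1]
  exact hS'.prod_fiberwise hcol

theorem hasSum_alt_lambert :
    HasSum (fun m : ℕ => X ^ (2 * m + 1) * hinv (2 * m + 1) ^ 2) (-alt lambert) := by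
  refine hasSum_of_eq (HasSum.rescale_neg_one hasSum_lambert_odd).neg (fun m => ?_) rfl
  rw [show rescale (-1 : ℤ) = alt from rfl, map_mul, map_pow alt (ginv _), alt_X_pow,
    alt_ginv_odd, pow_succ (-1 : PowerSeries ℤ), pow_mul (-1 : PowerSeries ℤ), neg_one_sq, one_pow]
  ring

/-- The convolution of `kap` with itself. -/
noncomputable def kapConv (k : ℤ) : PowerSeries ℤ := ∑' n, kap n * kap (k - n)

theorem hasSum_kapConv (k : ℤ) : HasSum (fun n => kap n * kap (k - n)) (kapConv k) :=
  ((hasSum_convolution hasSum_kap hasSum_kap).1 k).hasSum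

/-- A partial fraction decomposition; the cases only record which of the two indices is negative. -/
theorem kap_mul_kap (N : ℕ) (m : ℤ) : (1 - X ^ (2 * (N + 1))) * (kap m * kap (N - m)) =
    X ^ N * (ffun m - ffun (m - (N + 1 : ℕ))) := by
  rw [← kap_reflect (N - m), show -1 - (N - m) = m - (N + 1 : ℕ) by push_cast; ring]
  rcases int_cases m with ⟨u, rfl⟩ | ⟨u, rfl⟩
  · rcases int_cases ((u : ℤ) - (N + 1 : ℕ)) with ⟨v, hv⟩ | ⟨v, hv⟩
    · rw [hv, kap_natCast, kap_natCast, ffun_natCast, ffun_natCast]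
      obtain rfl : u = v + N + 1 := by omega
      have h1 := mul_hinv (v + N + 1)
      have h2 := mul_hinv v
      linear_combination X ^ N * hinv (2 * (v + N + 1) + 1) * h2 - X ^ N * hinv (2 * v + 1) * h1
    · rw [hv, kap_natCast, kap_negSucc, ffun_natCast, ffun_negSucc]
      obtain rfl : N = u + v := by omega
      have h1 := mul_hinv u
      have h2 := mul_hinv v
      linear_combination X ^ (u + v) * hinv (2 * u + 1) * h2 -
        X ^ (u + v) * X ^ (2 * v + 1) * hinv (2 * v + 1) * h1
  · rw [show -1 - (u : ℤ) - (N + 1 : ℕ) = -1 - (u + N + 1 : ℕ) by push_cast; ring, kap_negSucc,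
      kap_negSucc, ffun_negSucc, ffun_negSucc]
    have h1 := mul_hinv u
    have h2 := mul_hinv (u + N + 1)
    linear_combination X ^ N * X ^ (2 * u + 1) * hinv (2 * u + 1) * h2 -
      X ^ N * X ^ (2 * (u + N + 1) + 1) * hinv (2 * (u + N + 1) + 1) * h1

theorem hasSum_ffun_sub (D : ℕ) : HasSum (fun m => ffun m - ffun (m - D)) (D : PowerSeries ℤ) := by
  induction D with
  | zero => simp [hasSum_zero]
  | succ D ih =>
    have h := ((Equiv.subRight (D : ℤ)).hasSum_iff).mpr hasSum_gfun
    refine hasSum_of_eq (ih.add h) (fun m => ?_) (by push_cast; ring)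
    simp only [Function.comp_apply, Equiv.subRight_apply, gfun]
    rw [show m - ((D + 1 : ℕ) : ℤ) = m - D - 1 by push_cast; ring]
    ring

/-- Summed over `m`, the differences of `ffun` at distance `N + 1` telescope to `N + 1`, the
numerator of `lam (N + 1)`. -/
theorem X_mul_kapConv (N : ℕ) : X * kapConv N = lam (N + 1) := by
  have h1 := (hasSum_kapConv N).mul_left (1 - X ^ (2 * (N + 1)))
  have h2 := (hasSum_ffun_sub (N + 1)).mul_left (X ^ N)
  have h3 := h1.unique (hasSum_of_eq h2 (fun m => kap_mul_kap N m) rfl)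
  have h4 := lam_mul (N + 1)
  push_cast at h3 h4
  apply mul_left_cancel₀ (ne_zero_of_constantCoeff
    (constantCoeff_one_sub_X_pow (n := 2 * (N + 1)) (by omega)))
  linear_combination X * h3 - h4

theorem kapConv_reflect (k : ℤ) : kapConv (-2 - k) = kapConv k := by
  have h := ((Equiv.subLeft (-1 : ℤ)).hasSum_iff).mpr (hasSum_kapConv (-2 - k))
  refine (hasSum_of_eq h (fun n => ?_) rfl : HasSum (fun n => kap n * kap (k - n)) _).unique
    (hasSum_kapConv k)
  simp only [Function.comp_apply, Equiv.subLeft_apply]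
  rw [kap_reflect, show -2 - k - (-1 - n) = -1 - (k - n) by ring, kap_reflect]

/-- The case in which `1 - X ^ (2 * (N + 1))` would be zero. By reflection the terms are squares of
`kap`, each occurring twice. -/
theorem X_mul_kapConv_neg_one : X * kapConv (-1) = -(2 * alt lambert) := by
  have h1 := (hasSum_kapConv (-1)).mul_left X
  have h2 := HasSum.of_nat_of_neg_add_one
    (f := fun n : ℤ => (X : PowerSeries ℤ) * (kap n * kap (-1 - n)))
    (hasSum_of_eq hasSum_alt_lambert (fun m => ?_) rfl)
    (hasSum_of_eq hasSum_alt_lambert (fun m => ?_) rfl)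
  · rw [h1.unique h2]
    ring
  · rw [kap_reflect, kap_natCast]
    ring
  · rw [kap_reflect, show -((m : ℤ) + 1) = -1 - m by ring, kap_negSucc]
    ring

theorem X_mul_kapSum_sq : X * kapSum ^ 2 = 2 * (lambert - alt lambert) := by
  have h1 := ((hasSum_convolution hasSum_kap hasSum_kap).2).mul_left X
  have h2 := ((Equiv.subRight (1 : ℤ)).hasSum_iff).mpr h1
  have h3 := hasSum_lam.add (hasSum_ite_eq (0 : ℤ) (-(2 * alt lambert)))
  have h4 := h2.unique (hasSum_of_eq h3 (fun j => ?_) rfl)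
  · linear_combination h4
  · simp only [Function.comp_apply, Equiv.subRight_apply]
    change X * kapConv (j - 1) = _
    have hz : lam 0 = 0 := by simp [lam]
    rcases lt_trichotomy j 0 with h | rfl | h
    · obtain ⟨n, hn⟩ := Int.eq_ofNat_of_zero_le (show 0 ≤ -j - 1 by omega)
      rw [if_neg h.ne, add_zero, show j - 1 = -2 - (n : ℤ) by omega, kapConv_reflect,
        X_mul_kapConv, ← lam_neg]
      congr 1
      omega
    · rw [if_pos rfl, zero_sub, X_mul_kapConv_neg_one, hz, zero_add]
    · obtain ⟨n, hn⟩ := Int.eq_ofNat_of_zero_le (show 0 ≤ j - 1 by omega)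
      rw [if_neg h.ne', add_zero, hn, X_mul_kapConv]
      congr 1
      omega

theorem eta_pow_mul_phi_sub : eta 2 ^ 7 * (phi - alt phi) = 2 * X * eta 4 ^ 8 := by
  have h1 := two_mul_eta_mul_phi
  have h2 := congrArg alt h1
  have h3 : alt (eta 2) = eta 2 := by rw [eta_two, alt_expand_two]
  rw [map_add, map_mul, map_mul, map_pow, h3, alt_thetaLam_zero, map_mul, map_ofNat] at h2
  have h4 := X_mul_kapSum_sq
  have h5 := eta_sq_mul_kapSum
  apply mul_left_cancel₀ two_ne_zero_powerSeries
  linear_combination eta 2 ^ 4 * (h1 - h2) - eta 2 ^ 4 * h4 +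
    X * (eta 2 ^ 2 * kapSum + 2 * eta 4 ^ 4) * h5

/-- The generating function of `a(2 n + 1)`. -/
noncomputable def oddPart : PowerSeries ℤ := PowerSeries.mk fun n => a (2 * n + 1)

theorem phi_sub_alt : phi - alt phi = 2 * X * expand 2 two_ne_zero oddPart := by
  ext n
  rw [mul_assoc, show (2 : PowerSeries ℤ) = C 2 by simp, coeff_C_mul, map_sub, alt, coeff_rescale]
  rcases Nat.even_or_odd' n with ⟨m, rfl | rfl⟩
  · rw [pow_mul, neg_one_sq, one_pow, one_mul, sub_self]
    rcases m with _ | m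
    · simp
    · rw [show 2 * (m + 1) = 2 * m + 1 + 1 by ring, coeff_succ_X_mul,
        coeff_expand_of_not_dvd _ _ _ (by omega), mul_zero]
  · rw [coeff_succ_X_mul, coeff_expand_mul, oddPart, coeff_mk, a, pow_succ, pow_mul, neg_one_sq,
      one_pow]
    ring

theorem eta_pow_mul_oddPart : eta 1 ^ 7 * oddPart = eta 2 ^ 8 := by
  have h1 := eta_pow_mul_phi_sub
  rw [phi_sub_alt] at h1
  have h2 : expand 2 two_ne_zero (eta 1 ^ 7 * oddPart) = expand 2 two_ne_zero (eta 2 ^ 8) := by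
    rw [map_mul, map_pow, map_pow, expand_eta _ _ one_pos, expand_eta _ _ two_pos]
    apply mul_left_cancel₀ (mul_ne_zero two_ne_zero_powerSeries
      (X_ne_zero (R := ℤ)))
    linear_combination h1
  ext n
  have h3 := congrArg (coeff (2 * n)) h2
  rwa [coeff_expand_mul, coeff_expand_mul] at h3

/-! ### Dissections modulo 5 -/

/-- The substitution `X ↦ X ^ 5`. -/
noncomputable def exf : PowerSeries ℤ →+* PowerSeries ℤ :=
  (expand 5 (by norm_num) : PowerSeries ℤ →ₐ[ℤ] PowerSeries ℤ)

/-- The substitution `X ↦ X ^ 2`. -/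
noncomputable def exd : PowerSeries ℤ →+* PowerSeries ℤ :=
  (expand 2 two_ne_zero : PowerSeries ℤ →ₐ[ℤ] PowerSeries ℤ)

theorem coeff_exf (n : ℕ) (f : PowerSeries ℤ) :
    coeff n (exf f) = if 5 ∣ n then coeff (n / 5) f else 0 :=
  coeff_expand 5 (by norm_num) f

theorem exf_X : exf X = X ^ 5 := expand_X 5 (by norm_num)

theorem exd_X : exd X = X ^ 2 := expand_X 2 two_ne_zero

theorem exf_eta {k : ℕ} (hk : 0 < k) : exf (eta k) = eta (5 * k) :=
  expand_eta 5 (by norm_num) hk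

theorem exd_eta {k : ℕ} (hk : 0 < k) : exd (eta k) = eta (2 * k) :=
  expand_eta 2 two_ne_zero hk

theorem exf_exd (f : PowerSeries ℤ) : exf (exd f) = exd (exf f) := by
  have h1 := expand_mul 5 (by norm_num) 2 two_ne_zero f
  have h2 := expand_mul 2 two_ne_zero 5 (by norm_num) f
  exact h1.symm.trans h2

/-- The series formed by the coefficients whose index is `j` modulo `5`. -/
noncomputable def U (j : ℕ) : PowerSeries ℤ →+ PowerSeries ℤ where
  toFun f := PowerSeries.mk fun n => coeff (5 * n + j) f
  map_add' f g := by ext n; simp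
  map_zero' := by ext n; simp

theorem coeff_U (j n : ℕ) (f : PowerSeries ℤ) : coeff n (U j f) = coeff (5 * n + j) f := by
  simp [U]

theorem continuous_U (j : ℕ) : Continuous (U j) := by
  rw [continuous_iff_continuousAt]
  intro f
  rw [ContinuousAt, WithPiTopology.tendsto_iff_coeff_tendsto]
  intro d
  simp_rw [coeff_U]
  exact (WithPiTopology.continuous_coeff ℤ _).tendsto f

theorem HasSum.U {ι : Type*} {f : ι → PowerSeries ℤ} {S : PowerSeries ℤ} (h : HasSum f S)
    (j : ℕ) : HasSum (fun i => U j (f i)) (U j S) :=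
  h.map (RamanujanPhi.U j) (continuous_U j)

theorem U_X_pow_mul_exf {i j : ℕ} (hi : i < 5) (hj : j < 5) (f : PowerSeries ℤ) :
    U j (X ^ i * exf f) = if i = j then f else 0 := by
  ext n
  rw [coeff_U, coeff_X_pow_mul', coeff_exf]
  by_cases h : i = j
  · subst h
    simp
  · rw [if_neg h, map_zero]
    split_ifs <;> first | rfl | (exfalso; omega)

theorem dissection (f : PowerSeries ℤ) : f = exf (U 0 f) + X * exf (U 1 f) +
    X ^ 2 * exf (U 2 f) + X ^ 3 * exf (U 3 f) + X ^ 4 * exf (U 4 f) := by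
  have h : f = ∑ i ∈ Finset.range 5, X ^ i * exf (U i f) := by
    ext n
    rw [map_sum, Finset.sum_eq_single (n % 5)]
    · rw [coeff_X_pow_mul', coeff_exf, coeff_U, if_pos (Nat.mod_le _ _), if_pos (by omega)]
      congr 2
      omega
    · intro i hi hne
      rw [Finset.mem_range] at hi
      rw [coeff_X_pow_mul', coeff_exf]
      split_ifs <;> first | rfl | omega
    · intro h
      exact absurd (Finset.mem_range.mpr (Nat.mod_lt _ (by norm_num))) h
  conv_lhs => rw [h]
  simp [Finset.sum_range_succ]

/-- Reading off a dissection modulo `5`. -/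
theorem U_eq_of_eq {f f0 f1 f2 f3 f4 : PowerSeries ℤ}
    (h : f = exf f0 + X * exf f1 + X ^ 2 * exf f2 + X ^ 3 * exf f3 + X ^ 4 * exf f4) :
    U 0 f = f0 ∧ U 1 f = f1 ∧ U 2 f = f2 ∧ U 3 f = f3 ∧ U 4 f = f4 := by
  have h0 := fun {j : ℕ} (hj : j < 5) => U_X_pow_mul_exf (show 0 < 5 by norm_num) hj f0
  have h1 := fun {j : ℕ} (hj : j < 5) => U_X_pow_mul_exf (show 1 < 5 by norm_num) hj f1
  have h2 := fun {j : ℕ} (hj : j < 5) => U_X_pow_mul_exf (show 2 < 5 by norm_num) hj f2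
  have h3 := fun {j : ℕ} (hj : j < 5) => U_X_pow_mul_exf (show 3 < 5 by norm_num) hj f3
  have h4 := fun {j : ℕ} (hj : j < 5) => U_X_pow_mul_exf (show 4 < 5 by norm_num) hj f4
  have key : ∀ j < 5, U j f = (if 0 = j then f0 else 0) + (if 1 = j then f1 else 0) +
      (if 2 = j then f2 else 0) + (if 3 = j then f3 else 0) + if 4 = j then f4 else 0 := by
    intro j hj
    rw [h, ← h0 hj, ← h1 hj, ← h2 hj, ← h3 hj, ← h4 hj]
    simp only [map_add, pow_zero, one_mul, pow_one]
  refine ⟨?_, ?_, ?_, ?_, ?_⟩ <;> rw [key _ (by norm_num)] <;> simp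

theorem U_mul (f g : PowerSeries ℤ) :
    U 0 (f * g) = U 0 f * U 0 g + X * (U 1 f * U 4 g + U 2 f * U 3 g + U 3 f * U 2 g +
      U 4 f * U 1 g) ∧
    U 1 (f * g) = U 0 f * U 1 g + U 1 f * U 0 g + X * (U 2 f * U 4 g + U 3 f * U 3 g +
      U 4 f * U 2 g) ∧
    U 2 (f * g) = U 0 f * U 2 g + U 1 f * U 1 g + U 2 f * U 0 g + X * (U 3 f * U 4 g +
      U 4 f * U 3 g) ∧
    U 3 (f * g) = U 0 f * U 3 g + U 1 f * U 2 g + U 2 f * U 1 g + U 3 f * U 0 g +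
      X * (U 4 f * U 4 g) ∧
    U 4 (f * g) = U 0 f * U 4 g + U 1 f * U 3 g + U 2 f * U 2 g + U 3 f * U 1 g +
      U 4 f * U 0 g := by
  refine U_eq_of_eq ?_
  conv_lhs => rw [dissection f, dissection g]
  simp only [map_add, map_mul, exf_X]
  ring

theorem U_exf (f : PowerSeries ℤ) :
    U 0 (exf f) = f ∧ U 1 (exf f) = 0 ∧ U 2 (exf f) = 0 ∧ U 3 (exf f) = 0 ∧ U 4 (exf f) = 0 :=
  U_eq_of_eq (by simp)

/-- Series in `X ^ 5` are scalars for `U j`. The later congruences arrange each term as such a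
scalar times a series with known components. -/
theorem U_exf_mul (f g : PowerSeries ℤ) {j : ℕ} (hj : j < 5) :
    U j (exf f * g) = f * U j g := by
  obtain ⟨h0, h1, h2, h3, h4⟩ := U_mul (exf f) g
  obtain ⟨e0, e1, e2, e3, e4⟩ := U_exf f
  simp only [e0, e1, e2, e3, e4, zero_mul, mul_zero, add_zero] at h0 h1 h2 h3 h4
  interval_cases j <;> assumption

theorem U_X_mul (f : PowerSeries ℤ) :
    U 0 (X * f) = X * U 4 f ∧ U 1 (X * f) = U 0 f ∧ U 2 (X * f) = U 1 f ∧
      U 3 (X * f) = U 2 f ∧ U 4 (X * f) = U 3 f := by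
  refine U_eq_of_eq ?_
  conv_lhs => rw [dissection f]
  simp only [map_mul, exf_X]
  ring

/-- Doubling permutes the residues modulo 5; the factors `X` record the carries in `2 * 3 = 5 + 1`
and `2 * 4 = 5 + 3`. -/
theorem U_exd (f : PowerSeries ℤ) :
    U 0 (exd f) = exd (U 0 f) ∧ U 1 (exd f) = X * exd (U 3 f) ∧ U 2 (exd f) = exd (U 1 f) ∧
      U 3 (exd f) = X * exd (U 4 f) ∧ U 4 (exd f) = exd (U 2 f) := by
  refine U_eq_of_eq ?_
  conv_lhs => rw [dissection f]
  simp only [map_add, map_mul, map_pow, exf_X, exd_X, exf_exd]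
  ring

theorem U_term {j : ℕ} (hj : j < 5) (c : ℤ) (e : ℕ) : U j ((c : PowerSeries ℤ) * X ^ e) =
    if e % 5 = j then (c : PowerSeries ℤ) * X ^ (e / 5) else 0 := by
  have h1 : (c : PowerSeries ℤ) = exf c := (map_intCast exf c).symm
  have h2 : (X : PowerSeries ℤ) ^ e = X ^ (e % 5) * exf (X ^ (e / 5)) := by
    rw [map_pow, exf_X, ← pow_mul, ← pow_add, Nat.mod_add_div]
  rw [h2]
  nth_rewrite 1 [h1]
  rw [U_exf_mul _ _ hj, U_X_pow_mul_exf (Nat.mod_lt _ (by norm_num)) hj]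
  split_ifs <;> simp

/-- The terms of a series in one residue class, enumerated by `g`. -/
theorem HasSum.U_reindex {ι κ : Type*} {c : ι → ℤ} {e : ι → ℕ} {S : PowerSeries ℤ} {j : ℕ}
    (h : HasSum (fun i => (c i : PowerSeries ℤ) * X ^ e i) S) (hj : j < 5) {g : κ → ι}
    (hg : Function.Injective g) {e' : κ → ℕ} (he : ∀ k, e (g k) = 5 * e' k + j)
    (hr : ∀ i, e i % 5 = j → i ∈ Set.range g) :
    HasSum (fun k => (c (g k) : PowerSeries ℤ) * X ^ e' k) (RamanujanPhi.U j S) := by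
  have h1 := HasSum.U h j
  simp only [U_term hj] at h1
  rw [← hg.hasSum_iff fun i hi => if_neg fun h => hi (hr i h)] at h1
  refine hasSum_of_eq h1 (fun k => ?_) rfl
  have := he k
  rw [Function.comp_apply, if_pos (by omega), show e (g k) / 5 = e' k by omega]

theorem U_eq_zero {ι : Type*} {c : ι → ℤ} {e : ι → ℕ} {S : PowerSeries ℤ} {j : ℕ}
    (h : HasSum (fun i => (c i : PowerSeries ℤ) * X ^ e i) S) (hj : j < 5)
    (hr : ∀ i, e i % 5 ≠ j) : U j S = 0 := by
  have h1 := HasSum.U h j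
  simp only [U_term hj, if_neg (hr _)] at h1
  exact h1.unique hasSum_zero

/-- The terms of a series in one residue class, enumerated by `g₁` and `g₂`, whose common values
are enumerated by `g₃`. -/
theorem U_add_eq_of_reindex {ι κ κ₃ : Type} {c : ι → ℤ} {e : ι → ℕ} {S : PowerSeries ℤ} {j : ℕ}
    (h : HasSum (fun i => (c i : PowerSeries ℤ) * X ^ e i) S) (hj : j < 5) {g₁ g₂ : κ → ι} {g₃ : κ₃ → ι}
    (hg₁ : Function.Injective g₁) (hg₂ : Function.Injective g₂) (hg₃ : Function.Injective g₃)
    {e₁ : κ → ℕ} {e₃ : κ₃ → ℕ} (he₁ : ∀ k, e (g₁ k) = 5 * e₁ k + j) (he₂ : ∀ k, e (g₂ k) = 5 * e₁ k + j)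
    (he₃ : ∀ k, e (g₃ k) = 5 * e₃ k + j)
    (hr : ∀ i, e i % 5 = j → i ∈ Set.range g₁ ∪ Set.range g₂)
    (h₃ : Set.range g₁ ∩ Set.range g₂ = Set.range g₃) {S₁ S₂ S₃ : PowerSeries ℤ}
    (hS₁ : HasSum (fun k => (c (g₁ k) : PowerSeries ℤ) * X ^ e₁ k) S₁)
    (hS₂ : HasSum (fun k => (c (g₂ k) : PowerSeries ℤ) * X ^ e₁ k) S₂)
    (hS₃ : HasSum (fun k => (c (g₃ k) : PowerSeries ℤ) * X ^ e₃ k) S₃) :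
    U j S + S₃ = S₁ + S₂ := by
  set F : ι → PowerSeries ℤ := fun i =>
    if e i % 5 = j then (c i : PowerSeries ℤ) * X ^ (e i / 5) else 0 with hF
  have h1 : HasSum F (U j S) := by
    have h1 := HasSum.U h j
    simpa only [U_term hj] using h1
  have key : ∀ {κ : Type} (g : κ → ι) (e' : κ → ℕ) (T : PowerSeries ℤ),
      Function.Injective g → (∀ k, e (g k) = 5 * e' k + j) →
      HasSum (fun k => (c (g k) : PowerSeries ℤ) * X ^ e' k) T →
      HasSum ((Set.range g).indicator F) T := by
    intro κ g e' T hg he hT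
    rw [← hg.hasSum_iff fun i hi => Set.indicator_of_notMem hi F]
    refine hasSum_of_eq hT (fun k => ?_) rfl
    have := he k
    rw [Function.comp_apply, Set.indicator_of_mem (Set.mem_range_self k)]
    simp only [hF]
    rw [if_pos (by omega), show e (g k) / 5 = e' k by omega]
  have h2 := (key g₁ e₁ S₁ hg₁ he₁ hS₁).add (key g₂ e₁ S₂ hg₂ he₂ hS₂)
  have h3 := h1.add (key g₃ e₃ S₃ hg₃ he₃ hS₃)
  refine h3.unique (hasSum_of_eq h2 (fun i => ?_) rfl)
  have h4 := congrFun (Set.indicator_union_add_inter F (Set.range g₁) (Set.range g₂)) i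
  rw [h₃] at h4
  simp only [Pi.add_apply] at h4
  rw [← h4]
  congr 1
  by_cases hi : i ∈ Set.range g₁ ∪ Set.range g₂
  · rw [Set.indicator_of_mem hi]
  · rw [Set.indicator_of_notMem hi]
    exact if_neg fun h => hi (hr i h)

/-! ### Components of the theta functions -/

theorem five_cases (n : ℤ) :
    ∃ m, n = 5 * m ∨ n = 5 * m + 1 ∨ n = 5 * m + 2 ∨ n = 5 * m + 3 ∨ n = 5 * m + 4 :=
  ⟨n / 5, by omega⟩

theorem tri_mod_five (n : ℤ) : tri n % 5 = 0 ∧ (n % 5 = 0 ∨ n % 5 = 4) ∨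
    tri n % 5 = 1 ∧ (n % 5 = 1 ∨ n % 5 = 3) ∨ tri n % 5 = 3 ∧ n % 5 = 2 := by
  have h := two_mul_tri n
  obtain ⟨m, rfl | rfl | rfl | rfl | rfl⟩ := five_cases n <;> ring_nf at h ⊢ <;> omega

theorem sqn_mod_five (n : ℤ) : sqn n % 5 = 0 ∧ n % 5 = 0 ∨
    sqn n % 5 = 1 ∧ (n % 5 = 1 ∨ n % 5 = 4) ∨ sqn n % 5 = 4 ∧ (n % 5 = 2 ∨ n % 5 = 3) := by
  have h := coe_sqn n
  obtain ⟨m, rfl | rfl | rfl | rfl | rfl⟩ := five_cases n <;> ring_nf at h ⊢ <;> omega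

theorem pent_mod_five (n : ℤ) : pent n % 5 = 0 ∧ (n % 5 = 0 ∨ n % 5 = 3) ∨
    pent n % 5 = 2 ∧ (n % 5 = 1 ∨ n % 5 = 2) ∨ pent n % 5 = 1 ∧ n % 5 = 4 := by
  have h := two_mul_pent n
  obtain ⟨m, rfl | rfl | rfl | rfl | rfl⟩ := five_cases n <;> ring_nf at h ⊢ <;> omega

theorem sg_five_mul (n : ℤ) : sg (5 * n) = sg n := by
  rw [show 5 * n = 2 * (2 * n) + n by ring, sg_add, sg_two_mul, one_mul]

theorem HasSum.exf {ι : Type*} {f : ι → PowerSeries ℤ} {S : PowerSeries ℤ} (h : HasSum f S) :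
    HasSum (fun i => exf (f i)) (exf S) := HasSum.expand h 5 (by norm_num)

theorem exf_X_pow (n : ℕ) : exf (X ^ n) = X ^ (5 * n) := by rw [map_pow, exf_X, pow_mul]

theorem tri_five_mul_add_two (m : ℤ) : tri (5 * m + 2) = 5 * (5 * tri m) + 3 := by
  have h1 := two_mul_tri m
  have h2 := two_mul_tri (5 * m + 2)
  have h3 : 2 * (tri (5 * m + 2) : ℤ) = 25 * (2 * tri m) + 6 := by rw [h1, h2]; ring
  omega

theorem pent_five_mul_sub_one (m : ℤ) : pent (5 * m - 1) = 5 * (5 * pent (-m)) + 1 := by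
  have h1 := two_mul_pent (-m)
  have h2 := two_mul_pent (5 * m - 1)
  have h3 : 2 * (pent (5 * m - 1) : ℤ) = 25 * (2 * pent (-m)) + 2 := by rw [h1, h2]; ring
  omega

theorem injective_five_mul_add (a : ℤ) : Function.Injective fun m : ℤ => 5 * m + a :=
  fun x y h => by simp only at h; omega

theorem U_eta : U 1 (eta 1) = -eta 5 ∧ U 3 (eta 1) = 0 ∧ U 4 (eta 1) = 0 := by
  refine ⟨?_, U_eq_zero hasSum_eta (by norm_num) fun n => ?_,
    U_eq_zero hasSum_eta (by norm_num) fun n => ?_⟩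
  · have h1 := HasSum.U_reindex hasSum_eta (j := 1) (by norm_num) (injective_five_mul_add (-1))
      pent_five_mul_sub_one (fun n hn => ⟨(n + 1) / 5, by
        have := pent_mod_five n
        simp only
        omega⟩)
    have h2 := (HasSum.exf (((Equiv.neg ℤ).hasSum_iff).mpr hasSum_eta)).neg
    rw [exf_eta one_pos, mul_one] at h2
    refine h1.unique (hasSum_of_eq h2 (fun m => ?_) rfl)
    rw [Function.comp_apply, Equiv.neg_apply, sg_neg, map_mul, map_intCast, exf_X_pow,
      show 5 * m + -1 = 5 * m - 2 + 1 by ring, sg_succ, show 5 * m - 2 = 2 * (-1) + 5 * m by ring,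
      sg_add, sg_two_mul, sg_five_mul]
    push_cast
    ring
  · have := pent_mod_five n; omega
  · have := pent_mod_five n; omega

/-- Triangular numbers are 0, 1 or 3 modulo 5, and 3 occurs only for `n = 5 * m + 2`. There the
weight splits into `5 * m`, giving the factor 5, and the constant 2, whose sum vanishes. -/
theorem U_eta_cube : U 2 (eta 1 ^ 3) = 0 ∧ U 3 (eta 1 ^ 3) = 5 * eta 5 ^ 3 ∧
    U 4 (eta 1 ^ 3) = 0 := by
  have h0 : HasSum (fun n : ℤ => ((n * sg n : ℤ) : PowerSeries ℤ) * X ^ tri n) (eta 1 ^ 3) :=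
    hasSum_of_eq hasSum_jacobi (fun n => by push_cast; ring) rfl
  refine ⟨U_eq_zero h0 (by norm_num) fun n => ?_, ?_, U_eq_zero h0 (by norm_num) fun n => ?_⟩
  · have := tri_mod_five n; omega
  · have h1 := HasSum.U_reindex h0 (j := 3) (by norm_num) (injective_five_mul_add 2)
      tri_five_mul_add_two (fun n hn => ⟨n / 5, by
        have := tri_mod_five n
        simp only
        omega⟩)
    have h2 := ((HasSum.exf hasSum_jacobi).mul_left 5).add ((HasSum.exf hasSum_sg_tri).mul_left 2)
    rw [map_pow, exf_eta one_pos, mul_one, map_zero, mul_zero, add_zero] at h2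
    refine h1.unique (hasSum_of_eq h2 (fun m => ?_) rfl)
    rw [map_mul, map_mul, map_intCast, map_intCast, exf_X_pow,
      show 5 * m + 2 = 2 * 1 + 5 * m by ring, sg_add, sg_two_mul, sg_five_mul]
    push_cast
    ring
  · have := tri_mod_five n; omega

theorem U_psi : U 2 psi = 0 ∧ U 3 psi = exf psi ∧ U 4 psi = 0 := by
  have h0 : HasSum (fun n : ℤ => ((1 : ℤ) : PowerSeries ℤ) * X ^ tri n) (2 * psi) :=
    hasSum_of_eq hasSum_two_mul_psi (fun n => by push_cast; ring) rfl
  have hU : ∀ j < 5, U j (2 * psi) = 2 * U j psi := fun j hj => by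
    have h := U_exf_mul 2 psi hj
    rwa [map_ofNat] at h
  refine ⟨?_, ?_, ?_⟩ <;> apply mul_left_cancel₀ two_ne_zero_powerSeries <;>
    rw [← hU _ (by norm_num)]
  · rw [mul_zero]
    refine U_eq_zero h0 (by norm_num) fun n => ?_
    have := tri_mod_five n; omega
  · have h1 := HasSum.U_reindex h0 (j := 3) (by norm_num) (injective_five_mul_add 2)
      tri_five_mul_add_two (fun n hn => ⟨n / 5, by
        have := tri_mod_five n
        simp only
        omega⟩)
    have h2 := HasSum.exf hasSum_two_mul_psi
    rw [map_mul, map_ofNat] at h2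
    refine h1.unique (hasSum_of_eq h2 (fun m => ?_) rfl)
    rw [exf_X_pow]
    push_cast
    ring
  · rw [mul_zero]
    refine U_eq_zero h0 (by norm_num) fun n => ?_
    have := tri_mod_five n; omega

theorem U_theta : U 0 theta = exf theta ∧ U 2 theta = 0 ∧ U 3 theta = 0 := by
  refine ⟨?_, U_eq_zero hasSum_theta (by norm_num) fun n => ?_,
    U_eq_zero hasSum_theta (by norm_num) fun n => ?_⟩
  · have h1 := HasSum.U_reindex hasSum_theta (j := 0) (by norm_num) (injective_five_mul_add 0)
      (e' := fun m => 5 * sqn m)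
      (fun m => by zify; rw [coe_sqn, coe_sqn]; ring) (fun n hn => ⟨n / 5, by
        have := sqn_mod_five n
        simp only
        omega⟩)
    refine h1.unique (hasSum_of_eq (HasSum.exf hasSum_theta) (fun m => ?_) rfl)
    rw [map_mul, map_intCast, exf_X_pow, add_zero, sg_five_mul]
  · have := sqn_mod_five n; omega
  · have := sqn_mod_five n; omega

/-- The exponents `5 n ^ 2 + b n`. -/
def quad (b : ℕ) (n : ℤ) : ℕ := (5 * n ^ 2 + b * n).toNat

theorem coe_quad {b : ℕ} (hb : b ≤ 5) (n : ℤ) : (quad b n : ℤ) = 5 * n ^ 2 + b * n := by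
  have hb' : (b : ℤ) ≤ 5 := by exact_mod_cast hb
  refine Int.toNat_of_nonneg ?_
  rcases le_or_gt 0 n with h | h
  · positivity
  · nlinarith

/-- The class `i ^ 2` is reached by `n = ±(5 * m + i)`. The two branches are disjoint and equal, and
each is a triple product with exponents `5 * m ^ 2 + 2 * i * m`. -/
theorem U_theta_eq {i b : ℕ} (hb : b ≤ 5) (hi : i = 1 ∧ b = 2 ∨ i = 2 ∧ b = 4) :
    U (i ^ 2) theta = 2 * (-1) ^ i * (qprod 1 (5 + b) 10 * qprod 1 (5 - b) 10 * eta 10) := by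
  have h0 := (isTheta_sg (a := 5 + b) (c := 5 - b) (e := quad b) (by omega) (fun n => by
    rw [coe_quad hb]; push_cast [Nat.cast_sub hb]; ring)).hasSum
  rw [show 5 + b + (5 - b) = 10 by omega] at h0
  have h1 := h0.mul_left ((-1) ^ i)
  have hinj := injective_five_mul_add i
  have e1 : ∀ m : ℤ, sqn (5 * m + i) = 5 * quad b m + i ^ 2 := fun m => by
    zify
    rw [coe_sqn, coe_quad hb]
    rcases hi with ⟨rfl, rfl⟩ | ⟨rfl, rfl⟩ <;> push_cast <;> ring
  have s1 : ∀ m : ℤ, sg (5 * m + i) = (-1) ^ i * sg m := fun m => by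
    rw [sg_add, sg_five_mul, sg_natCast, mul_comm]
  have h2 := U_add_eq_of_reindex hasSum_theta (j := i ^ 2) (by
      rcases hi with ⟨rfl, rfl⟩ | ⟨rfl, rfl⟩ <;> norm_num)
    (g₁ := fun m : ℤ => 5 * m + i) (g₂ := fun m : ℤ => -(5 * m + i)) (g₃ := Empty.elim)
    hinj (neg_injective.comp hinj) (Function.injective_of_subsingleton _)
    (e₁ := quad b) (e₃ := Empty.elim) e1 (fun m => by rw [sqn_neg, e1]) (fun k => k.elim)
    (fun n hn => ?_) ?_ (hasSum_of_eq h1 (fun m => ?_) rfl) (hasSum_of_eq h1 (fun m => ?_) rfl)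
    hasSum_empty
  · rw [add_zero] at h2
    rw [h2, eta]
    ring
  · have := sqn_mod_five n
    rcases hi with ⟨rfl, rfl⟩ | ⟨rfl, rfl⟩
    · by_cases h : n % 5 = 1
      · exact Or.inl ⟨n / 5, by simp only; omega⟩
      · exact Or.inr ⟨-n / 5, by simp only; omega⟩
    · by_cases h : n % 5 = 2
      · exact Or.inl ⟨n / 5, by simp only; omega⟩
      · exact Or.inr ⟨-n / 5, by simp only; omega⟩
  · ext n
    simp only [Set.mem_inter_iff, Set.mem_range, IsEmpty.exists_iff, iff_false]
    rintro ⟨⟨x, hx⟩, y, hy⟩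
    rcases hi with ⟨rfl, rfl⟩ | ⟨rfl, rfl⟩ <;> omega
  · rw [s1]
    push_cast
    ring
  · rw [sg_neg, s1]
    push_cast
    ring

/-- The four products in `U 1 theta` and `U 4 theta` run over the residues 1, 3, 7, 9 modulo 10;
only the residue 5 is missing from `qprod 1 1 2`. -/
theorem U_theta_mul : U 1 theta * U 4 theta * (eta 2 * eta 5) = -(4 * (eta 1 * eta 10 ^ 3)) := by
  have h1 := U_theta_eq (i := 1) (b := 2) (by norm_num) (by norm_num)
  have h4 := U_theta_eq (i := 2) (b := 4) (by norm_num) (by norm_num)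
  norm_num at h1 h4
  have h5 := qprod_split 1 1 two_pos (m := 5) (by norm_num)
  have h6 := qprod_one_two_mul_eta
  have h7 := congrArg exf qprod_one_two_mul_eta
  rw [map_mul, exf_eta one_pos, exf_eta two_pos,
    show exf (qprod 1 1 2) = qprod 1 (5 * 1) (5 * 2) from expand_qprod 5 (by norm_num) 1 1 two_pos]
    at h7
  norm_num [Finset.prod_range_succ] at h5 h7
  rw [h1, h4]
  rw [h5] at h6
  rw [← h6, ← h7]
  ring

theorem prime_five : Prime (5 : ℤ) := Int.prime_iff_natAbs_prime.mpr (by norm_num)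

/-- If `m ^ 2 + n ^ 2` is divisible by 5, then `m + n i` is a multiple of `2 + i` or of `2 - i`, and
of both exactly when 5 divides `m` and `n`. Multiplication by `2 ± i` scales the norm by 5 and
preserves the parity of `m + n`, hence the sign. -/
theorem U_theta_sq : U 0 (theta ^ 2) + exf theta ^ 2 = 2 * theta ^ 2 := by
  have h0 : HasSum (fun p : ℤ × ℤ => ((sg p.1 * sg p.2 : ℤ) : PowerSeries ℤ) *
      X ^ (sqn p.1 + sqn p.2)) (theta ^ 2) :=
    hasSum_of_eq (HasSum.mul_of_nonarchimedean hasSum_theta hasSum_theta)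
      (fun p => by push_cast; ring) (sq _)
  have h5 : HasSum (fun p : ℤ × ℤ => ((sg p.1 * sg p.2 : ℤ) : PowerSeries ℤ) *
      X ^ (5 * (sqn p.1 + sqn p.2))) (exf theta ^ 2) :=
    hasSum_of_eq (HasSum.exf h0) (fun p => by rw [map_mul, map_intCast, exf_X_pow])
      (map_pow _ _ _).symm
  have hsg : ∀ u v : ℤ, sg (2 * u + v) = sg v := fun u v => by
    rw [sg_add, sg_two_mul, one_mul]
  have h := U_add_eq_of_reindex h0 (j := 0) (by norm_num)
    (g₁ := fun p : ℤ × ℤ => (2 * p.1 - p.2, p.1 + 2 * p.2))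
    (g₂ := fun p : ℤ × ℤ => (2 * p.1 + p.2, -p.1 + 2 * p.2))
    (g₃ := fun p : ℤ × ℤ => (5 * p.1, 5 * p.2))
    (fun p q h => ?_) (fun p q h => ?_) (fun p q h => ?_)
    (e₁ := fun p => sqn p.1 + sqn p.2) (e₃ := fun p => 5 * (sqn p.1 + sqn p.2))
    (fun p => ?_) (fun p => ?_) (fun p => ?_) (fun p hp => ?_) ?_
    (hasSum_of_eq h0 (fun p => ?_) rfl) (hasSum_of_eq h0 (fun p => ?_) rfl)
    (hasSum_of_eq h5 (fun p => ?_) rfl)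
  · rw [h]; ring
  · simp only [Prod.mk.injEq] at h
    exact Prod.ext (by omega) (by omega)
  · simp only [Prod.mk.injEq] at h
    exact Prod.ext (by omega) (by omega)
  · simp only [Prod.mk.injEq] at h
    exact Prod.ext (by omega) (by omega)
  · zify; simp only [coe_sqn]; ring
  · zify; simp only [coe_sqn]; ring
  · zify; simp only [coe_sqn]; ring
  · have h1 : (5 : ℤ) ∣ (2 * p.1 + p.2) * (2 * p.1 - p.2) := by
      have e1 := coe_sqn p.1
      have e2 := coe_sqn p.2
      rw [show (2 * p.1 + p.2) * (2 * p.1 - p.2) = 5 * p.1 ^ 2 - (p.1 ^ 2 + p.2 ^ 2) by ring,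
        ← e1, ← e2]
      omega
    rcases prime_five.dvd_or_dvd h1 with ⟨u, hu⟩ | ⟨u, hu⟩
    · exact Or.inl ⟨(u, 2 * u - p.1), Prod.ext (by simp only; omega) (by simp only; omega)⟩
    · exact Or.inr ⟨(u, p.1 - 2 * u), Prod.ext (by simp only; omega) (by simp only; omega)⟩
  · ext ⟨m, n⟩
    simp only [Set.mem_inter_iff, Set.mem_range, Prod.exists, Prod.mk.injEq]
    constructor
    · rintro ⟨⟨x, y, h1, h2⟩, z, w, h3, h4⟩
      exact ⟨m / 5, n / 5, by omega, by omega⟩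
    · rintro ⟨x, y, h1, h2⟩
      exact ⟨⟨2 * x + y, 2 * y - x, by omega, by omega⟩, 2 * x - y, x + 2 * y, by omega, by omega⟩
  · simp only
    rw [sub_eq_add_neg, hsg, add_comm p.1, hsg, sg_neg, mul_comm (sg p.2)]
  · simp only
    rw [hsg, add_comm (-p.1), hsg, sg_neg, mul_comm (sg p.2)]
  · rw [sg_five_mul, sg_five_mul]

/-- The same count for `(2m+1)^2 + (2n+1)^2`: the sum of two triangular numbers is 1 modulo 5
exactly when this norm is divisible by 5. The overlap `(5p+2, 5q+2)` corresponds to odd multiples of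
5. -/
theorem U_psi_sq : U 1 (psi ^ 2) + X * exf psi ^ 2 = 2 * psi ^ 2 := by
  have h0 : HasSum (fun p : ℤ × ℤ => ((1 : ℤ) : PowerSeries ℤ) *
      X ^ (tri p.1 + tri p.2)) (4 * psi ^ 2) :=
    hasSum_of_eq (HasSum.mul_of_nonarchimedean hasSum_two_mul_psi hasSum_two_mul_psi)
      (fun p => by push_cast; ring) (by ring)
  have h5 : HasSum (fun p : ℤ × ℤ => ((1 : ℤ) : PowerSeries ℤ) *
      X ^ (5 * (tri p.1 + tri p.2) + 1)) (X * exf (4 * psi ^ 2)) :=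
    hasSum_of_eq ((HasSum.exf h0).mul_left X)
      (fun p => by rw [map_mul, map_intCast, exf_X_pow]; ring) rfl
  have h := U_add_eq_of_reindex h0 (j := 1) (by norm_num)
    (g₁ := fun p : ℤ × ℤ => (2 * p.1 - p.2, p.1 + 2 * p.2 + 1))
    (g₂ := fun p : ℤ × ℤ => (2 * p.1 + p.2 + 1, 2 * p.2 - p.1))
    (g₃ := fun p : ℤ × ℤ => (5 * p.1 + 2, 5 * p.2 + 2))
    (fun p q h => ?_) (fun p q h => ?_) (fun p q h => ?_)
    (e₁ := fun p => tri p.1 + tri p.2) (e₃ := fun p => 5 * (tri p.1 + tri p.2) + 1)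
    (fun p => ?_) (fun p => ?_) (fun p => ?_) (fun p hp => ?_) ?_ h0 h0 h5
  · have h1 := U_exf_mul 4 (psi ^ 2) (j := 1) (by norm_num)
    rw [map_ofNat] at h1
    rw [h1, map_mul, map_ofNat, map_pow exf] at h
    apply mul_left_cancel₀ two_ne_zero_powerSeries
    apply mul_left_cancel₀ two_ne_zero_powerSeries
    linear_combination h
  · simp only [Prod.mk.injEq] at h
    exact Prod.ext (by omega) (by omega)
  · simp only [Prod.mk.injEq] at h
    exact Prod.ext (by omega) (by omega)
  · simp only [Prod.mk.injEq] at h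
    exact Prod.ext (by omega) (by omega)
  · have e : 2 * ((tri (2 * p.1 - p.2) : ℤ) + tri (p.1 + 2 * p.2 + 1)) =
        2 * (5 * (tri p.1 + tri p.2) + 1) := by
      linear_combination two_mul_tri (2 * p.1 - p.2) + two_mul_tri (p.1 + 2 * p.2 + 1) -
        5 * two_mul_tri p.1 - 5 * two_mul_tri p.2
    simp only
    omega
  · have e : 2 * ((tri (2 * p.1 + p.2 + 1) : ℤ) + tri (2 * p.2 - p.1)) =
        2 * (5 * (tri p.1 + tri p.2) + 1) := by
      linear_combination two_mul_tri (2 * p.1 + p.2 + 1) + two_mul_tri (2 * p.2 - p.1) -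
        5 * two_mul_tri p.1 - 5 * two_mul_tri p.2
    simp only
    omega
  · simp only [tri_five_mul_add_two]
    ring
  · have h1 : (5 : ℤ) ∣ (2 * p.1 + p.2 - 1) * (2 * p.1 - p.2 - 2) := by
      have e1 := two_mul_tri p.1
      have e2 := two_mul_tri p.2
      rw [show (2 * p.1 + p.2 - 1) * (2 * p.1 - p.2 - 2) = 5 * (p.1 ^ 2 - p.1) -
        (p.1 * (p.1 + 1) + p.2 * (p.2 + 1)) + 2 by ring, ← e1, ← e2]
      omega
    rcases prime_five.dvd_or_dvd h1 with ⟨u, hu⟩ | ⟨u, hu⟩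
    · exact Or.inl ⟨(u, 2 * u - p.1), Prod.ext (by simp only; omega) (by simp only; omega)⟩
    · exact Or.inr ⟨(u, p.1 - 2 * u - 1), Prod.ext (by simp only; omega) (by simp only; omega)⟩
  · ext ⟨m, n⟩
    simp only [Set.mem_inter_iff, Set.mem_range, Prod.exists, Prod.mk.injEq]
    constructor
    · rintro ⟨⟨x, y, h1, h2⟩, z, w, h3, h4⟩
      exact ⟨m / 5, n / 5, by omega, by omega⟩
    · rintro ⟨x, y, h1, h2⟩
      exact ⟨⟨2 * x + y + 1, 2 * y - x, by omega, by omega⟩, 2 * x - y, x + 2 * y + 1,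
        by omega, by omega⟩

/-! ### The algebra of the dissections modulo 5 -/

section Field

variable {K : Type*} [Field K]

/-- The hypothesis gives `X` as a rational function of `r` and `s`, so each claim is an identity of
rational functions in two variables. -/
theorem param_identities {X r s : K} (hr : r ≠ 0) (hs : s ≠ 0) (h2 : r ^ 2 + s ≠ 0)
    (h : X * (r ^ 2 + s) = r * s ^ 2 * (r ^ 2 - s)) :
    r ^ 5 - 11 * X - X ^ 2 / r ^ 5 =
      (r * s ^ 2 - X ^ 2 / (r * s ^ 2) + X) * (1 - (r ^ 2 / s - s / r ^ 2)) ^ 2 ∧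
    (r * s ^ 2 - X ^ 2 / (r * s ^ 2)) * (r ^ 2 / s - s / r ^ 2) = 4 * X ∧
    5 * X * (1 - 2 * (r ^ 2 / s - s / r ^ 2)) + 2 * (r - s / r) * (r ^ 4 - 3 * X / r) -
      2 * X * (r / s + 1 / r) * (3 * r + X / r ^ 4) +
      X * (r / s + 1 / r) ^ 2 * (2 * r ^ 2 - X / r ^ 3) + (r - s / r) ^ 2 * (r ^ 3 + 2 * X / r ^ 2) =
      5 * X * (1 - (r ^ 2 / s - s / r ^ 2)) ^ 2 := by
  have hX : X = r * s ^ 2 * (r ^ 2 - s) / (r ^ 2 + s) := by field_simp; linear_combination h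
  subst hX
  refine ⟨?_, ?_, ?_⟩ <;> field_simp <;> ring

/-- Here `r` and `s` are the leading components of `eta 1` and `eta 2`, divided by `e` and `f`. The
relations linear in the unknown components determine `t1`, `t4`, `g0`, `g1`; then `h4` becomes the
relation between `X`, `r` and `s`, and all quantities reduce to the parameters `w` and `k` with `k *
w = 4 * X`. -/
theorem dissection_identities_aux {X r s e f D C t1 t4 g0 g1 E1 E2 T P : K} (htwo : (2 : K) ≠ 0)
    (hX : X ≠ 0) (hr : r ≠ 0) (hs : s ≠ 0) (he : e ≠ 0) (hf : f ≠ 0) (hE1 : E1 ≠ 0)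
    (hE2 : E2 ≠ 0) (hrs : r ^ 2 + s ≠ 0) (hD : D = e ^ 2 / f) (hC : C = f ^ 2 / e)
    (h1 : t1 * (s * f) - X * t4 * f = -2 * (r * e) * e)
    (h3 : -t1 * f + X * t4 * (-f / s) = -2 * e * (-e / r))
    (h4 : D * (-f / s) + t4 * (s * f) = (-e / r) ^ 2)
    (k1 : g1 * (r * e) - g0 * e = -2 * X * f * (-f / s))
    (k2 : g0 * (-e / r) - g1 * e = -2 * (s * f) * f)
    (hT : T ^ 2 = D ^ 2 + X * t1 * t4) (hP : P ^ 2 = g0 * g1 + X * C ^ 2)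
    (hTE : T * E2 = E1 ^ 2) (hPE : P * E1 = E2 ^ 2) (hprod : t1 * t4 * E2 * e = -4 * E1 * f ^ 3) :
    e ^ 6 * (r ^ 5 - 11 * X - X ^ 2 / r ^ 5) = E1 ^ 6 ∧
    E2 ^ 5 * e ^ 2 = E1 ^ 5 * e * f + 5 * X * E1 ^ 2 * E2 * f ^ 4 ∧
    D ^ 2 * ((D ^ 2 + 2 * X * t1 * t4) * 5 + 2 * D * t1 * (3 * r + X / r ^ 4) +
      t1 ^ 2 * (2 * r ^ 2 - X / r ^ 3) + X * t4 ^ 2 * (r ^ 3 + 2 * X / r ^ 2) +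
      2 * D * t4 * (r ^ 4 - 3 * X / r)) = 5 * T ^ 4 := by
  have h1' : t1 * s - X * t4 = -2 * r * e * e / f := by field_simp; linear_combination h1
  have h3' : t1 * s + X * t4 = -2 * s * e * e / (r * f) := by
    field_simp at h3 ⊢; linear_combination -h3
  have ht1 : t1 = -(D * (r / s + 1 / r)) := by
    apply mul_left_cancel₀ htwo
    apply mul_right_cancel₀ hs
    subst hD
    have : 2 * t1 * s = -2 * r * e * e / f + -2 * s * e * e / (r * f) := by
      rw [← h1', ← h3']; ring
    rw [this]
    field_simp
    ring
  have ht4 : X * t4 = D * (r - s / r) := by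
    apply mul_left_cancel₀ htwo
    subst hD
    have : 2 * (X * t4) = -2 * s * e * e / (r * f) - -2 * r * e * e / f := by
      rw [← h1', ← h3']; ring
    rw [this]
    field_simp
    ring
  have hR : X * (r ^ 2 + s) = r * s ^ 2 * (r ^ 2 - s) := by
    have h5 : D * (-f / s) * X + (X * t4) * (s * f) = X * (-e / r) ^ 2 := by
      linear_combination X * h4
    rw [ht4, hD] at h5
    field_simp at h5
    linear_combination -h5
  have hg1 : g1 = f ^ 2 / e * (s + X / (r * s)) := by
    field_simp at k1 k2 ⊢
    apply mul_left_cancel₀ htwo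
    linear_combination k1 - s * k2
  have hg0 : g0 = f ^ 2 / e * (r * s - X / s) := by
    rw [hg1] at k1
    field_simp at k1 ⊢
    linear_combination -k1
  obtain ⟨i1, i2, i3⟩ := param_identities hr hs hrs hR
  set w := r ^ 2 / s - s / r ^ 2 with hw
  set k := r * s ^ 2 - X ^ 2 / (r * s ^ 2) with hk
  have hT' : T ^ 2 = D ^ 2 * (1 - w) := by
    rw [hT, show X * t1 * t4 = t1 * (X * t4) by ring, ht1, ht4, hw]
    field_simp
    ring
  have hP' : P ^ 2 = C ^ 2 * (k + X) := by
    rw [hP, hg0, hg1, hk, hC]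
    field_simp
    ring
  have hD0 : D ≠ 0 := by rw [hD]; exact div_ne_zero (pow_ne_zero _ he) hf
  have hTP : T ^ 4 * P ^ 2 = E1 ^ 6 := by
    apply mul_right_cancel₀ (mul_ne_zero (pow_ne_zero 4 hE2) (pow_ne_zero 2 hE1))
    linear_combination (P * E1) ^ 2 * (T * E2 + E1 ^ 2) * ((T * E2) ^ 2 + E1 ^ 4) * hTE +
      E1 ^ 8 * (P * E1 + E2 ^ 2) * hPE
  have hw0 : w ≠ 0 := by
    rintro h0
    rw [h0, mul_zero, show (4 : K) = 2 * 2 by norm_num] at i2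
    exact mul_ne_zero (mul_ne_zero htwo htwo) hX i2.symm
  -- `hprod` compares `D ^ 2 * w` with `4 * X = k * w`, and `w` cancels.
  have hk' : D ^ 2 * E2 * e = k * E1 * f ^ 3 := by
    apply mul_right_cancel₀ hw0
    have h5 : t1 * (X * t4) = -(D ^ 2 * w) := by
      rw [ht1, ht4, hw]
      field_simp
      ring
    linear_combination -(X * hprod) + E2 * e * h5 - E1 * f ^ 3 * i2
  refine ⟨?_, ?_, ?_⟩
  · rw [i1, ← hTP, show T ^ 4 = (T ^ 2) ^ 2 by ring, hT', hP', hD, hC]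
    field_simp
  · have h5 : E1 * f ^ 3 * (P ^ 2 - 5 * X * C ^ 2) = C ^ 2 * T ^ 2 * E2 * e := by
      rw [hP', hT']
      linear_combination -(C ^ 2 * (1 - w)) * hk' + C ^ 2 * E1 * f ^ 3 * i2
    have h6 : C * e = f ^ 2 := by rw [hC]; field_simp
    apply mul_left_cancel₀ (pow_ne_zero 3 hf)
    linear_combination E1 * E2 * e ^ 2 * h5 - f ^ 3 * E2 * e ^ 2 * (P * E1 + E2 ^ 2) * hPE +
      5 * X * E1 ^ 2 * E2 * f ^ 3 * (C * e + f ^ 2) * h6 +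
      e * E1 * (T * E2) ^ 2 * (C * e + f ^ 2) * h6 + e * E1 * f ^ 4 * (T * E2 + E1 ^ 2) * hTE
  · apply mul_left_cancel₀ hX
    have h5 : X * (5 * T ^ 4) = D ^ 4 * (5 * X * (1 - w) ^ 2) := by
      rw [show T ^ 4 = (T ^ 2) ^ 2 by ring, hT']
      ring
    have h6 : t1 * (X * t4) = -(D ^ 2 * w) := by
      rw [ht1, ht4, hw]
      field_simp
      ring
    rw [h5, ← i3, show X * (D ^ 2 * ((D ^ 2 + 2 * X * t1 * t4) * 5 + 2 * D * t1 *
      (3 * r + X / r ^ 4) + t1 ^ 2 * (2 * r ^ 2 - X / r ^ 3) + X * t4 ^ 2 *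
      (r ^ 3 + 2 * X / r ^ 2) + 2 * D * t4 * (r ^ 4 - 3 * X / r))) =
      D ^ 2 * ((D ^ 2 + 2 * (t1 * (X * t4))) * (5 * X) + 2 * D * X * t1 *
      (3 * r + X / r ^ 4) + X * t1 ^ 2 * (2 * r ^ 2 - X / r ^ 3) + (X * t4) ^ 2 *
      (r ^ 3 + 2 * X / r ^ 2) + 2 * D * (X * t4) * (r ^ 4 - 3 * X / r)) by ring, h6, ht4, ht1]
    ring

theorem dissection_identities_of_isDomain {R : Type*} [CommRing R] [IsDomain R]
    {x a b c d e f D C t1 t4 g0 g1 E1 E2 T P : R} (htwo : (2 : R) ≠ 0) (hx : x ≠ 0) (ha : a ≠ 0)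
    (hb : b ≠ 0) (he : e ≠ 0) (hf : f ≠ 0) (hE1 : E1 ≠ 0) (hE2 : E2 ≠ 0)
    (hab : a ^ 2 * f + b * e ^ 2 ≠ 0) (hac : a * c = -e ^ 2) (hbd : b * d = -f ^ 2)
    (hD : D * f = e ^ 2) (hC : C * e = f ^ 2) (h1 : t1 * b - x * t4 * f = -2 * a * e)
    (h3 : -t1 * f + x * t4 * d = -2 * e * c) (h4 : D * d + t4 * b = c ^ 2)
    (k1 : g1 * a - g0 * e = -2 * x * f * d) (k2 : g0 * c - g1 * e = -2 * b * f)
    (hT : T ^ 2 = D ^ 2 + x * t1 * t4) (hP : P ^ 2 = g0 * g1 + x * C ^ 2)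
    (hTE : T * E2 = E1 ^ 2) (hPE : P * E1 = E2 ^ 2) (hprod : t1 * t4 * E2 * e = -4 * E1 * f ^ 3) :
    e * (a ^ 10 - 11 * x * a ^ 5 * e ^ 5 - x ^ 2 * e ^ 10) = a ^ 5 * E1 ^ 6 ∧
    E2 ^ 5 * e ^ 2 = E1 ^ 5 * e * f + 5 * x * E1 ^ 2 * E2 * f ^ 4 ∧
    D ^ 2 * ((D ^ 2 + 2 * x * t1 * t4) * (5 * a ^ 4 * e ^ 4) +
      2 * D * t1 * (3 * a ^ 5 * e ^ 3 + x * e ^ 8) +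
      t1 ^ 2 * (2 * a ^ 6 * e ^ 2 - x * a * e ^ 7) +
      x * t4 ^ 2 * (a ^ 7 * e + 2 * x * a ^ 2 * e ^ 6) +
      2 * D * t4 * (a ^ 8 - 3 * x * a ^ 3 * e ^ 5)) = 5 * a ^ 4 * e ^ 4 * T ^ 4 := by
  set ι := algebraMap R (FractionRing R) with hι
  have hinj : Function.Injective ι := IsFractionRing.injective _ _
  have hne : ∀ {g : R}, g ≠ 0 → ι g ≠ 0 := fun h => (map_ne_zero_iff ι hinj).mpr h
  have htwo' : (2 : FractionRing R) ≠ 0 := by rw [← map_ofNat ι]; exact hne htwo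
  replace hx := hne hx
  replace ha := hne ha
  replace hb := hne hb
  replace he := hne he
  replace hf := hne hf
  replace hE1 := hne hE1
  replace hE2 := hne hE2
  replace hab := hne hab
  replace hac := congrArg ι hac
  replace hbd := congrArg ι hbd
  replace hD := congrArg ι hD
  replace hC := congrArg ι hC
  replace h1 := congrArg ι h1
  replace h3 := congrArg ι h3
  replace h4 := congrArg ι h4
  replace k1 := congrArg ι k1
  replace k2 := congrArg ι k2
  replace hT := congrArg ι hT
  replace hP := congrArg ι hP
  replace hTE := congrArg ι hTE
  replace hPE := congrArg ι hPE
  replace hprod := congrArg ι hprod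
  simp only [map_add, map_sub, map_mul, map_neg, map_pow, map_ofNat] at hab hac hbd hD hC h1
  simp only [map_add, map_sub, map_mul, map_neg, map_pow, map_ofNat] at h3 h4 k1 k2 hT hP
  simp only [map_mul, map_neg, map_pow, map_ofNat] at hTE hPE hprod
  have hr : ι a / ι e ≠ 0 := div_ne_zero ha he
  have hs : ι b / ι f ≠ 0 := div_ne_zero hb hf
  have er : ι a / ι e * ι e = ι a := div_mul_cancel₀ _ he
  have es : ι b / ι f * ι f = ι b := div_mul_cancel₀ _ hf
  have ec : -ι e / (ι a / ι e) = ι c := by field_simp; linear_combination -hac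
  have ed : -ι f / (ι b / ι f) = ι d := by field_simp; linear_combination -hbd
  obtain ⟨i1, i2, i3⟩ := dissection_identities_aux (X := ι x) (r := ι a / ι e) (s := ι b / ι f)
    (e := ι e) (f := ι f) (D := ι D) (C := ι C) (t1 := ι t1) (t4 := ι t4) (g0 := ι g0)
    (g1 := ι g1) (E1 := ι E1) (E2 := ι E2) (T := ι T) (P := ι P) htwo' hx hr hs he hf hE1 hE2
    (by
      have : (ι a / ι e) ^ 2 + ι b / ι f = (ι a ^ 2 * ι f + ι b * ι e ^ 2) / (ι e ^ 2 * ι f) := by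
        field_simp
      rw [this]
      exact div_ne_zero hab (mul_ne_zero (pow_ne_zero 2 he) hf))
    (eq_div_of_mul_eq hf hD) (eq_div_of_mul_eq he hC) (by rw [es, er, h1])
    (by rw [ed, ec, h3]) (by rw [ed, es, ec, h4]) (by rw [er, ed, k1]) (by rw [ec, es, k2])
    hT hP hTE hPE hprod
  refine ⟨hinj ?_, hinj ?_, hinj ?_⟩ <;>
    simp only [map_add, map_sub, map_mul, map_pow, map_ofNat]
  · rw [← i1]
    field_simp
  · exact i2
  · rw [show 5 * ι a ^ 4 * ι e ^ 4 * ι T ^ 4 = ι a ^ 4 * ι e ^ 4 * (5 * ι T ^ 4) by ring, ← i3]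
    field_simp

end Field

/-! ### Components of the eta functions and their relations -/

theorem constantCoeff_U_zero (f : PowerSeries ℤ) :
    constantCoeff (U 0 f) = constantCoeff f := by
  rw [← coeff_zero_eq_constantCoeff_apply, coeff_U, mul_zero, add_zero,
    coeff_zero_eq_constantCoeff_apply]

theorem constantCoeff_exd (f : PowerSeries ℤ) : constantCoeff (exd f) = constantCoeff f :=
  constantCoeff_expand 2 two_ne_zero f

theorem constantCoeff_U_zero_eta : constantCoeff (U 0 (eta 1)) = 1 := by
  rw [constantCoeff_U_zero, constantCoeff_eta one_pos]

/-- With a, -e, c the components of `eta 1`, the component of residue 2 of its cube is 3a(ac + e^2),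
which is zero by Jacobi's identity. -/
theorem U_zero_eta_mul : U 0 (eta 1) * U 2 (eta 1) = -eta 5 ^ 2 := by
  obtain ⟨e1, e3, e4⟩ := U_eta
  obtain ⟨h0, h1, h2, -, -⟩ := U_mul (eta 1) (eta 1)
  obtain ⟨-, -, h, -, -⟩ := U_mul (eta 1 * eta 1) (eta 1)
  rw [show eta 1 * eta 1 * eta 1 = eta 1 ^ 3 by ring, U_eta_cube.1, h0, h1, h2, e1, e3, e4] at h
  have h3 : (3 : PowerSeries ℤ) ≠ 0 := fun h => by
    have := congrArg constantCoeff h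
    rw [map_ofNat, map_zero] at this
    norm_num at this
  apply mul_left_cancel₀ (mul_ne_zero h3 (ne_zero_of_constantCoeff constantCoeff_U_zero_eta))
  linear_combination -h

theorem U_eta_sq : U 0 (eta 1 ^ 2) = U 0 (eta 1) ^ 2 ∧
    U 1 (eta 1 ^ 2) = -(2 * U 0 (eta 1) * eta 5) ∧ U 2 (eta 1 ^ 2) = -eta 5 ^ 2 ∧
    U 3 (eta 1 ^ 2) = -(2 * eta 5 * U 2 (eta 1)) ∧ U 4 (eta 1 ^ 2) = U 2 (eta 1) ^ 2 := by
  obtain ⟨e1, e3, e4⟩ := U_eta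
  obtain ⟨h0, h1, h2, h3, h4⟩ := U_mul (eta 1) (eta 1)
  have h := U_zero_eta_mul
  rw [sq (eta 1), h0, h1, h2, h3, h4, e1, e3, e4]
  refine ⟨by ring, by ring, ?_, by ring, by ring⟩
  linear_combination 2 * h

theorem U_eta_two : U 0 (eta 2) = exd (U 0 (eta 1)) ∧ U 1 (eta 2) = 0 ∧ U 2 (eta 2) = -eta 10 ∧
    U 3 (eta 2) = 0 ∧ U 4 (eta 2) = exd (U 2 (eta 1)) := by
  have h := U_exd (eta 1)
  obtain ⟨e1, e3, e4⟩ := U_eta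
  rwa [exd_eta one_pos, e1, e3, e4, map_neg, exd_eta (by norm_num), map_zero, mul_zero] at h

theorem U_zero_eta_two_mul : exd (U 0 (eta 1)) * exd (U 2 (eta 1)) = -eta 10 ^ 2 := by
  have h := congrArg exd U_zero_eta_mul
  rwa [map_mul, map_neg, map_pow, exd_eta (by norm_num)] at h

theorem U_eta_two_sq : U 1 (eta 2 ^ 2) = -(2 * X * eta 10 * exd (U 2 (eta 1))) ∧
    U 2 (eta 2 ^ 2) = -(2 * exd (U 0 (eta 1)) * eta 10) := by
  obtain ⟨e0, e1, e2, e3, e4⟩ := U_eta_two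
  obtain ⟨-, h1, h2, -, -⟩ := U_mul (eta 2) (eta 2)
  rw [sq (eta 2), h1, h2, e0, e1, e2, e3, e4]
  exact ⟨by ring, by ring⟩

theorem exf_theta_mul : exf theta * eta 10 = eta 5 ^ 2 := by
  have h := congrArg exf theta_mul_eta
  rwa [map_mul, map_pow, exf_eta two_pos, exf_eta one_pos] at h

theorem exf_psi_mul : exf psi * eta 5 = eta 10 ^ 2 := by
  have h := congrArg exf psi_mul_eta
  rwa [map_mul, map_pow, exf_eta two_pos, exf_eta one_pos] at h

/-- The three algebraic relations between the eta functions of level `10` and the components of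
the dissections of `eta 1` and `theta`. -/
theorem dissection_identities :
    eta 5 * (U 0 (eta 1) ^ 10 - 11 * X * U 0 (eta 1) ^ 5 * eta 5 ^ 5 - X ^ 2 * eta 5 ^ 10) =
      U 0 (eta 1) ^ 5 * eta 1 ^ 6 ∧
    eta 2 ^ 5 * eta 5 ^ 2 =
      eta 1 ^ 5 * eta 5 * eta 10 + 5 * X * eta 1 ^ 2 * eta 2 * eta 10 ^ 4 ∧
    exf theta ^ 2 * ((exf theta ^ 2 + 2 * X * U 1 theta * U 4 theta) *
        (5 * U 0 (eta 1) ^ 4 * eta 5 ^ 4) +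
      2 * exf theta * U 1 theta * (3 * U 0 (eta 1) ^ 5 * eta 5 ^ 3 + X * eta 5 ^ 8) +
      U 1 theta ^ 2 * (2 * U 0 (eta 1) ^ 6 * eta 5 ^ 2 - X * U 0 (eta 1) * eta 5 ^ 7) +
      X * U 4 theta ^ 2 * (U 0 (eta 1) ^ 7 * eta 5 + 2 * X * U 0 (eta 1) ^ 2 * eta 5 ^ 6) +
      2 * exf theta * U 4 theta * (U 0 (eta 1) ^ 8 - 3 * X * U 0 (eta 1) ^ 3 * eta 5 ^ 5)) =
      5 * U 0 (eta 1) ^ 4 * eta 5 ^ 4 * theta ^ 4 := by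
  obtain ⟨u1, u3, u4⟩ := U_eta
  obtain ⟨v0, v1, v2, v3, v4⟩ := U_eta_two
  obtain ⟨-, q1, -, q3, q4⟩ := U_eta_sq
  obtain ⟨q1', q2'⟩ := U_eta_two_sq
  obtain ⟨t0, t2, t3⟩ := U_theta
  obtain ⟨p2, p3, p4⟩ := U_psi
  have hac := U_zero_eta_mul
  have hbd := U_zero_eta_two_mul
  -- Components 1, 3, 4 of `theta * eta 2 = eta 1 ^ 2`, and below components 1 and 2 of `psi * eta 1
  -- = eta 2 ^ 2`, give the linear relations.
  obtain ⟨-, h1, -, h3, h4⟩ := U_mul theta (eta 2)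
  rw [theta_mul_eta, q1, v0, v1, v2, v3, v4, t0, t2, t3] at h1
  rw [theta_mul_eta, q3, v0, v1, v2, v3, v4, t0, t2, t3] at h3
  rw [theta_mul_eta, q4, v0, v1, v2, v3, v4, t0, t2, t3] at h4
  obtain ⟨-, k1, k2, -, -⟩ := U_mul psi (eta 1)
  rw [psi_mul_eta, q1', u1, u3, u4, p2, p3, p4] at k1
  rw [psi_mul_eta, q2', u1, u3, u4, p2, p3, p4] at k2
  obtain ⟨w0, -, -, -, -⟩ := U_mul theta theta
  obtain ⟨-, w1, -, -, -⟩ := U_mul psi psi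
  rw [t0, t2, t3] at w0
  rw [p2, p3, p4] at w1
  have hT := U_theta_sq
  have hP := U_psi_sq
  rw [sq theta, w0] at hT
  rw [sq psi, w1] at hP
  have hT' : theta ^ 2 = exf theta ^ 2 + X * U 1 theta * U 4 theta := by
    apply mul_left_cancel₀ two_ne_zero_powerSeries
    linear_combination -hT
  have hP' : psi ^ 2 = U 0 psi * U 1 psi + X * exf psi ^ 2 := by
    apply mul_left_cancel₀ two_ne_zero_powerSeries
    linear_combination -hP
  have ha := constantCoeff_U_zero_eta
  have hb : constantCoeff (exd (U 0 (eta 1))) = 1 := by rw [constantCoeff_exd, ha]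
  have he := constantCoeff_eta (show 0 < 5 by norm_num)
  have hf := constantCoeff_eta (show 0 < 10 by norm_num)
  have hs : U 0 (eta 1) ^ 2 * eta 10 + exd (U 0 (eta 1)) * eta 5 ^ 2 ≠ 0 := fun h => by
    have h' := congrArg constantCoeff h
    simp only [map_add, map_mul, map_pow, ha, hb, he, hf, map_zero] at h'
    norm_num at h'
  exact dissection_identities_of_isDomain two_ne_zero_powerSeries X_ne_zero
    (ne_zero_of_constantCoeff ha) (ne_zero_of_constantCoeff hb) (ne_zero_of_constantCoeff he)
    (ne_zero_of_constantCoeff hf) (eta_ne_zero one_pos) (eta_ne_zero two_pos) hs hac hbd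
    exf_theta_mul exf_psi_mul (by linear_combination -h1) (by linear_combination -h3)
    (by linear_combination -h4) (by linear_combination -k1) (by linear_combination -k2) hT' hP'
    theta_mul_eta psi_mul_eta (by linear_combination U_theta_mul)

/-! ### Components of eta quotients -/

/-- The inverse of `eta k`. -/
noncomputable def etaInv (k : ℕ) : PowerSeries ℤ := pinv (eta k)

theorem eta_mul_etaInv {k : ℕ} (hk : 0 < k) : eta k * etaInv k = 1 :=
  mul_pinv (constantCoeff_eta hk)

theorem exf_eta_one : exf (eta 1) = eta 5 := exf_eta one_pos

theorem exf_eta_two : exf (eta 2) = eta 10 := exf_eta two_pos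

theorem exf_etaInv {k : ℕ} (hk : 0 < k) : exf (etaInv k) = etaInv (5 * k) := by
  refine eq_pinv (constantCoeff_eta (by omega)) ?_
  rw [← exf_eta hk, ← map_mul, eta_mul_etaInv hk, map_one]

theorem exf_etaInv_one : exf (etaInv 1) = etaInv 5 := exf_etaInv one_pos

theorem exf_etaInv_two : exf (etaInv 2) = etaInv 10 := exf_etaInv two_pos

theorem exd_etaInv_one : exd (etaInv 1) = etaInv 2 := by
  refine eq_pinv (constantCoeff_eta (by omega)) ?_
  rw [← mul_one 2, ← exd_eta one_pos, ← map_mul, eta_mul_etaInv one_pos, map_one]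

theorem U_ofNat_mul (n : ℕ) [n.AtLeastTwo] (f : PowerSeries ℤ) {j : ℕ} (hj : j < 5) :
    U j (OfNat.ofNat n * f) = OfNat.ofNat n * U j f := by
  have h := U_exf_mul (OfNat.ofNat n) f hj
  rwa [map_ofNat] at h

/-- The cofactor of `eta 1` in its norm to the series in `X ^ 5`. -/
noncomputable def cofactor : PowerSeries ℤ :=
  exf (U 0 (eta 1) ^ 8 - 3 * X * U 0 (eta 1) ^ 3 * eta 5 ^ 5) +
    X * exf (U 0 (eta 1) ^ 7 * eta 5 + 2 * X * U 0 (eta 1) ^ 2 * eta 5 ^ 6) +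
    X ^ 2 * exf (2 * U 0 (eta 1) ^ 6 * eta 5 ^ 2 - X * U 0 (eta 1) * eta 5 ^ 7) +
    X ^ 3 * exf (3 * U 0 (eta 1) ^ 5 * eta 5 ^ 3 + X * eta 5 ^ 8) +
    X ^ 4 * exf (5 * U 0 (eta 1) ^ 4 * eta 5 ^ 4)

/-- Eliminating c through ac = -e^2 turns a E_1 into a^2 - X a e - X^2 e^2 with a and e series in
X^5. The cofactor completes this form to a series in X^5, so that E_1 can be inverted component by
component. -/
theorem eta_mul_cofactor : eta 1 * exf (U 0 (eta 1)) * cofactor =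
    exf (U 0 (eta 1) ^ 10 - 11 * X * U 0 (eta 1) ^ 5 * eta 5 ^ 5 - X ^ 2 * eta 5 ^ 10) := by
  have h := congrArg exf U_zero_eta_mul
  have hd := dissection (eta 1)
  obtain ⟨e1, e3, e4⟩ := U_eta
  rw [e1, e3, e4] at hd
  simp only [map_mul, map_neg, map_pow, map_zero] at h hd
  have h1 : eta 1 * exf (U 0 (eta 1)) =
      exf (U 0 (eta 1)) ^ 2 - X * exf (U 0 (eta 1)) * exf (eta 5) - X ^ 2 * exf (eta 5) ^ 2 := by
    nth_rewrite 1 [hd]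
    linear_combination X ^ 2 * h
  rw [h1, cofactor]
  simp only [map_add, map_sub, map_mul, map_pow, map_ofNat, exf_X]
  ring

theorem exf_mul_etaInv :
    exf (U 0 (eta 1) ^ 10 - 11 * X * U 0 (eta 1) ^ 5 * eta 5 ^ 5 - X ^ 2 * eta 5 ^ 10) * etaInv 1 =
      exf (U 0 (eta 1)) * cofactor := by
  rw [← eta_mul_cofactor]
  linear_combination exf (U 0 (eta 1)) * cofactor * eta_mul_etaInv one_pos

/-- Ramanujan's generating function for the partition numbers `p(5 n + 4)`. -/
theorem eta_pow_mul_U_four_etaInv : eta 1 ^ 6 * U 4 (etaInv 1) = 5 * eta 5 ^ 5 := by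
  have h := congrArg (U 4) exf_mul_etaInv
  rw [U_exf_mul _ _ (by norm_num), U_exf_mul _ _ (by norm_num),
    (U_eq_of_eq (f := cofactor) rfl).2.2.2.2] at h
  apply mul_left_cancel₀
    (pow_ne_zero 5 (ne_zero_of_constantCoeff constantCoeff_U_zero_eta))
  linear_combination eta 5 * h - U 4 (etaInv 1) * dissection_identities.1

theorem U_theta_sq_all : U 0 (theta ^ 2) = exf theta ^ 2 + 2 * X * U 1 theta * U 4 theta ∧
    U 1 (theta ^ 2) = 2 * exf theta * U 1 theta ∧ U 2 (theta ^ 2) = U 1 theta ^ 2 ∧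
    U 3 (theta ^ 2) = X * U 4 theta ^ 2 ∧ U 4 (theta ^ 2) = 2 * exf theta * U 4 theta := by
  obtain ⟨h0, h1, h2, h3, h4⟩ := U_mul theta theta
  obtain ⟨t0, t2, t3⟩ := U_theta
  rw [sq theta, h0, h1, h2, h3, h4, t0, t2, t3]
  exact ⟨by ring, by ring, by ring, by ring, by ring⟩

/-- The analogue for θ^2 / E_1 of Ramanujan's identity for p(5n+4). Component 4 of `theta ^ 2 *
cofactor` is what the third of the `dissection_identities` evaluates. -/
theorem eta_pow_mul_U_four_theta_sq :
    eta 2 ^ 4 * U 4 (theta ^ 2 * etaInv 1) = 5 * eta 1 ^ 2 * eta 5 * eta 10 ^ 2 := by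
  have h0 := congrArg (theta ^ 2 * ·) exf_mul_etaInv
  have h1 : exf (U 0 (eta 1) ^ 10 - 11 * X * U 0 (eta 1) ^ 5 * eta 5 ^ 5 - X ^ 2 * eta 5 ^ 10) *
      (theta ^ 2 * etaInv 1) = exf (U 0 (eta 1)) * (theta ^ 2 * cofactor) := by
    linear_combination h0
  have h := congrArg (U 4) h1
  obtain ⟨c0, c1, c2, c3, c4⟩ := U_eq_of_eq (f := cofactor) rfl
  obtain ⟨s0, s1, s2, s3, s4⟩ := U_theta_sq_all
  rw [U_exf_mul _ _ (by norm_num), U_exf_mul _ _ (by norm_num), (U_mul _ cofactor).2.2.2.2, c0, c1, c2,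
    c3, c4, s0, s1, s2, s3, s4] at h
  obtain ⟨d1, -, d3⟩ := dissection_identities
  have ha := ne_zero_of_constantCoeff constantCoeff_U_zero_eta
  have he := eta_ne_zero (show 0 < 5 by norm_num)
  have h2 : exf theta ^ 2 * eta 1 ^ 6 * U 4 (theta ^ 2 * etaInv 1) = 5 * eta 5 ^ 5 * theta ^ 4 := by
    apply mul_left_cancel₀ (pow_ne_zero 5 ha)
    linear_combination exf theta ^ 2 * eta 5 * h -
      exf theta ^ 2 * U 4 (theta ^ 2 * etaInv 1) * d1 + U 0 (eta 1) * eta 5 * d3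
  have h3 := exf_theta_mul
  have h4 := theta_mul_eta
  apply mul_left_cancel₀ (mul_ne_zero (pow_ne_zero 4 he) (pow_ne_zero 6 (eta_ne_zero one_pos)))
  linear_combination eta 2 ^ 4 * eta 10 ^ 2 * h2 -
    eta 2 ^ 4 * eta 1 ^ 6 * U 4 (theta ^ 2 * etaInv 1) * (exf theta * eta 10 + eta 5 ^ 2) * h3 +
    5 * eta 5 ^ 5 * eta 10 ^ 2 * (theta * eta 2 + eta 1 ^ 2) *
      ((theta * eta 2) ^ 2 + eta 1 ^ 4) * h4

theorem U_three_etaInv_two : U 3 (etaInv 2) = 5 * X * eta 10 ^ 5 * etaInv 2 ^ 6 := by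
  have h := congrArg exd eta_pow_mul_U_four_etaInv
  rw [map_mul, map_mul, map_pow, map_pow, map_ofNat, exd_eta one_pos, exd_eta (by norm_num)] at h
  rw [← exd_etaInv_one, (U_exd _).2.2.2.1, exd_etaInv_one]
  have h2 : (eta 2 * etaInv 2) ^ 6 = 1 := by rw [eta_mul_etaInv two_pos, one_pow]
  linear_combination X * etaInv 2 ^ 6 * h - X * exd (U 4 (etaInv 1)) * h2

theorem U_four_theta_sq_mul_etaInv :
    U 4 (theta ^ 2 * etaInv 1) = 5 * eta 1 ^ 2 * eta 5 * eta 10 ^ 2 * etaInv 2 ^ 4 := by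
  have h2 : (eta 2 * etaInv 2) ^ 4 = 1 := by rw [eta_mul_etaInv two_pos, one_pow]
  linear_combination etaInv 2 ^ 4 * eta_pow_mul_U_four_theta_sq -
    U 4 (theta ^ 2 * etaInv 1) * h2

theorem U_eta_two_cube : U 1 (eta 2 ^ 3) = 5 * X * eta 10 ^ 3 ∧ U 3 (eta 2 ^ 3) = 0 ∧
    U 4 (eta 2 ^ 3) = 0 := by
  have h : eta 2 ^ 3 = exd (eta 1 ^ 3) := by rw [map_pow, exd_eta one_pos, mul_one]
  obtain ⟨h2, h3, h4⟩ := U_eta_cube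
  obtain ⟨-, k1, -, k3, k4⟩ := U_exd (eta 1 ^ 3)
  rw [h, k1, k3, k4, h2, h3, h4, map_mul, map_pow, map_ofNat, exd_eta (by norm_num), map_zero,
    mul_zero]
  exact ⟨by ring, rfl, rfl⟩

theorem U_eta_pow_four : U 0 (eta 1 ^ 4) = U 0 (eta 1) ^ 4 + 8 * X * eta 5 ^ 3 * U 2 (eta 1) ∧
    U 1 (eta 1 ^ 4) = -4 * U 0 (eta 1) ^ 3 * eta 5 + 2 * X * eta 5 ^ 2 * U 2 (eta 1) ^ 2 ∧
    U 2 (eta 1 ^ 4) = 2 * U 0 (eta 1) ^ 2 * eta 5 ^ 2 - 4 * X * eta 5 * U 2 (eta 1) ^ 3 ∧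
    U 3 (eta 1 ^ 4) = 8 * U 0 (eta 1) * eta 5 ^ 3 + X * U 2 (eta 1) ^ 4 ∧
    U 4 (eta 1 ^ 4) = -5 * eta 5 ^ 4 := by
  obtain ⟨q0, q1, q2, q3, q4⟩ := U_eta_sq
  obtain ⟨h0, h1, h2, h3, h4⟩ := U_mul (eta 1 ^ 2) (eta 1 ^ 2)
  have h := U_zero_eta_mul
  rw [show eta 1 ^ 4 = eta 1 ^ 2 * eta 1 ^ 2 by ring, h0, h1, h2, h3, h4, q0, q1, q2, q3, q4]
  generalize U 0 (eta 1) = a at *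
  generalize U 2 (eta 1) = c at *
  generalize eta 5 = e at *
  refine ⟨?_, by ring, by ring, ?_, ?_⟩
  · linear_combination -4 * X * e * c * h
  · linear_combination -4 * a * e * h
  · linear_combination (2 * a * c + 6 * e ^ 2) * h

/-- Modulo ac = -e^2 every monomial of this component becomes a multiple of X e^8. -/
theorem U_three_eta_pow_eight : U 3 (eta 1 ^ 8) = 125 * (-(X * eta 5 ^ 8)) := by
  obtain ⟨q0, q1, q2, q3, q4⟩ := U_eta_pow_four
  obtain ⟨-, -, -, h3, -⟩ := U_mul (eta 1 ^ 4) (eta 1 ^ 4)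
  have h := U_zero_eta_mul
  rw [show eta 1 ^ 8 = eta 1 ^ 4 * eta 1 ^ 4 by ring, h3, q0, q1, q2, q3, q4]
  generalize U 0 (eta 1) = a at *
  generalize U 2 (eta 1) = c at *
  generalize eta 5 = e at *
  linear_combination (2 * X * (a ^ 3 * c ^ 3 - a ^ 2 * c ^ 2 * e ^ 2 + a * c * e ^ 4 - e ^ 6) +
    128 * X * e ^ 6 + 32 * X * e ^ 2 * (a ^ 2 * c ^ 2 - a * c * e ^ 2 + e ^ 4) +
    8 * X * e ^ 4 * (a * c - e ^ 2)) * h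

theorem exists_U_one_eta_two_pow_eight : ∃ h, U 1 (eta 2 ^ 8) = 125 * h := by
  refine ⟨X * exd (-(X * eta 5 ^ 8)), ?_⟩
  rw [show eta 2 ^ 8 = exd (eta 1 ^ 8) by rw [map_pow, exd_eta one_pos, mul_one], (U_exd _).2.1,
    U_three_eta_pow_eight, map_mul, map_ofNat]
  ring

theorem U_three_eta_one_mul_eta_two : U 3 (eta 1 * eta 2) = eta 5 * eta 10 := by
  obtain ⟨e1, e3, e4⟩ := U_eta
  obtain ⟨v0, v1, v2, v3, v4⟩ := U_eta_two
  rw [(U_mul _ _).2.2.2.1, e1, e3, e4, v1, v2, v3, v4]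
  ring

/-! ### Congruences -/

/-- Over `ZMod 5` the fifth power of a power series is its substitution `X ↦ X ^ 5`. -/
theorem exists_eta_one_pow_five : ∃ h, eta 1 ^ 5 = eta 5 + 5 * h := by
  have : Fact (Nat.Prime 5) := ⟨by norm_num⟩
  have h1 : ∀ f : PowerSeries (ZMod 5), f ^ 5 = expand 5 (by norm_num) f := fun f => by
    have h := MvPowerSeries.map_frobenius_expand (R := ZMod 5) 5 (by norm_num) (f := f)
    rw [ZMod.frobenius_zmod, MvPowerSeries.map_id] at h
    exact h.symm
  have h2 : PowerSeries.map (Int.castRingHom (ZMod 5)) (eta 1 ^ 5 - eta 5) = 0 := by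
    rw [map_sub, map_pow, h1, ← exf_eta_one, sub_eq_zero]
    exact (map_expand 5 (by norm_num) (Int.castRingHom (ZMod 5)) (eta 1)).symm
  refine ⟨PowerSeries.mk fun n => coeff n (eta 1 ^ 5 - eta 5) / 5, ?_⟩
  ext n
  have h3 := congrArg (coeff n) h2
  rw [coeff_map, map_zero, eq_intCast, ZMod.intCast_zmod_eq_zero_iff_dvd] at h3
  rw [show (5 : PowerSeries ℤ) = C 5 by simp, map_add, coeff_C_mul, coeff_mk]
  have h4 := Int.mul_ediv_cancel' h3
  rw [map_sub] at h4 ⊢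
  push_cast at h4
  rw [h4]
  ring

/-- Iterating the hypothesis expresses `A` through `B` up to a multiple of 125. The coefficient 75
is 25 from `A` plus 50 from `5 * g * A ^ 2`. -/
theorem inverse_expansion {R : Type*} [CommRing R] {A B g : R} (h : A = B + 5 * g * A * B) :
    ∃ w, A + 5 * g * A ^ 2 = B + 10 * g * B ^ 2 + 75 * g ^ 2 * B ^ 3 + 125 * w := by
  have hA : A = B + 5 * g * B ^ 2 + 25 * g ^ 2 * B ^ 3 + 125 * (g ^ 3 * B ^ 3 * A) := by
    linear_combination (1 + 5 * g * B + 25 * g ^ 2 * B ^ 2) * h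
  set p := B + 5 * g * B ^ 2 + 25 * g ^ 2 * B ^ 3 with hp
  generalize g ^ 3 * B ^ 3 * A = v at hA
  refine ⟨v + 5 * g * (2 * p * v + 125 * v ^ 2) + 3 * g ^ 3 * B ^ 4 + 10 * g ^ 4 * B ^ 5 +
    25 * g ^ 5 * B ^ 6, ?_⟩
  rw [hA, hp]
  ring

theorem exists_eta_two_pow_five : ∃ h, eta 2 ^ 5 = eta 10 + 5 * h := by
  obtain ⟨h, hh⟩ := exists_eta_one_pow_five
  refine ⟨exd h, ?_⟩
  have := congrArg exd hh
  rwa [map_pow, map_add, map_mul, map_ofNat, exd_eta one_pos, exd_eta (by norm_num)] at this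

theorem exists_etaInv_one_pow_five : ∃ h, etaInv 1 ^ 5 = etaInv 5 + 5 * h := by
  obtain ⟨h, hh⟩ := exists_eta_one_pow_five
  have h1 : (eta 1 * etaInv 1) ^ 5 = 1 := by rw [eta_mul_etaInv one_pos, one_pow]
  have h2 := eta_mul_etaInv (show 0 < 5 by norm_num)
  refine ⟨-(h * etaInv 1 ^ 5 * etaInv 5), ?_⟩
  linear_combination etaInv 5 * h1 - etaInv 1 ^ 5 * h2 - etaInv 1 ^ 5 * etaInv 5 * hh

theorem exists_etaInv_two_pow_five : ∃ h, etaInv 2 ^ 5 = etaInv 10 + 5 * h := by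
  obtain ⟨h, hh⟩ := exists_eta_two_pow_five
  have h1 : (eta 2 * etaInv 2) ^ 5 = 1 := by rw [eta_mul_etaInv two_pos, one_pow]
  have h2 := eta_mul_etaInv (show 0 < 10 by norm_num)
  refine ⟨-(h * etaInv 2 ^ 5 * etaInv 10), ?_⟩
  linear_combination etaInv 10 * h1 - etaInv 2 ^ 5 * h2 - etaInv 2 ^ 5 * etaInv 10 * hh

theorem theta_eq : theta = eta 1 ^ 2 * etaInv 2 := by
  linear_combination etaInv 2 * theta_mul_eta - theta * eta_mul_etaInv two_pos

theorem exists_oddPart : ∃ h, oddPart = eta 10 ^ 2 * etaInv 5 ^ 2 * (theta ^ 2 * etaInv 1) +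
    10 * (eta 10 ^ 5 * etaInv 5 ^ 3 * (X * etaInv 2)) +
    25 * (eta 10 ^ 8 * etaInv 5 ^ 5 * (X * (X * eta 1 ^ 2))) + 125 * h := by
  obtain ⟨h1, hh1⟩ := exists_eta_one_pow_five
  obtain ⟨h2, hh2⟩ := exists_etaInv_two_pow_five
  have e1 := eta_mul_etaInv one_pos
  have e2 := eta_mul_etaInv two_pos
  have e5 := eta_mul_etaInv (show 0 < 5 by norm_num)
  have e10 := eta_mul_etaInv (show 0 < 10 by norm_num)
  have hC := dissection_identities.2.1
  have hF := eta_pow_mul_oddPart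
  rw [theta_eq]
  generalize eta 1 = E1 at *
  generalize eta 2 = E2 at *
  generalize eta 5 = E5 at *
  generalize eta 10 = E10 at *
  generalize etaInv 1 = I1 at *
  generalize etaInv 2 = I2 at *
  generalize etaInv 5 = I5 at *
  generalize etaInv 10 = I10 at *
  generalize oddPart = F at *
  have p1 : ∀ k, (E1 * I1) ^ k = 1 := fun k => by rw [e1, one_pow]
  have p2 : ∀ k, (E2 * I2) ^ k = 1 := fun k => by rw [e2, one_pow]
  have p5 : ∀ k, (E5 * I5) ^ k = 1 := fun k => by rw [e5, one_pow]
  have p10 : ∀ k, (E10 * I10) ^ k = 1 := fun k => by rw [e10, one_pow]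
  have hE : E1 ^ 5 = E2 ^ 5 * E5 * I10 - 5 * X * E1 ^ 2 * E2 * E10 ^ 3 * I5 := by
    linear_combination -(I5 * I10) * hC - E1 ^ 5 * (E10 * I10 * e5 + e10) +
      E2 ^ 5 * E5 * I10 * e5 - 5 * X * E1 ^ 2 * E2 * E10 ^ 3 * I5 * e10
  set g := X * E1 ^ 2 * E2 * E10 ^ 3 * I5 ^ 2 with hg
  -- The level 10 relation, read as β = α + 5g for α = E_1^5/E_5 and β = E_2^5/E_10. Below, `A` and
  -- `B` are their inverses and the quotient is κ β A^2 = κ (A + 5g A^2).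
  have hβ : E2 ^ 5 * I10 = E1 ^ 5 * I5 + 5 * g := by
    linear_combination -I5 * hE - E2 ^ 5 * I10 * e5
  set A := E5 * I1 ^ 5 with hA
  set B := E10 * I2 ^ 5 with hB
  have hαA : E1 ^ 5 * I5 * A = 1 := by
    linear_combination E5 * I5 * p1 5 + e5
  have hβB : E2 ^ 5 * I10 * B = 1 := by
    linear_combination E10 * I10 * p2 5 + e10
  obtain ⟨w, hw⟩ := inverse_expansion (A := A) (B := B) (g := g) (by
    linear_combination A * B * hβ - A * hβB + B * hαA)
  set κ := E10 * I5 ^ 2 * E1 ^ 3 * E2 ^ 3 with hκ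
  have hFA : F = κ * (A + 5 * g * A ^ 2) := by
    have h3 : F = E2 ^ 8 * I1 ^ 7 := by linear_combination I1 ^ 7 * hF - F * p1 7
    have h4 : E2 ^ 8 * I1 ^ 7 = κ * (E2 ^ 5 * I10) * A ^ 2 := by
      rw [hκ, hA]
      linear_combination -(E2 ^ 8 * I1 ^ 7) *
        (E10 * I10 * (E5 * I5) ^ 2 * p1 3 + E10 * I10 * p5 2 + e10)
    rw [h3, h4]
    linear_combination κ * A ^ 2 * hβ + κ * A * hαA
  have t1 : κ * B = E10 ^ 2 * I5 ^ 2 * ((E1 ^ 2 * I2) ^ 2 * I1) := by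
    rw [hκ, hB]
    linear_combination E10 ^ 2 * I5 ^ 2 * E1 ^ 3 * I2 ^ 2 * (p2 3 - e1)
  -- Rewriting `E1 ^ 5` by `hE` produces a correction divisible by 5. Its contribution -50 combines
  -- with the 75 from `t3` to give the coefficient 25.
  have t2 : κ * g * B ^ 2 = E10 ^ 5 * I5 ^ 3 * (X * I2) -
      5 * X ^ 2 * E10 ^ 9 * I5 ^ 5 * E1 ^ 2 * I2 ^ 5 := by
    rw [hκ, hB, hg]
    linear_combination X * E10 ^ 6 * I5 ^ 4 * E1 ^ 5 * I2 ^ 6 * p2 4 +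
      X * E10 ^ 6 * I5 ^ 4 * I2 ^ 6 * hE +
      X * E10 ^ 5 * I5 ^ 3 * I2 * (E10 * I10 * (E5 * I5) * p2 5 + E10 * I10 * e5 + e10) -
      5 * X ^ 2 * E10 ^ 9 * I5 ^ 5 * E1 ^ 2 * I2 ^ 5 * e2
  have t3 : κ * g ^ 2 * B ^ 3 = X ^ 2 * E10 ^ 10 * I5 ^ 6 * E1 ^ 2 * (E5 + 5 * h1) *
      (I10 + 5 * h2) ^ 2 := by
    rw [← hh1, ← hh2, hκ, hB, hg]
    linear_combination X ^ 2 * E10 ^ 10 * I5 ^ 6 * E1 ^ 7 * I2 ^ 10 * p2 5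
  rw [hh2] at t2
  refine ⟨κ * w - 2 * X ^ 2 * E10 ^ 9 * I5 ^ 5 * E1 ^ 2 * h2 + 3 * X ^ 2 * E10 ^ 10 * I5 ^ 6 *
    E1 ^ 2 * (h1 * (I10 + 5 * h2) ^ 2 + E5 * (2 * I10 * h2 + 5 * h2 ^ 2)), ?_⟩
  rw [hFA, hw]
  linear_combination t1 + 10 * t2 + 75 * t3 - 50 * X ^ 2 * E10 ^ 8 * I5 ^ 5 * E1 ^ 2 * e10 +
    75 * X ^ 2 * E10 ^ 8 * I5 ^ 5 * E1 ^ 2 * (E5 * I5 * p10 2 + e5)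

/-- The components entering are `U 4` of θ^2/E_1, `U 3` of 1/E_2 and `U 2` of E_1^2. The first two
bring a further factor 5, after which the fifth powers in the last two terms are needed only modulo
5. -/
theorem exists_U_four_oddPart : ∃ h, U 4 oddPart = 5 * (eta 5 * eta 10 ^ 2 * etaInv 2 ^ 2) +
    50 * (eta 10 ^ 5 * etaInv 5 * (X * theta)) - 25 * (eta 5 * eta 2 ^ 8) + 125 * h := by
  obtain ⟨h0, hh0⟩ := exists_oddPart
  obtain ⟨h1, hh1⟩ := exists_etaInv_one_pow_five
  have e1 := eta_mul_etaInv one_pos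
  have e2 := eta_mul_etaInv two_pos
  have e5 := eta_mul_etaInv (show 0 < 5 by norm_num)
  have k1 := U_exf_mul (eta 2 ^ 2 * etaInv 1 ^ 2) (theta ^ 2 * etaInv 1) (j := 4) (by norm_num)
  have k2 := U_exf_mul (eta 2 ^ 5 * etaInv 1 ^ 3) (X * etaInv 2) (j := 4) (by norm_num)
  have k3 := U_exf_mul (eta 2 ^ 8 * etaInv 1 ^ 5) (X * (X * eta 1 ^ 2)) (j := 4) (by norm_num)
  rw [map_mul exf, map_pow exf, map_pow exf, exf_eta_two, exf_etaInv_one] at k1 k2 k3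
  rw [hh0, map_add, map_add, map_add, U_ofNat_mul 10 _ (by norm_num),
    U_ofNat_mul 25 _ (by norm_num), U_ofNat_mul 125 _ (by norm_num), k1, k2, k3,
    (U_X_mul _).2.2.2.2, (U_X_mul _).2.2.2.2, (U_X_mul _).2.2.2.1, U_eta_sq.2.2.1,
    U_three_etaInv_two, U_four_theta_sq_mul_etaInv]
  have q1 : (eta 1 * etaInv 1) ^ 2 = 1 := by rw [e1, one_pow]
  have q2 : (eta 2 * etaInv 2) ^ 2 = 1 := by rw [e2, one_pow]
  have q5 : (eta 2 * etaInv 2) ^ 5 = 1 := by rw [e2, one_pow]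
  have hθ : etaInv 1 ^ 3 * etaInv 2 = theta * etaInv 1 ^ 5 := by
    linear_combination -etaInv 1 ^ 5 * theta_eq - etaInv 1 ^ 3 * etaInv 2 * q1
  refine ⟨U 4 h0 + 2 * X * eta 10 ^ 5 * theta * h1 - eta 2 ^ 8 * eta 5 ^ 2 * h1, ?_⟩
  linear_combination 5 * eta 5 * eta 10 ^ 2 * etaInv 2 ^ 2 * ((eta 2 * etaInv 2) ^ 2 * q1 + q2) +
    50 * X * eta 10 ^ 5 * etaInv 1 ^ 3 * etaInv 2 * q5 + 50 * X * eta 10 ^ 5 * hθ +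
    50 * X * eta 10 ^ 5 * theta * hh1 - 25 * eta 2 ^ 8 * eta 5 ^ 2 * hh1 -
    25 * eta 2 ^ 8 * eta 5 * e5

/-- For β = E_2^5/E_10 the square (β - 1)^2 is divisible by 25, so 1/E_2^2 is congruent to 2
E_2^3/E_10 - E_2^8/E_10^2. The component of E_2^8 is itself divisible by 125. -/
theorem exists_U_one_etaInv_two_sq : ∃ h, U 1 (etaInv 2 ^ 2) =
    10 * (X * eta 10 ^ 3 * etaInv 2) + 25 * h := by
  obtain ⟨h2, hh2⟩ := exists_eta_two_pow_five
  obtain ⟨h3, hh3⟩ := exists_U_one_eta_two_pow_eight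
  have e2 := eta_mul_etaInv two_pos
  have e10 := eta_mul_etaInv (show 0 < 10 by norm_num)
  have key : etaInv 2 ^ 2 = 2 * (etaInv 10 * eta 2 ^ 3) - etaInv 10 ^ 2 * eta 2 ^ 8 +
      25 * (h2 ^ 2 * etaInv 10 ^ 2 * etaInv 2 ^ 2) := by
    have hβ : eta 2 ^ 5 * etaInv 10 - 1 = 5 * h2 * etaInv 10 := by
      linear_combination etaInv 10 * hh2 + e10
    have q2 : (eta 2 * etaInv 2) ^ 2 = 1 := by rw [e2, one_pow]
    linear_combination etaInv 2 ^ 2 * (eta 2 ^ 5 * etaInv 10 - 1 + 5 * h2 * etaInv 10) * hβ +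
      (2 * etaInv 10 * eta 2 ^ 3 - etaInv 10 ^ 2 * eta 2 ^ 8) * q2
  have k1 := U_exf_mul (etaInv 2) (eta 2 ^ 3) (j := 1) (by norm_num)
  have k2 := U_exf_mul (etaInv 2 ^ 2) (eta 2 ^ 8) (j := 1) (by norm_num)
  rw [exf_etaInv_two] at k1
  rw [map_pow, exf_etaInv_two] at k2
  rw [key, map_add, map_sub, U_ofNat_mul 2 _ (by norm_num), U_ofNat_mul 25 _ (by norm_num), k1, k2,
    hh3, U_eta_two_cube.1]
  exact ⟨U 1 (h2 ^ 2 * etaInv 10 ^ 2 * etaInv 2 ^ 2) - 5 * etaInv 2 ^ 2 * h3, by ring⟩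

theorem exists_U_one_U_four_oddPart : ∃ h, U 1 (U 4 oddPart) =
    50 * (eta 10 ^ 3 * (X * (eta 1 * eta 2))) + 50 * (eta 2 ^ 5 * exf theta * etaInv 1) +
      125 * h := by
  obtain ⟨h0, hh0⟩ := exists_U_four_oddPart
  obtain ⟨h1, hh1⟩ := exists_U_one_etaInv_two_sq
  obtain ⟨h3, hh3⟩ := exists_U_one_eta_two_pow_eight
  have e2 := eta_mul_etaInv two_pos
  have k1 := U_exf_mul (eta 1 * eta 2 ^ 2) (etaInv 2 ^ 2) (j := 1) (by norm_num)
  have k2 := U_exf_mul (eta 2 ^ 5 * etaInv 1) (X * theta) (j := 1) (by norm_num)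
  have k3 := U_exf_mul (eta 1) (eta 2 ^ 8) (j := 1) (by norm_num)
  rw [map_mul exf, map_pow exf, exf_eta_two, exf_eta_one] at k1
  rw [map_mul exf, map_pow exf, exf_eta_two, exf_etaInv_one] at k2
  rw [exf_eta_one] at k3
  rw [hh0, map_add, map_sub, map_add, U_ofNat_mul 5 _ (by norm_num),
    U_ofNat_mul 50 _ (by norm_num), U_ofNat_mul 25 _ (by norm_num),
    U_ofNat_mul 125 _ (by norm_num), k1, k2, k3, (U_X_mul _).2.1, U_theta.1, hh1, hh3]
  refine ⟨U 1 h0 + eta 1 * eta 2 ^ 2 * h1 - 25 * eta 1 * h3, ?_⟩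
  linear_combination 50 * eta 1 * eta 2 * X * eta 10 ^ 3 * e2

/-- In the second term E_2^5/E_1 may be replaced modulo 5 by E_10 E_1^4/E_5. Component 4 of E_1^4 is
a multiple of 5, so this term disappears modulo 125. -/
theorem exists_U_four_U_one_U_four_oddPart : ∃ h, U 4 (U 1 (U 4 oddPart)) =
    50 * (eta 5 * eta 10 * eta 2 ^ 3) + 125 * h := by
  obtain ⟨h0, hh0⟩ := exists_U_one_U_four_oddPart
  obtain ⟨h1, hh1⟩ := exists_etaInv_one_pow_five
  obtain ⟨h2, hh2⟩ := exists_eta_two_pow_five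
  have e1 := eta_mul_etaInv one_pos
  have e1' : (eta 1 * etaInv 1) ^ 4 = 1 := by rw [e1, one_pow]
  have key : eta 2 ^ 5 * exf theta * etaInv 1 = eta 10 * exf theta * etaInv 5 * eta 1 ^ 4 +
      5 * (eta 10 * exf theta * eta 1 ^ 4 * h1 + h2 * exf theta * etaInv 1) := by
    linear_combination exf theta * etaInv 1 * hh2 + exf theta * eta 10 * eta 1 ^ 4 * hh1 -
      eta 10 * exf theta * etaInv 1 * e1'
  have k1 := U_exf_mul (eta 2 ^ 3) (X * (eta 1 * eta 2)) (j := 4) (by norm_num)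
  have k2 := U_exf_mul (eta 2 * theta * etaInv 1) (eta 1 ^ 4) (j := 4) (by norm_num)
  rw [map_pow, exf_eta_two] at k1
  rw [map_mul exf, map_mul exf, exf_eta_two, exf_etaInv_one] at k2
  rw [hh0, key, map_add, map_add, U_ofNat_mul 50 _ (by norm_num),
    U_ofNat_mul 50 _ (by norm_num), U_ofNat_mul 125 _ (by norm_num), map_add,
    U_ofNat_mul 5 _ (by norm_num), k1, k2, (U_X_mul _).2.2.2.2, U_three_eta_one_mul_eta_two,
    U_eta_pow_four.2.2.2.2]
  refine ⟨U 4 h0 + 2 * (U 4 (eta 10 * exf theta * eta 1 ^ 4 * h1 + h2 * exf theta * etaInv 1) -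
    eta 2 * theta * etaInv 1 * eta 5 ^ 4), ?_⟩
  ring

theorem exists_U_U_four_U_one_U_four_oddPart {r : ℕ} (hr : r = 1 ∨ r = 3 ∨ r = 4) :
    ∃ h, U r (U 4 (U 1 (U 4 oddPart))) = 125 * h := by
  obtain ⟨h0, hh0⟩ := exists_U_four_U_one_U_four_oddPart
  have hr5 : r < 5 := by omega
  have k1 := U_exf_mul (eta 1 * eta 2) (eta 2 ^ 3) hr5
  rw [map_mul exf, exf_eta_two, exf_eta_one] at k1
  rw [hh0, map_add, U_ofNat_mul 50 _ hr5, U_ofNat_mul 125 _ hr5, k1]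
  obtain ⟨u1, u3, u4⟩ := U_eta_two_cube
  rcases hr with rfl | rfl | rfl
  · rw [u1]
    exact ⟨2 * (eta 1 * eta 2 * (X * eta 10 ^ 3)) + U 1 h0, by ring⟩
  · rw [u3]
    exact ⟨U 3 h0, by ring⟩
  · rw [u4]
    exact ⟨U 4 h0, by ring⟩

end RamanujanPhi

theorem corollary3p4 (n r : ℕ) (hr : r = 1 ∨ r = 3 ∨ r = 4) :
    RamanujanPhi.a (1250 * n + 250 * r + 219) ≡ 0 [ZMOD 125] := by
  obtain ⟨h, hh⟩ := RamanujanPhi.exists_U_U_four_U_one_U_four_oddPart hr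
  have h1 := congrArg (PowerSeries.coeff n) hh
  simp only [RamanujanPhi.coeff_U, RamanujanPhi.oddPart, PowerSeries.coeff_mk] at h1
  rw [show (125 : PowerSeries ℤ) = PowerSeries.C 125 by simp, PowerSeries.coeff_C_mul] at h1
  -- The outer `2 * _ + 1` selects the odd part; the residues 4, 1, 4, r, read from outside in, are
  -- the four extractions in their order of application.
  rw [show 1250 * n + 250 * r + 219 = 2 * (5 * (5 * (5 * (5 * n + r) + 4) + 1) + 4) + 1 by ring, h1]
  exact Int.modEq_zero_iff_dvd.mpr (Dvd.intro _ rfl)
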